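/- **Setting.** Let $K$ be a field of characteristic $0$ (for instance $\mathbb C$). "Functions" of $x=(x_1,x_2,\dots)$, $y=(y_1,y_2,\dots)$ are formal power series over $K$; $\lambda,\mu,z$ are formal parameters, and identities between series in them hold coefficientwise. Put $\xi(x,z)=\sum_{n\ge1}x_nz^n$, $[z]=(z,\tfrac{z^2}{2},\tfrac{z^3}{3},\dots)$ and $\Lambda=(\delta_{j-i,1})_{i,j\in\mathbb Z}$. For a $\mathbb Z\times\mathbb Z$ matrix $P$ let $P_u$ be its upper triangular part (with diagonal), $P_l$ its strictly lower triangular part, $(P_1,P_2)_+=(P_{1u}+P_{2l},P_{1u}+P_{2l})$ and $(P_1,P_2)_-=(P_{1l}-P_{2l},P_{2u}-P_{1u})$; let $(q\otimes r)_{ij}=q_ir_j$. Let $W_1=S_1e^{\xi(x,\Lambda)}$, $W_2=S_2e^{\xi(y,\Lambda^{-1})}$, where $S_1$ is lower triangular with unit diagonal and $S_2$ is upper triangular with invertible diagonal, and let $L_1=S_1\Lambda S_1^{-1}$, $L_2=S_2\Lambda^{-1}S_2^{-1}$. Assume that $W=(W_1,W_2)$ solves the Toda lattice hierarchy, $\partial_{x_n}W=(L_1^n,0)_+W$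 and $\partial_{y_n}W=(0,L_2^n)_+W$ for all $n\ge1$. Let $\Psi_i(z)=W_i\chi(z)$ and $\Psi_i^*(z)=(W_i^{-1})^T\chi(z^{-1})$, where $\chi(z)=(z^n)_{n\in\mathbb Z}$, be the wave and adjoint wave functions, and let $\tau=(\tau(s;x,y))_{s\in\mathbb Z}$ be a tau function, that is, all $\tau(s)$ are invertible and $$\Psi_1(s;z)=\tfrac{\tau(s;x-[z^{-1}],y)}{\tau(s;x,y)}e^{\xi(x,z)}z^s,\qquad \Psi_2(s;z)=\tfrac{\tau(s+1;x,y-[z])}{\tau(s;x,y)}e^{\xi(y,z^{-1})}z^s,$$ $$\Psi_1^*(s;z)=\tfrac{\tau(s+1;x+[z^{-1}],y)}{\tau(s+1;x,y)}e^{-\xi(x,z)}z^{-s},\qquad \Psi_2^*(s;z)=\tfrac{\tau(s;x,y+[z])}{\tau(s+1;x,y)}e^{-\xi(y,z^{-1})}z^{-s}.$$ The squared eigenfunction symmetries are the flows $$\partial_{\alpha_1}W=\big(\lambda^{-1}\Psi_1(\mu)\otimes\Psi_1^*(\lambda),0\big)_-W,\qquad \partial_{\alpha_2}W=\big(0,\lambda^{-1}\Psi_2(\mu^{-1})\otimes\Psi_2^*(\lambda^{-1})\big)_-W.$$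 With $M_1=W_1\varepsilon W_1^{-1}$, $M_2=W_2\varepsilon^*W_2^{-1}$, $\varepsilon=\mathrm{diag}[s]\Lambda^{-1}$, $\varepsilon^*=-\varepsilon^T+\Lambda$, the additional symmetries are $$\partial_{x^*_{m,l}}W=-(M_1^mL_1^l,0)_-W,\qquad \partial_{y^*_{m,l}}W=-(0,M_2^mL_2^l)_-W\qquad(m\ge0,\ l\in\mathbb Z).$$ For such a flow $\partial W_i=A_iW_i$ one has $\partial\Psi_i=A_i\Psi_i$ and $\partial\Psi_i^*=-A_i^T\Psi_i^*$. Its action on the tau function is a family $\partial\tau=(\partial\tau(s))_s$ for which the four relations above stay valid when $\partial$, as a derivation commuting with the shifts of $x$ and $y$, is applied to them. Since $\tau$ is determined by $W$ only up to a constant factor, $\partial\tau$ is determined only up to adding $c\,\tau$ with $c$ a constant (independent of $s,x,y$; a formal series over $K$ in the parameters for $\alpha_1,\alpha_2$). The equalities for $\partial\tau$ below mean: the right-hand side is a value of $\partial\tau$, and every value of $\partial\tau$ differs from it by such a term $c\,\tau$. Finally let $$X(x,\lambda,\mu)=\tfrac1\lambda e^{\xi(x+[\lambda^{-1}],\mu)-\xi(x,\lambda)}e^{\sum_{l\ge1}\frac1l(\lambda^{-l}-\mu^{-l})\partial_{x_l}},$$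 $\mathbb X(x,\lambda,\mu)=\big((\mu/\lambda)^nX(x,\lambda,\mu)\big)_{n\in\mathbb Z}$ and $\tilde{\mathbb X}(y,\lambda,\mu)=\big((\lambda/\mu)^nX(y,\lambda,\mu)\big)_{n\in\mathbb Z}$. **Proposition.** 1. $\displaystyle \partial_{\alpha_1}\tau=\mathbb X(x,\lambda,\mu)\,\tau$ and $\displaystyle \partial_{\alpha_2}\tau=\frac{\mu}{\lambda}\,\tilde{\mathbb X}(y,\lambda,\mu)\,\tau.$ 2. These symmetries generate the additional symmetries: expanding at $\mu=\lambda$ (substitute $\mu=\lambda+t$ and expand in powers of $t$), one has on the wave matrices, coefficientwise in $t^m\lambda^{-k-m-1}$, $$-\partial_{\alpha_1}=\sum_{m\ge0}\frac{(\mu-\lambda)^m}{m!}\sum_{k\in\mathbb Z}\lambda^{-k-m-1}\partial_{x^*_{m,m+k}},\qquad -\partial_{\alpha_2}=\sum_{m\ge0}\frac{(\mu-\lambda)^m}{m!}\sum_{k\in\mathbb Z}\lambda^{-k-m-1}\partial_{y^*_{m,m+k}}.$$ 3. (Adler–Shiota–van Moerbeke formula.) For all $m\ge0$ and $k\in\mathbb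 Z$, with $\mu=\lambda+t$, $$\partial_{x^*_{m,m+k}}\tau=m!\,\big[t^{m+1}\lambda^{-k-m-1}\big]\,(\lambda-\mu)\,\mathbb X(x,\lambda,\mu)\tau,\qquad \partial_{y^*_{m,m+k}}\tau=m!\,\big[t^{m+1}\lambda^{-k-m-1}\big]\,(\lambda-\mu)\tfrac{\mu}{\lambda}\tilde{\mathbb X}(y,\lambda,\mu)\tau.$$ -/

import Mathlib

open MvPowerSeries

namespace Toda

/-- The time variables of the hierarchy: `(false, i)` is `x_{i+1}`, `(true, i)` is `y_{i+1}`. -/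
abbrev Var : Type := Bool × ℕ

/-- Functions of `x = (x₁, x₂, …)` and `y = (y₁, y₂, …)`: formal power series over `K`. -/
abbrev Fn (K : Type*) : Type _ := MvPowerSeries Var K

/-- Doubly infinite matrices `(P_{ij})_{i,j ∈ ℤ}` with entries functions of `x, y`. -/
abbrev Mat (K : Type*) : Type _ := ℤ → ℤ → Fn K

/-- Formal series `∑_{k ∈ ℤ} f_k z^k`, written as `k ↦ f_k`. -/
abbrev Ser (K : Type*) : Type _ := ℤ → Fn K

/-- Formal series `∑_{a,b ∈ ℤ} f_{a,b} λ^a μ^b`, written as `a b ↦ f_{a,b}`. -/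
abbrev Ser₂ (K : Type*) : Type _ := ℤ → ℤ → Fn K

noncomputable section

variable {K : Type*} [Field K]

/-- The sum of a (possibly infinite) family of power series in which each monomial in `x, y`
occurs only finitely often. -/
def lsum {ι : Type*} (f : ι → Fn K) : Fn K :=
  fun d => ∑ᶠ i, coeff d (f i)

/-! ### Formal series in spectral parameters -/

/-- Product of series in `z`. -/
def Ser.mul (f g : Ser K) : Ser K :=
  fun k => lsum fun i : ℤ => f i * g (k - i)

/-- `f(z) ↦ z^s f(z)`. -/
def Ser.zpow_mul (s : ℤ) (f : Ser K) : Ser K :=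
  fun k => f (k - s)

/-- `f(z) ↦ f(z⁻¹)`. -/
def Ser.flip (f : Ser K) : Ser K :=
  fun k => f (-k)

/-- Product of series in `λ, μ`. -/
def Ser₂.mul (f g : Ser₂ K) : Ser₂ K :=
  fun a b => lsum fun i : ℤ × ℤ => f i.1 i.2 * g (a - i.1) (b - i.2)

/-- `f(λ, μ) ↦ λ^p μ^q f(λ, μ)`. -/
def Ser₂.mon_mul (p q : ℤ) (f : Ser₂ K) : Ser₂ K :=
  fun a b => f (a - p) (b - q)

/-- `f(λ, μ) ↦ (λ - μ) f(λ, μ)`. -/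
def Ser₂.diff_mul (f : Ser₂ K) : Ser₂ K :=
  fun a b => Ser₂.mon_mul 1 0 f a b - Ser₂.mon_mul 0 1 f a b

/-- The coefficient of `(μ - λ)^m λ^c` in the expansion of `f(λ, μ)` at `μ = λ`, that is, the
coefficient of `t^m λ^c` after substituting `μ^b = (λ + t)^b = ∑_m (b choose m) λ^{b-m} t^m`. -/
def Ser₂.diagCoeff (m : ℕ) (c : ℤ) (f : Ser₂ K) : Fn K :=
  lsum fun b : ℤ => (Ring.choose b m : ℤ) • f (c + m - b) b

/-- The exponential `e^{ε ξ}` as a series in `z`, where `ξ = ξ(x, z) = ∑_{n ≥ 1} x_n z^n` for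
`v = false` and `ξ = ξ(y, z)` for `v = true`: the coefficient of `∏ x_n^{d_n}` is
`z^{∑ n d_n} ∏ ε^{d_n} / d_n!`. -/
def expXi (v : Bool) (ε : K) : Ser K := fun k d =>
  open Classical in
  if (∀ i : ℕ, d (!v, i) = 0) ∧ (d.sum fun u e => ((u.2 : ℤ) + 1) * (e : ℤ)) = k then
    d.prod fun _ e => ε ^ e / (e.factorial : K)
  else 0

/-- The substitution `x ↦ x + c [ζ]` (for `v = false`), or `y ↦ y + c [ζ]` (for `v = true`), where
`[ζ] = (ζ, ζ²/2, ζ³/3, …)`; the formal parameter `ζ` is the variable `none`. -/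
def shiftVars (v : Bool) (c : K) (u : Var) : MvPowerSeries (Option Var) K :=
  X (some u) + if u.1 = v then C (c / ((u.2 : K) + 1)) * X none ^ (u.2 + 1) else 0

/-- The substitution above is admissible for formal power series. -/
theorem hasSubst_shiftVars (v : Bool) (c : K) : HasSubst (shiftVars v c) := by
  classical
  refine ⟨fun u => ?_, fun d => ?_⟩
  · have h : constantCoeff (shiftVars v c u) = 0 := by
      unfold shiftVars
      split_ifs <;> simp
    rw [h]
    exact IsNilpotent.zero
  · have hsub : {u | coeff d (shiftVars v c u) ≠ 0} ⊆
        ({u | Finsupp.single (some u) 1 = d} ∪ {u | Finsupp.single none (u.2 + 1) = d}) := by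
      intro u hu
      by_contra hcon
      simp only [Set.mem_union, Set.mem_ofPred_eq, not_or] at hcon
      apply hu
      have h1 : coeff d (X (some u) : MvPowerSeries (Option Var) K) = 0 := by
        rw [coeff_X, if_neg (fun h => hcon.1 h.symm)]
      have h2 : coeff d (X none ^ (u.2 + 1) : MvPowerSeries (Option Var) K) = 0 := by
        rw [coeff_X_pow, if_neg (fun h => hcon.2 h.symm)]
      unfold shiftVars
      split_ifs <;> simp [h1, h2, coeff_C_mul]
    refine Set.Finite.subset (Set.Finite.union ?_ ?_) hsub
    · refine Set.Subsingleton.finite ?_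
      intro u hu w hw
      have := (hu : _ = d).trans (hw : _ = d).symm
      have h3 := (Finsupp.single_left_injective (one_ne_zero)) this
      exact Option.some.inj h3
    · have : {u : Var | Finsupp.single none (u.2 + 1) = d} ⊆
          (Set.univ : Set Bool) ×ˢ {n : ℕ | n + 1 = d none} := by
        rintro ⟨w, n⟩ hu
        have hu' : Finsupp.single none (n + 1) = d := hu
        refine ⟨trivial, ?_⟩
        simp [← hu']
      refine Set.Finite.subset (Set.Finite.prod Set.finite_univ ?_) this
      refine Set.Subsingleton.finite ?_
      intro a ha b hb
      simp only [Set.mem_ofPred_eq] at ha hb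
      omega

/-- `f(x + c[ζ], y)` (for `v = false`), or `f(x, y + c[ζ])` (for `v = true`), as a series in `ζ`. -/
def shift (v : Bool) (c : K) (f : Fn K) : Ser K := fun k d =>
  if 0 ≤ k then
    coeff (d.mapDomain some + Finsupp.single none k.toNat) (subst (shiftVars v c) f)
  else 0

/-! ### Infinite matrices -/

/-- Matrix product. -/
def mmul (P Q : Mat K) : Mat K :=
  fun i j => lsum fun k : ℤ => P i k * Q k j

/-- The identity matrix. -/
def mone : Mat K := fun i j => if i = j then 1 else 0

/-- Powers of a matrix. -/
def mpow (P : Mat K) : ℕ → Mat K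
  | 0 => mone
  | m + 1 => mmul P (mpow P m)

/-- `Λ^n`, where `Λ = (δ_{j-i,1})_{i,j}`. -/
def shiftMat (n : ℤ) : Mat K := fun i j => if j - i = n then 1 else 0

/-- Upper triangular part, including the diagonal. -/
def upper (P : Mat K) : Mat K := fun i j => if i ≤ j then P i j else 0

/-- Strictly lower triangular part. -/
def lower (P : Mat K) : Mat K := fun i j => if j < i then P i j else 0

/-- Pairs of matrices. -/
abbrev MatPair (K : Type*) : Type _ := Mat K × Mat K

/-- The projection `(P₁, P₂)₊ = (P₁ᵤ + P₂ₗ, P₁ᵤ + P₂ₗ)`. -/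
def plusPart (P : MatPair K) : MatPair K :=
  (upper P.1 + lower P.2, upper P.1 + lower P.2)

/-- The projection `(P₁, P₂)₋ = (P₁ₗ - P₂ₗ, P₂ᵤ - P₁ᵤ)`. -/
def minusPart (P : MatPair K) : MatPair K :=
  (lower P.1 - lower P.2, upper P.2 - upper P.1)

/-- The Kronecker product `(q ⊗ r)_{ij} = q_i r_j` of `q(μ)` and `r(λ)`, times `λ⁻¹`, as a series
in `λ, μ` with matrix coefficients. -/
def kron (q r : ℤ → Ser K) (a b : ℤ) : Mat K :=
  fun i j => Ser₂.mon_mul (-1) 0 (fun a b => r j a * q i b) a b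

/-! ### Wave matrices and wave functions -/

/-- A pair `S = (S₁, S₂)`, together with the inverses: `S₁` is lower triangular with unit diagonal
and `S₂` is upper triangular with invertible diagonal (the last follows from `S₂ S₂⁻¹ = 1`). The
triangular inverses of such matrices exist and are unique. -/
structure Dressing (K : Type*) [Field K] where
  S₁ : Mat K
  S₂ : Mat K
  S₁inv : Mat K
  S₂inv : Mat K
  S₁_lower : ∀ i j, i < j → S₁ i j = 0
  S₁_diag : ∀ i, S₁ i i = 1
  S₂_upper : ∀ i j, j < i → S₂ i j = 0
  S₁inv_lower : ∀ i j, i < j → S₁inv i j = 0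
  S₂inv_upper : ∀ i j, j < i → S₂inv i j = 0
  S₁_mul_inv : mmul S₁ S₁inv = mone
  S₁_inv_mul : mmul S₁inv S₁ = mone
  S₂_mul_inv : mmul S₂ S₂inv = mone
  S₂_inv_mul : mmul S₂inv S₂ = mone

namespace Dressing

variable (S : Dressing K)

/-- `W₁ = S₁ e^{ξ(x, Λ)}`. -/
def W₁ : Mat K := mmul S.S₁ fun i j => expXi false 1 (j - i)

/-- `W₂ = S₂ e^{ξ(y, Λ⁻¹)}`. -/
def W₂ : Mat K := mmul S.S₂ fun i j => expXi true 1 (i - j)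

/-- `W₁⁻¹ = e^{-ξ(x, Λ)} S₁⁻¹`. -/
def W₁inv : Mat K := mmul (fun i j => expXi false (-1) (j - i)) S.S₁inv

/-- `W₂⁻¹ = e^{-ξ(y, Λ⁻¹)} S₂⁻¹`. -/
def W₂inv : Mat K := mmul (fun i j => expXi true (-1) (i - j)) S.S₂inv

/-- `L₁^n = S₁ Λ^n S₁⁻¹` for `n ∈ ℤ`. -/
def L₁ (n : ℤ) : Mat K := mmul (mmul S.S₁ (shiftMat n)) S.S₁inv

/-- `L₂^n = S₂ Λ^{-n} S₂⁻¹` for `n ∈ ℤ`. -/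
def L₂ (n : ℤ) : Mat K := mmul (mmul S.S₂ (shiftMat (-n))) S.S₂inv

/-- The Toda lattice hierarchy, in terms of the wave matrices `W = (W₁, W₂)`:
`∂_{x_n} W = (L₁^n, 0)₊ W` and `∂_{y_n} W = (0, L₂^n)₊ W` for `n = 1, 2, …` (here `n = i + 1`). -/
def IsTodaSolution : Prop :=
  ∀ i : ℕ,
    (fun s t => pderiv K ((false, i) : Var) (S.W₁ s t)) =
        mmul (plusPart (S.L₁ (i + 1), 0)).1 S.W₁ ∧
    (fun s t => pderiv K ((false, i) : Var) (S.W₂ s t)) =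
        mmul (plusPart (S.L₁ (i + 1), 0)).2 S.W₂ ∧
    (fun s t => pderiv K ((true, i) : Var) (S.W₁ s t)) =
        mmul (plusPart (0, S.L₂ (i + 1))).1 S.W₁ ∧
    (fun s t => pderiv K ((true, i) : Var) (S.W₂ s t)) =
        mmul (plusPart (0, S.L₂ (i + 1))).2 S.W₂

/-- `Ψ₁(n; x, y; z) = (W₁ χ(z))_n = ∑_k (W₁)_{n k} z^k`, where `χ(z) = (z^i)_i`. -/
def Ψ₁ (n : ℤ) : Ser K := fun k => S.W₁ n k

/-- `Ψ₂(n; x, y; z) = (W₂ χ(z))_n`. -/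
def Ψ₂ (n : ℤ) : Ser K := fun k => S.W₂ n k

/-- `Ψ₁*(n; x, y; z) = ((W₁⁻¹)ᵀ χ(z⁻¹))_n = ∑_k (W₁⁻¹)_{k n} z^{-k}`. -/
def Ψ₁star (n : ℤ) : Ser K := fun k => S.W₁inv (-k) n

/-- `Ψ₂*(n; x, y; z) = ((W₂⁻¹)ᵀ χ(z⁻¹))_n`. -/
def Ψ₂star (n : ℤ) : Ser K := fun k => S.W₂inv (-k) n

end Dressing

/-! ### Tau functions -/

/-- `τ(s; x - [z⁻¹], y) e^{ξ(x, z)} z^s`. -/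
def tauSide₁ (τ : ℤ → Fn K) (s : ℤ) : Ser K :=
  Ser.zpow_mul s (Ser.mul (Ser.flip (shift false (-1) (τ s))) (expXi false 1))

/-- `τ(s + 1; x, y - [z]) e^{ξ(y, z⁻¹)} z^s`. -/
def tauSide₂ (τ : ℤ → Fn K) (s : ℤ) : Ser K :=
  Ser.zpow_mul s (Ser.mul (shift true (-1) (τ (s + 1))) (Ser.flip (expXi true 1)))

/-- `τ(s + 1; x + [z⁻¹], y) e^{-ξ(x, z)} z^{-s}`. -/
def tauSide₁star (τ : ℤ → Fn K) (s : ℤ) : Ser K :=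
  Ser.zpow_mul (-s) (Ser.mul (Ser.flip (shift false 1 (τ (s + 1)))) (expXi false (-1)))

/-- `τ(s; x, y + [z]) e^{-ξ(y, z⁻¹)} z^{-s}`. -/
def tauSide₂star (τ : ℤ → Fn K) (s : ℤ) : Ser K :=
  Ser.zpow_mul (-s) (Ser.mul (shift true 1 (τ s)) (Ser.flip (expXi true (-1))))

/-- `τ = (τ(s; x, y))_{s ∈ ℤ}` is a tau function of the wave matrices:
`Ψ₁(s) = τ(s; x - [z⁻¹], y) / τ(s) · e^{ξ(x, z)} z^s`,
`Ψ₂(s) = τ(s + 1; x, y - [z]) / τ(s) · e^{ξ(y, z⁻¹)} z^s`,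
`Ψ₁*(s) = τ(s + 1; x + [z⁻¹], y) / τ(s + 1) · e^{-ξ(x, z)} z^{-s}`,
`Ψ₂*(s) = τ(s; x, y + [z]) / τ(s + 1) · e^{-ξ(y, z⁻¹)} z^{-s}`,
with all `τ(s)` invertible. -/
structure IsTau (S : Dressing K) (τ : ℤ → Fn K) : Prop where
  unit : ∀ s, IsUnit (τ s)
  wave₁ : ∀ s k, τ s * S.Ψ₁ s k = tauSide₁ τ s k
  wave₂ : ∀ s k, τ s * S.Ψ₂ s k = tauSide₂ τ s k
  wave₁star : ∀ s k, τ (s + 1) * S.Ψ₁star s k = tauSide₁star τ s k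
  wave₂star : ∀ s k, τ (s + 1) * S.Ψ₂star s k = tauSide₂star τ s k

/-- Let a flow `∂` act on the wave matrices by `∂W₁ = A₁ W₁`, `∂W₂ = A₂ W₂`, hence on the wave
functions by `∂Ψᵢ = Aᵢ Ψᵢ` and on the adjoint ones by `∂Ψᵢ* = -Aᵢᵀ Ψᵢ*`. The family
`σ = (σ(s; x, y))_s` is a value of `∂τ` if the relations between `τ` and the wave functions are
preserved, i.e. if they still hold after `∂` is applied to both sides with the Leibniz rule, where
`∂τ = σ` and `∂` commutes with shifts of `x, y`. -/
structure IsTauDeriv (S : Dressing K) (τ : ℤ → Fn K) (A : MatPair K) (σ : ℤ → Fn K) : Prop where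
  wave₁ : ∀ s k, σ s * S.Ψ₁ s k + τ s * (lsum fun i : ℤ => A.1 s i * S.Ψ₁ i k) = tauSide₁ σ s k
  wave₂ : ∀ s k, σ s * S.Ψ₂ s k + τ s * (lsum fun i : ℤ => A.2 s i * S.Ψ₂ i k) = tauSide₂ σ s k
  wave₁star : ∀ s k, σ (s + 1) * S.Ψ₁star s k
    - τ (s + 1) * (lsum fun i : ℤ => A.1 i s * S.Ψ₁star i k) = tauSide₁star σ s k
  wave₂star : ∀ s k, σ (s + 1) * S.Ψ₂star s k
    - τ (s + 1) * (lsum fun i : ℤ => A.2 i s * S.Ψ₂star i k) = tauSide₂star σ s k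

/-! ### Squared eigenfunction symmetries and additional symmetries -/

/-- The flow `∂_{α₁} W = (λ⁻¹ Ψ₁(μ) ⊗ Ψ₁*(λ), 0)₋ W`: the coefficient of `λ^a μ^b`. -/
def alphaFlow₁ (S : Dressing K) (a b : ℤ) : MatPair K :=
  minusPart (kron S.Ψ₁ S.Ψ₁star a b, 0)

/-- The flow `∂_{α₂} W = (0, λ⁻¹ Ψ₂(μ⁻¹) ⊗ Ψ₂*(λ⁻¹))₋ W`: the coefficient of `λ^a μ^b`. -/
def alphaFlow₂ (S : Dressing K) (a b : ℤ) : MatPair K :=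
  minusPart (0, kron (fun n => Ser.flip (S.Ψ₂ n)) (fun n => Ser.flip (S.Ψ₂star n)) a b)

/-- `ε = diag[s] Λ⁻¹`. -/
def orlov₁ : Mat K := fun i j => if j = i - 1 then (i : Fn K) else 0

/-- `ε* = -εᵀ + Λ`. -/
def orlov₂ : Mat K := fun i j => -orlov₁ j i + shiftMat 1 i j

/-- The Orlov–Shulman matrix `M₁ = W₁ ε W₁⁻¹`. -/
def Dressing.M₁ (S : Dressing K) : Mat K := mmul (mmul S.W₁ orlov₁) S.W₁inv

/-- The Orlov–Shulman matrix `M₂ = W₂ ε* W₂⁻¹`. -/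
def Dressing.M₂ (S : Dressing K) : Mat K := mmul (mmul S.W₂ orlov₂) S.W₂inv

/-- The additional symmetry `∂_{x*_{m,l}} W = -(M₁^m L₁^l, 0)₋ W`. -/
def addFlow₁ (S : Dressing K) (m : ℕ) (l : ℤ) : MatPair K :=
  -minusPart (mmul (mpow S.M₁ m) (S.L₁ l), 0)

/-- The additional symmetry `∂_{y*_{m,l}} W = -(0, M₂^m L₂^l)₋ W`. -/
def addFlow₂ (S : Dressing K) (m : ℕ) (l : ℤ) : MatPair K :=
  -minusPart (0, mmul (mpow S.M₂ m) (S.L₂ l))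

/-! ### Vertex operators -/

/-- `X(x, λ, μ) f = λ⁻¹ e^{ξ(x + [λ⁻¹], μ) - ξ(x, λ)} f(x + [λ⁻¹] - [μ⁻¹], y)` for `v = false`, and
the same with `x` and `y` exchanged, `X(y, λ, μ) f`, for `v = true`. -/
def vertexOp (v : Bool) (f : Fn K) : Ser₂ K :=
  Ser₂.mon_mul (-1) 0 <|
    Ser₂.mul
      (Ser₂.mul
        (fun a b => Ser.flip (shift v 1 (expXi v 1 b)) a)
        (fun a b => if b = 0 then expXi v (-1) a else 0))
      (fun a b => Ser.flip (shift v (-1) (Ser.flip (shift v 1 f) a)) b)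

/-- `𝕏(x, λ, μ) τ = ((μ/λ)^n X(x, λ, μ) τ(n))_n`. -/
def vertexX (τ : ℤ → Fn K) (n : ℤ) : Ser₂ K :=
  Ser₂.mon_mul (-n) n (vertexOp false (τ n))

/-- `𝕏̃(y, λ, μ) τ = ((λ/μ)^n X(y, λ, μ) τ(n))_n`. -/
def vertexXtilde (τ : ℤ → Fn K) (n : ℤ) : Ser₂ K :=
  Ser₂.mon_mul n (-n) (vertexOp true (τ n))

/-- `(μ/λ) 𝕏̃(y, λ, μ) τ`. -/
def vertexY (τ : ℤ → Fn K) (n : ℤ) : Ser₂ K :=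
  Ser₂.mon_mul (-1) 1 (vertexXtilde τ n)

end

end Toda

open MvPowerSeries

namespace Toda

noncomputable section

variable {K : Type*} [Field K]

section


/-! ### Locally finite sums -/

/-! Write `θ_s = τ_s Ψ(s; μ)` and `φ_s = τ_s Ψ*(s-1; λ)`, coefficientwise in `λ` and `μ`, so that
the kernel `Ψ_i(μ) Ψ*_j(λ)` of a squared eigenfunction flow is `θ_i φ_{j+1} / (τ_i τ_{j+1})`. The
proof turns every statement into finite linear or bilinear relations under Miwa shifts `x ↦ x -
[ζ]`, `y ↦ y - [ζ]`.

The hierarchy says that `W₁` and `W₂` have the same logarithmic derivatives in each time, given by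
band matrices. The shift is the exponential of a combination of such derivatives, so it too
multiplies both wave matrices on the left by one common matrix `B` (`Common.hopM`). For a shift of
`x`, the factor `e^{ξ(x,Λ)}` contributes `1 - ζΛ`. From `W₁`, `B = S₁(x-[ζ]) (1-ζΛ) S₁⁻¹` has at
most one diagonal above the main one; from `W₂`, `B = S₂(x-[ζ]) S₂⁻¹` is upper triangular. Hence `B`
has just two diagonals, with entries ratios of tau functions (`bidiagonal`). Acting on `W₁`, `W₂`
and their inverses, `B` gives three-term relations for `θ` and `φ` (`IsWave`, `IsAdjWave`). Acting
on `S₁` and `S₂`, whose entries are shifts of `τ`, it gives bilinear identities for `τ` (`IsHirota`,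
`IsMixedHirota`). The reflection `s ↦ 1 - s` exchanges the roles of `x` and `y`
(`IsSystem.reflect`).

Eliminating between these relations gives identities in which `τ` and `θ` are shifted twice (`fay₁`
to `fay₄`). The vertex operator factors: `X(x,λ,μ)τ` is `λ⁻¹ e^{-ξ(x,λ)}` times the shift by `[λ⁻¹]`
of `e^{ξ(x,μ)} τ(x-[μ⁻¹])`, and the latter is `θ` up to a power of `μ` (`vertexOp_eq`). Summing the
identities against `e^{-ξ}` gives the two relations of `IsFlow` between `σ = 𝕏τ`, `τ`, `θ` and `φ`.
Conversely, by the three-term relations the sums `∑ Ψ*(i) S(i,j)` over half-lines telescope, so the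
linearized tau relations for the kernel `Ψ ⊗ Ψ*` reduce to `IsFlow` (`isDressingDeriv_of_isFlow`).
This is the first assertion. Uniqueness up to `c τ` holds because the ratio of two tau functions of
the same `W` is invariant under all shifts and under `s ↦ s+1` (`IsDressingDeriv.eq_smul`).

For the additional symmetries, `M^m L^l = W ε^m Λ^l W⁻¹` (with `ε*` and `Λ^{-l}` for the second
component), and `ε^m` multiplies by the falling factorial `m! (b choose m)`, which is the
coefficient produced by expanding `μ^b` at `μ = λ`. Finally, `𝕏τ` itself has a pole at `μ = λ`,
while `(λ-μ)𝕏τ` has none. The flow relations are therefore multiplied by `λ - μ` before the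
expansion, which raises the order in `t` by one (`diagCoeff_diff_mul`, `isDressingDeriv_diagCoeff`).
-/

/-- Each monomial occurs only finitely often in the family. -/
def LF {ι : Type*} (f : ι → Fn K) : Prop := ∀ d, {i | coeff d (f i) ≠ 0}.Finite

/-- An additive map each output coefficient of which depends on finitely many input coefficients. -/
def Cts (T : Fn K →+ Fn K) : Prop :=
  ∀ d, ∃ D : Finset (Var →₀ ℕ), ∀ f, (∀ e ∈ D, coeff e f = 0) → coeff d (T f) = 0

section LocallyFinite

variable {ι κ : Type*}

theorem coeff_lsum (f : ι → Fn K) (d : Var →₀ ℕ) :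
    coeff d (lsum f) = ∑ᶠ i, coeff d (f i) := rfl

theorem LF.zero : LF (fun _ : ι => (0 : Fn K)) := fun d => by simp

theorem LF.of_subset {f : ι → Fn K} {s : Set ι} (hs : s.Finite) (h : ∀ i, i ∉ s → f i = 0) :
    LF f := fun d => hs.subset fun i hi => by
  by_contra hc
  exact hi (by rw [h i hc, map_zero])

theorem LF.add {f g : ι → Fn K} (hf : LF f) (hg : LF g) : LF fun i => f i + g i := fun d =>
  ((hf d).union (hg d)).subset fun i hi => by
    by_contra hc
    simp only [Set.mem_union, Set.mem_ofPred_eq, not_or, not_not] at hc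
    exact hi (by rw [map_add, hc.1, hc.2, add_zero])

theorem LF.map {f : ι → Fn K} (hf : LF f) {T : Fn K →+ Fn K} (hT : Cts T) :
    LF fun i => T (f i) := fun d => by
  obtain ⟨D, hD⟩ := hT d
  refine (D.finite_toSet.biUnion fun e _ => hf e).subset fun i hi => ?_
  by_contra hc
  simp only [Set.mem_iUnion, not_exists, Set.mem_ofPred_eq, not_not] at hc
  exact hi (hD _ fun e he => hc e he)

theorem LF.neg {f : ι → Fn K} (hf : LF f) : LF fun i => -f i := fun d => by
  simpa using hf d

theorem LF.sub {f g : ι → Fn K} (hf : LF f) (hg : LF g) : LF fun i => f i - g i := by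
  simpa [sub_eq_add_neg] using hf.add hg.neg

theorem LF.mul_right {f : ι → Fn K} (hf : LF f) (g : ι → Fn K) : LF fun i => f i * g i := fun d => by
  classical
  refine ((Finset.HasAntidiagonal.antidiagonal d).finite_toSet.biUnion fun e _ => hf e.1).subset fun i hi => ?_
  by_contra hc
  simp only [Set.mem_iUnion, not_exists, Set.mem_ofPred_eq, not_not] at hc
  refine hi ?_
  rw [coeff_mul]
  exact Finset.sum_eq_zero fun e he => by rw [hc e he, zero_mul]

theorem LF.mul_left {f : ι → Fn K} (hf : LF f) (g : ι → Fn K) : LF fun i => g i * f i := by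
  simpa [mul_comm] using hf.mul_right g

theorem LF.comp {f : ι → Fn K} (hf : LF f) {e : κ → ι} (he : e.Injective) :
    LF fun i => f (e i) := fun d => (hf d).preimage he.injOn

theorem LF.sum {σ : Type*} (s : Finset σ) {f : σ → ι → Fn K} (hf : ∀ a ∈ s, LF (f a)) :
    LF fun i => ∑ a ∈ s, f a i := by
  classical
  induction s using Finset.induction_on with
  | empty => simpa using LF.zero
  | insert a s ha ih =>
    simp only [Finset.sum_insert ha]
    exact (hf a (by simp)).add (ih fun b hb => hf b (by simp [hb]))

theorem lsum_zero : lsum (fun _ : ι => (0 : Fn K)) = 0 := by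
  ext d; simp [coeff_lsum]

theorem lsum_eq_sum {f : ι → Fn K} (s : Finset ι) (h : ∀ i, i ∉ s → f i = 0) :
    lsum f = ∑ i ∈ s, f i := by
  ext d
  rw [coeff_lsum, map_sum]
  refine finsum_eq_sum_of_support_subset _ fun i hi => ?_
  by_contra hc
  exact hi (by simp [h i (by simpa using hc)])

theorem lsum_eq_single {f : ι → Fn K} (a : ι) (h : ∀ i, i ≠ a → f i = 0) : lsum f = f a := by
  rw [lsum_eq_sum {a} fun i hi => h i (by simpa using hi), Finset.sum_singleton]

theorem lsum_add {f g : ι → Fn K} (hf : LF f) (hg : LF g) :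
    lsum (fun i => f i + g i) = lsum f + lsum g := by
  ext d
  simp only [coeff_lsum, map_add]
  exact finsum_add_distrib (hf d) (hg d)

theorem lsum_neg (f : ι → Fn K) : lsum (fun i => -f i) = -lsum f := by
  ext d
  simp only [coeff_lsum, map_neg]
  exact finsum_neg_distrib _

theorem lsum_sub {f g : ι → Fn K} (hf : LF f) (hg : LF g) :
    lsum (fun i => f i - g i) = lsum f - lsum g := by
  ext d
  simp only [coeff_lsum, map_sub]
  exact finsum_sub_distrib (hf d) (hg d)

theorem lsum_equiv (e : κ ≃ ι) (f : ι → Fn K) : lsum (fun i => f (e i)) = lsum f := by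
  ext d
  exact finsum_comp_equiv e (f := fun i => coeff d (f i))

/-- Coefficients in a given finite set agree with those of a finite partial sum. -/
theorem exists_finset_lsum {f : ι → Fn K} (hf : LF f) (D : Finset (Var →₀ ℕ)) :
    ∃ s : Finset ι, (∀ e ∈ D, ∀ i, i ∉ s → coeff e (f i) = 0) ∧
      ∀ e ∈ D, coeff e (lsum f) = coeff e (∑ i ∈ s, f i) := by
  classical
  refine ⟨D.biUnion fun e => (hf e).toFinset, ?_⟩
  have h : ∀ e ∈ D, ∀ i, i ∉ D.biUnion (fun e => (hf e).toFinset) → coeff e (f i) = 0 := by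
    intro e he i hi
    by_contra hc
    exact hi (Finset.mem_biUnion.2 ⟨e, he, by simpa using hc⟩)
  refine ⟨h, fun e he => ?_⟩
  rw [coeff_lsum, map_sum]
  refine finsum_eq_sum_of_support_subset _ fun i hi => ?_
  by_contra hc
  exact hi (h e he i hc)

/-- A given output coefficient sees only finitely many input coefficients, and on those the infinite
sum agrees with a finite partial sum, where additivity suffices. -/
theorem map_lsum {f : ι → Fn K} (hf : LF f) {T : Fn K →+ Fn K} (hT : Cts T) :
    T (lsum f) = lsum fun i => T (f i) := by
  ext d
  obtain ⟨D, hD⟩ := hT d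
  obtain ⟨s, hs, hs'⟩ := exists_finset_lsum hf D
  have h1 : coeff d (T (lsum f)) = coeff d (T (∑ i ∈ s, f i)) := by
    rw [← sub_eq_zero, ← map_sub, ← map_sub]
    exact hD _ fun e he => by rw [map_sub, hs' e he, sub_self]
  rw [h1, map_sum, map_sum, coeff_lsum]
  refine (finsum_eq_sum_of_support_subset _ fun i hi => ?_).symm
  by_contra hc
  exact hi (hD _ fun e he => hs e he i hc)

theorem LF.fst {f : ι × κ → Fn K} (hf : LF f) : LF fun a => lsum fun b => f (a, b) := fun d => by
  refine ((hf d).image Prod.fst).subset fun a ha => ?_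
  obtain ⟨b, hb⟩ : ∃ b, coeff d (f (a, b)) ≠ 0 := by
    by_contra! hc
    exact ha (by simp [coeff_lsum, hc])
  exact ⟨(a, b), hb, rfl⟩

theorem LF.swap {f : ι × κ → Fn K} (hf : LF f) : LF fun p : κ × ι => f p.swap :=
  hf.comp Prod.swap_injective

theorem LF.slice {f : ι × κ → Fn K} (hf : LF f) (a : ι) : LF fun b => f (a, b) :=
  hf.comp (Prod.mk_right_injective a)

theorem lsum_prod {f : ι × κ → Fn K} (hf : LF f) :
    lsum f = lsum fun a => lsum fun b => f (a, b) := by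
  ext d
  simp only [coeff_lsum]
  exact finsum_curry _ (hf d)

theorem lsum_comm {f : ι → κ → Fn K} (hf : LF fun p : ι × κ => f p.1 p.2) :
    (lsum fun a => lsum fun b => f a b) = lsum fun b => lsum fun a => f a b := by
  rw [← lsum_prod hf, ← lsum_equiv (Equiv.prodComm κ ι), lsum_prod]
  · rfl
  · exact hf.swap

theorem Cts.zero : Cts (0 : Fn K →+ Fn K) := fun _ => ⟨∅, by simp⟩

theorem Cts.add {S T : Fn K →+ Fn K} (hS : Cts S) (hT : Cts T) : Cts (S + T) := fun d => by
  classical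
  obtain ⟨D, hD⟩ := hS d
  obtain ⟨E, hE⟩ := hT d
  refine ⟨D ∪ E, fun f hf => ?_⟩
  rw [AddMonoidHom.add_apply, map_add, hD f fun e he => hf e (Finset.mem_union_left _ he),
    hE f fun e he => hf e (Finset.mem_union_right _ he), add_zero]

theorem Cts.comp {S T : Fn K →+ Fn K} (hS : Cts S) (hT : Cts T) : Cts (S.comp T) := fun d => by
  classical
  obtain ⟨D, hD⟩ := hS d
  choose E hE using hT
  refine ⟨D.biUnion E, fun f hf => hD _ fun e he => hE e f fun e' he' => ?_⟩
  exact hf e' (Finset.mem_biUnion.2 ⟨e, he, he'⟩)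

theorem Cts.sum {σ : Type*} (s : Finset σ) {T : σ → Fn K →+ Fn K} (hT : ∀ a ∈ s, Cts (T a)) :
    Cts (∑ a ∈ s, T a) := by
  classical
  induction s using Finset.induction_on with
  | empty => simpa using Cts.zero
  | insert a s ha ih =>
    rw [Finset.sum_insert ha]
    exact (hT a (by simp)).add (ih fun b hb => hT b (by simp [hb]))

theorem Cts.mulLeft (g : Fn K) : Cts (AddMonoidHom.mulLeft g) := fun d => by
  classical
  refine ⟨(Finset.HasAntidiagonal.antidiagonal d).image Prod.snd, fun f hf => ?_⟩
  rw [AddMonoidHom.coe_mulLeft, coeff_mul]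
  exact Finset.sum_eq_zero fun e he => by rw [hf _ (Finset.mem_image_of_mem _ he), mul_zero]

theorem Cts.id : Cts (AddMonoidHom.id (Fn K)) := fun d =>
  ⟨{d}, fun _ hf => hf d (Finset.mem_singleton_self d)⟩

theorem Cts.pderiv (u : Var) : Cts (pderiv K u).toLinearMap.toAddMonoidHom := fun d => by
  refine ⟨{d + Finsupp.single u 1}, fun f hf => ?_⟩
  change coeff d (MvPowerSeries.pderiv K u f) = 0
  rw [coeff_pderiv, hf _ (Finset.mem_singleton_self _), zero_mul]

theorem mul_lsum (g : Fn K) {f : ι → Fn K} (hf : LF f) : g * lsum f = lsum fun i => g * f i :=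
  map_lsum hf (Cts.mulLeft g)

theorem lsum_mul (g : Fn K) {f : ι → Fn K} (hf : LF f) : lsum f * g = lsum fun i => f i * g := by
  rw [mul_comm, mul_lsum g hf]
  simp only [mul_comm]

theorem LF.const_mul (g : Fn K) {f : ι → Fn K} (hf : LF f) : LF fun i => g * f i :=
  hf.mul_left _

theorem pderiv_lsum (u : Var) {f : ι → Fn K} (hf : LF f) :
    pderiv K u (lsum f) = lsum fun i => pderiv K u (f i) :=
  map_lsum hf (Cts.pderiv u)

theorem lsum_finset_sum {σ : Type*} (s : Finset σ) {f : σ → ι → Fn K} (hf : ∀ a ∈ s, LF (f a)) :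
    lsum (fun i => ∑ a ∈ s, f a i) = ∑ a ∈ s, lsum (f a) := by
  classical
  induction s using Finset.induction_on with
  | empty => simpa using lsum_zero
  | insert a s ha ih =>
    simp only [Finset.sum_insert ha]
    rw [lsum_add (hf a (by simp)) (LF.sum s fun b hb => hf b (by simp [hb])),
      ih fun b hb => hf b (by simp [hb])]

theorem lsum_smul (c : K) {f : ι → Fn K} (hf : LF f) : lsum (fun i => c • f i) = c • lsum f := by
  simp only [smul_eq_C_mul]
  rw [mul_lsum _ hf]

/-- A power series is the sum of its monomials. -/
theorem lf_monomial (f : Fn K) : LF fun d : Var →₀ ℕ => monomial d (coeff d f) := fun e => by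
  classical
  refine (Set.finite_singleton e).subset fun d hd => ?_
  by_contra hc
  exact hd (by rw [coeff_monomial, if_neg (fun h => hc h.symm)])

theorem lsum_monomial (f : Fn K) : (lsum fun d : Var →₀ ℕ => monomial d (coeff d f)) = f := by
  classical
  ext e
  rw [coeff_lsum, finsum_eq_single _ e, coeff_monomial_same]
  intro d hd
  rw [coeff_monomial, if_neg hd.symm]

end LocallyFinite

end

section


/-! ### Shift operators as exponentials of derivations -/

open Finset.HasAntidiagonal (antidiagonal)

theorem sum_antidiagonal_assoc {M : Type*} [AddCommMonoid M] (F : ℕ → ℕ → ℕ → M) (n : ℕ) :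
    ∑ p ∈ antidiagonal n, ∑ q ∈ antidiagonal p.2, F p.1 q.1 q.2 =
      ∑ p ∈ antidiagonal n, ∑ q ∈ antidiagonal p.1, F q.1 q.2 p.2 := by
  rw [Finset.sum_sigma', Finset.sum_sigma']
  refine Finset.sum_nbij' (fun x => ⟨(x.1.1 + x.2.1, x.2.2), (x.1.1, x.2.1)⟩)
    (fun x => ⟨(x.2.1, x.2.2 + x.1.2), (x.2.2, x.1.2)⟩) ?_ ?_ ?_ ?_ ?_
  · rintro ⟨⟨a, b⟩, ⟨c, d⟩⟩ h
    simp only [Finset.mem_sigma, Finset.HasAntidiagonal.mem_antidiagonal] at h ⊢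
    exact ⟨by omega, trivial⟩
  · rintro ⟨⟨a, b⟩, ⟨c, d⟩⟩ h
    simp only [Finset.mem_sigma, Finset.HasAntidiagonal.mem_antidiagonal] at h ⊢
    exact ⟨by omega, trivial⟩
  · rintro ⟨⟨a, b⟩, ⟨c, d⟩⟩ h
    simp only [Finset.mem_sigma, Finset.HasAntidiagonal.mem_antidiagonal] at h ⊢
    obtain ⟨rfl, rfl⟩ := h
    rfl
  · rintro ⟨⟨a, b⟩, ⟨c, d⟩⟩ h
    simp only [Finset.mem_sigma, Finset.HasAntidiagonal.mem_antidiagonal] at h ⊢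
    obtain ⟨rfl, rfl⟩ := h
    rfl
  · rintro ⟨⟨a, b⟩, ⟨c, d⟩⟩ h
    rfl

theorem sum_antidiagonal_left_comm {M : Type*} [AddCommMonoid M] (F : ℕ → ℕ → ℕ → M) (n : ℕ) :
    ∑ p ∈ antidiagonal n, ∑ q ∈ antidiagonal p.2, F p.1 q.1 q.2 =
      ∑ p ∈ antidiagonal n, ∑ q ∈ antidiagonal p.2, F q.1 p.1 q.2 := by
  rw [sum_antidiagonal_assoc, sum_antidiagonal_assoc (fun a b c => F b a c)]
  refine Finset.sum_congr rfl fun p _ => ?_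
  exact Finset.Nat.sum_antidiagonal_swap (f := fun q : ℕ × ℕ => F q.2 q.1 p.2)

/-- The coefficient of `ζ ^ n` in `exp (c ∑ ζ^i / i ∂_i)`. -/
def hop (v : Bool) (c : K) : ℕ → (Fn K →ₗ[K] Fn K)
  | 0 => LinearMap.id
  | k + 1 => (c / ((k : K) + 1)) • ∑ i : Fin (k + 1),
      (hop v c (k - i)) ∘ₗ (pderiv K ((v, (i : ℕ)) : Var)).toLinearMap
termination_by k => k
decreasing_by omega

variable (v : Bool) (c : K)

theorem hop_zero (f : Fn K) : hop v c 0 f = f := by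
  rw [hop]; rfl

theorem hop_succ' (k : ℕ) (f : Fn K) : hop v c (k + 1) f =
    (c / ((k : K) + 1)) • ∑ p ∈ antidiagonal k, hop v c p.2 (pderiv K ((v, p.1) : Var) f) := by
  rw [hop, LinearMap.smul_apply, LinearMap.sum_apply,
    Finset.Nat.sum_antidiagonal_eq_sum_range_succ
      (fun i j => hop v c j (pderiv K ((v, i) : Var) f)), Finset.sum_range]
  rfl

/-- This is the `ζ`-derivative of the exponential: `d/dζ` brings down `c ∑ ζ^i ∂_{i+1}`. All
properties of the shift are proved by comparing such recursions, which is where characteristic zero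
enters. -/
theorem hop_succ [CharZero K] (k : ℕ) (f : Fn K) : ((k : K) + 1) • hop v c (k + 1) f =
    c • ∑ p ∈ antidiagonal k, hop v c p.2 (pderiv K ((v, p.1) : Var) f) := by
  rw [hop_succ', smul_smul, mul_div_cancel₀]
  exact_mod_cast Nat.succ_ne_zero k

theorem hop_succ_nat [CharZero K] (k : ℕ) (f : Fn K) : ((k + 1 : ℕ) : Fn K) * hop v c (k + 1) f =
    C c * ∑ p ∈ antidiagonal k, hop v c p.2 (pderiv K ((v, p.1) : Var) f) := by
  have := hop_succ v c k f
  rw [smul_eq_C_mul, smul_eq_C_mul] at this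
  rw [← this]
  congr 1
  rw [map_add, map_one, map_natCast, Nat.cast_succ]

theorem cts_hop (n : ℕ) : Cts (hop v c n).toAddMonoidHom := by
  induction n using Nat.strong_induction_on with
  | _ n ih =>
    obtain _ | k := n
    · have : (hop v c 0).toAddMonoidHom = AddMonoidHom.id (Fn K) := by
        ext1 f; exact hop_zero v c f
      rw [this]
      exact Cts.id
    · have : (hop v c (k + 1)).toAddMonoidHom =
          (AddMonoidHom.mulLeft (C (c / ((k : K) + 1)))).comp (∑ p ∈ antidiagonal k,
            (hop v c p.2).toAddMonoidHom.comp
              (pderiv K ((v, p.1) : Var)).toLinearMap.toAddMonoidHom) := by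
        ext1 f
        rw [AddMonoidHom.comp_apply, AddMonoidHom.finsetSum_apply, AddMonoidHom.coe_mulLeft,
          ← smul_eq_C_mul]
        exact hop_succ' v c k f
      rw [this]
      refine (Cts.mulLeft _).comp (Cts.sum _ fun p hp => (ih _ ?_).comp (Cts.pderiv _))
      have := Finset.HasAntidiagonal.mem_antidiagonal.1 hp
      omega

theorem hop_lsum (n : ℕ) {ι : Type*} {f : ι → Fn K} (hf : LF f) :
    hop v c n (lsum f) = lsum fun i => hop v c n (f i) :=
  map_lsum hf (cts_hop v c n)

theorem LF.hop (n : ℕ) {ι : Type*} {f : ι → Fn K} (hf : LF f) : LF fun i => hop v c n (f i) :=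
  hf.map (cts_hop v c n)

theorem pderiv_comm (u w : Var) (f : Fn K) :
    pderiv K u (pderiv K w f) = pderiv K w (pderiv K u f) := by
  classical
  ext d
  simp only [coeff_pderiv, add_assoc]
  rw [add_comm (Finsupp.single u 1)]
  by_cases h : u = w
  · subst h; rfl
  · simp only [Finsupp.add_apply, Finsupp.single_apply, h, Ne.symm h, if_false]
    push_cast
    ring

theorem pderiv_hop (u : Var) (n : ℕ) (f : Fn K) :
    pderiv K u (hop v c n f) = hop v c n (pderiv K u f) := by
  induction n using Nat.strong_induction_on generalizing f with
  | _ n ih =>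
    obtain _ | k := n
    · simp only [hop_zero]
    · rw [hop_succ', hop_succ', Derivation.map_smul, map_sum]
      congr 1
      refine Finset.sum_congr rfl fun p hp => ?_
      have := Finset.HasAntidiagonal.mem_antidiagonal.1 hp
      rw [ih _ (by omega), pderiv_comm]

theorem hop_comm (v' : Bool) (c' : K) (n m : ℕ) (f : Fn K) :
    hop v c n (hop v' c' m f) = hop v' c' m (hop v c n f) := by
  induction n using Nat.strong_induction_on generalizing f with
  | _ n ih =>
    obtain _ | k := n
    · simp only [hop_zero]
    · rw [hop_succ', hop_succ', map_smul, map_sum]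
      congr 1
      refine Finset.sum_congr rfl fun p hp => ?_
      have := Finset.HasAntidiagonal.mem_antidiagonal.1 hp
      rw [← ih _ (by omega), pderiv_hop]

/-- The Leibniz rule for `d/dζ` on a product of two series, read off coefficientwise. -/
theorem sum_antidiagonal_nat_mul {A : Type*} [Semiring A] (n : ℕ) (F : ℕ → ℕ → A) :
    ((n + 1 : ℕ) : A) * ∑ p ∈ antidiagonal (n + 1), F p.1 p.2 =
      ∑ p ∈ antidiagonal n, ((p.1 + 1 : ℕ) : A) * F (p.1 + 1) p.2 +
      ∑ p ∈ antidiagonal n, ((p.2 + 1 : ℕ) : A) * F p.1 (p.2 + 1) := by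
  have h1 := Finset.Nat.sum_antidiagonal_succ (n := n) (f := fun p => ((p.1 : ℕ) : A) * F p.1 p.2)
  have h2 := Finset.Nat.sum_antidiagonal_succ' (n := n) (f := fun p => ((p.2 : ℕ) : A) * F p.1 p.2)
  simp only [Nat.cast_zero, zero_mul, zero_add] at h1 h2
  rw [← h1, ← h2, Finset.mul_sum, ← Finset.sum_add_distrib]
  refine Finset.sum_congr rfl fun p hp => ?_
  rw [← Finset.HasAntidiagonal.mem_antidiagonal.1 hp, Nat.cast_add, add_mul]

theorem hop_one (n : ℕ) : hop v c n (1 : Fn K) = if n = 0 then 1 else 0 := by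
  obtain _ | k := n
  · simp [hop_zero]
  · rw [hop_succ']
    simp

theorem hop_X (u : Var) (n : ℕ) : hop v c n (X u : Fn K) =
    if n = 0 then X u else if u.1 = v ∧ n = u.2 + 1 then C (c / ((u.2 : K) + 1)) else 0 := by
  obtain _ | k := n
  · simp [hop_zero]
  · rw [if_neg (Nat.succ_ne_zero k), hop_succ']
    by_cases h : u.1 = v ∧ k + 1 = u.2 + 1
    · rw [if_pos h, Finset.sum_eq_single (k, 0)]
      · have : u = (v, k) := Prod.ext h.1 (by have := h.2; simp only; omega)
        subst this
        rw [hop_zero, pderiv_X_self, smul_eq_C_mul, mul_one]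
      · rintro ⟨i, j⟩ hp hne
        have h2 := Finset.HasAntidiagonal.mem_antidiagonal.1 hp
        rw [pderiv_X_of_ne, map_zero]
        rintro rfl
        apply hne
        have := h.2
        simp only [Prod.mk.injEq] at h2 this ⊢
        omega
      · intro h; exact absurd (by simp) h
    · rw [if_neg h, Finset.sum_eq_zero, smul_zero]
      rintro ⟨i, j⟩ hp
      have h2 := Finset.HasAntidiagonal.mem_antidiagonal.1 hp
      by_cases h3 : u = (v, i)
      · subst h3
        rw [pderiv_X_self, hop_one, if_neg]
        rintro rfl
        apply h
        exact ⟨rfl, by simp only at h2 ⊢; omega⟩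
      · rw [pderiv_X_of_ne h3, map_zero]

theorem shift_of_neg (f : Fn K) {k : ℤ} (hk : k < 0) : shift v c f k = 0 := by
  ext e
  have h : coeff e (shift v c f k) = shift v c f k e := rfl
  rw [h, shift, if_neg (by omega), coeff_zero]

variable [CharZero K]

theorem natCast_mul_cancel {n : ℕ} {f g : Fn K}
    (h : ((n + 1 : ℕ) : Fn K) * f = ((n + 1 : ℕ) : Fn K) * g) : f = g := by
  have h0 : ((n + 1 : ℕ) : Fn K) ≠ 0 := by
    rw [← map_natCast (C (σ := Var) (R := K))]
    intro h
    have := C_injective (σ := Var) (R := K) (h.trans (map_zero C).symm)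
    exact Nat.succ_ne_zero n (by exact_mod_cast this)
  exact mul_left_cancel₀ h0 h

/-- The exponential of a derivation is multiplicative: both sides satisfy the same first-order
recursion in `ζ`, and `n + 1` can be cancelled. -/
theorem hop_mul (n : ℕ) (f g : Fn K) :
    hop v c n (f * g) = ∑ p ∈ antidiagonal n, hop v c p.1 f * hop v c p.2 g := by
  induction n using Nat.strong_induction_on generalizing f g with
  | _ n ih =>
    obtain _ | k := n
    · simp [hop_zero]
    · apply natCast_mul_cancel (n := k)
      rw [hop_succ_nat, sum_antidiagonal_nat_mul k fun a b => hop v c a f * hop v c b g]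
      have e1 : ∀ p ∈ antidiagonal k, hop v c p.2 (pderiv K ((v, p.1) : Var) (f * g)) =
          ∑ q ∈ antidiagonal p.2, hop v c q.1 (pderiv K ((v, p.1) : Var) f) * hop v c q.2 g +
          ∑ q ∈ antidiagonal p.2, hop v c q.1 f * hop v c q.2 (pderiv K ((v, p.1) : Var) g) := by
        intro p hp
        have := Finset.HasAntidiagonal.mem_antidiagonal.1 hp
        rw [Derivation.leibniz, smul_eq_mul, smul_eq_mul, map_add, ih _ (by omega),
          mul_comm g, ih _ (by omega), add_comm]
      rw [Finset.sum_congr rfl e1, Finset.sum_add_distrib, mul_add]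
      congr 1
      · rw [sum_antidiagonal_assoc
          fun i a b => hop v c a (pderiv K ((v, i) : Var) f) * hop v c b g, Finset.mul_sum]
        refine Finset.sum_congr rfl fun p _ => ?_
        rw [← mul_assoc, hop_succ_nat, mul_assoc, Finset.sum_mul]
      · rw [sum_antidiagonal_left_comm
          fun i a b => hop v c a f * hop v c b (pderiv K ((v, i) : Var) g), Finset.mul_sum]
        refine Finset.sum_congr rfl fun p _ => ?_
        rw [mul_left_comm, hop_succ_nat, ← Finset.mul_sum, mul_left_comm]

/-- Opposite shifts are mutually inverse. -/
theorem hop_inv (n : ℕ) (f : Fn K) :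
    ∑ p ∈ antidiagonal n, hop v c p.1 (hop v (-c) p.2 f) = if n = 0 then f else 0 := by
  obtain _ | k := n
  · simp [hop_zero]
  · rw [if_neg (Nat.succ_ne_zero k)]
    apply natCast_mul_cancel (n := k)
    rw [mul_zero, sum_antidiagonal_nat_mul k fun a b => hop v c a (hop v (-c) b f)]
    have e1 : ∀ p : ℕ × ℕ, ((p.1 + 1 : ℕ) : Fn K) * hop v c (p.1 + 1) (hop v (-c) p.2 f) =
        C c * ∑ q ∈ antidiagonal p.1, hop v c q.2 (hop v (-c) p.2 (pderiv K ((v, q.1) : Var) f)) := by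
      intro p
      rw [hop_succ_nat]
      simp only [pderiv_hop]
    have e2 : ∀ p : ℕ × ℕ, ((p.2 + 1 : ℕ) : Fn K) * hop v c p.1 (hop v (-c) (p.2 + 1) f) =
        C (-c) * ∑ q ∈ antidiagonal p.2,
          hop v c p.1 (hop v (-c) q.2 (pderiv K ((v, q.1) : Var) f)) := by
      intro p
      have h : ∀ (N : ℕ) (g : Fn K), (N : Fn K) * hop v c p.1 g = hop v c p.1 ((N : Fn K) * g) := by
        intro N g
        rw [← map_natCast (C (σ := Var) (R := K)), ← smul_eq_C_mul, ← smul_eq_C_mul, map_smul]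
      rw [h, hop_succ_nat, ← smul_eq_C_mul, map_smul, map_sum, smul_eq_C_mul]
    -- The `ζ`-derivatives of the two exponentials now give the same double sum, with coefficients
    -- `c` and `-c`.
    simp only [e1, e2, ← Finset.mul_sum]
    rw [sum_antidiagonal_left_comm
        (fun a b d => hop v c a (hop v (-c) d (pderiv K ((v, b) : Var) f))), sum_antidiagonal_assoc
        (fun a b d => hop v c b (hop v (-c) d (pderiv K ((v, a) : Var) f))), map_neg]
    ring

/-- The shift as a ring homomorphism to power series in the shift parameter. -/
def shiftHom (v : Bool) (c : K) : Fn K →+* PowerSeries (Fn K) where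
  toFun f := PowerSeries.mk fun n => hop v c n f
  map_one' := by
    ext1 n
    rw [PowerSeries.coeff_mk, hop_one, PowerSeries.coeff_one]
  map_mul' f g := by
    ext1 n
    simp only [PowerSeries.coeff_mk, hop_mul, PowerSeries.coeff_mul]
  map_zero' := by ext1 n; simp
  map_add' f g := by ext1 n; simp

theorem coeff_shiftHom (n : ℕ) (f : Fn K) :
    PowerSeries.coeff n (shiftHom v c f) = hop v c n f := by
  simp [shiftHom]

theorem optionEquivLeft_shiftVars (u : Var) :
    optionEquivLeft Var K (shiftVars v c u) = shiftHom v c (X u) := by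
  have hC : ∀ a : K, optionEquivLeft Var K (C a) = PowerSeries.C (C a) := fun a => by
    rw [c_eq_algebraMap, AlgEquiv.commutes, PowerSeries.algebraMap_apply]; rfl
  ext1 n
  rw [coeff_shiftHom, hop_X, shiftVars, map_add, optionEquivLeft_X_some, map_add,
    PowerSeries.coeff_C]
  by_cases hv : u.1 = v
  · rw [if_pos hv, map_mul, map_pow, optionEquivLeft_X_none, hC, PowerSeries.coeff_C_mul,
      PowerSeries.coeff_X_pow]
    by_cases hn : n = 0
    · rw [if_pos hn, if_pos hn, if_neg (by omega), mul_zero, add_zero]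
    · by_cases h : n = u.2 + 1
      · rw [if_neg hn, if_neg hn, if_pos h, if_pos ⟨hv, h⟩, mul_one, zero_add]
      · rw [if_neg hn, if_neg hn, if_neg h, if_neg (fun hh => h hh.2), mul_zero, zero_add]
  · rw [if_neg hv, map_zero, map_zero, add_zero, if_neg (fun h : u.1 = v ∧ _ => hv h.1)]

/-- Both sides are multiplicative and agree on the variables, hence on monomials; local finiteness
extends the agreement to all series. -/
theorem optionEquivLeft_subst (f : Fn K) :
    optionEquivLeft Var K (subst (shiftVars v c) f) = shiftHom v c f := by
  ext n e
  rw [coeff_shiftHom, coeff_coeff_optionEquivLeft, coeff_subst (hasSubst_shiftVars v c)]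
  conv_rhs => rw [← lsum_monomial f, hop_lsum v c n (lf_monomial f), coeff_lsum]
  congr 1
  ext1 d
  rw [← coeff_coeff_optionEquivLeft, Finsupp.prod, map_prod]
  simp only [map_pow, optionEquivLeft_shiftVars]
  rw [← Finset.prod_congr rfl fun u _ => map_pow (shiftHom v c) (X u) (d u), ← map_prod,
    coeff_shiftHom, show ∏ x ∈ d.support, (X x : Fn K) ^ d x = monomial d 1 by
      rw [monomial_eq', map_one, one_mul]; rfl]
  rw [← mul_one (coeff d f), ← smul_eq_mul (coeff d f) 1, map_smul, map_smul, map_smul, smul_eq_mul,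
    smul_eq_mul, smul_eq_mul, mul_one]

/-- The bridge from the definition by substitution to the operator form, in which multiplicativity,
commutation and inversion of shifts are available. -/
theorem shift_natCast (f : Fn K) (n : ℕ) : shift v c f n = hop v c n f := by
  ext e
  conv_rhs => rw [← coeff_shiftHom, ← optionEquivLeft_subst, coeff_coeff_optionEquivLeft]
  have h : coeff e (shift v c f n) = shift v c f n e := rfl
  rw [h, shift, if_pos (Int.natCast_nonneg n), Int.toNat_natCast]
  congr 2
  ext o
  cases o with
  | none => simp [Finsupp.mapDomain_of_notMem_range]
  | some u => simp [Finsupp.mapDomain_apply (Option.some_injective _)]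

end

section


/-! ### Weights and exponentials -/

open Finset.HasAntidiagonal (antidiagonal)

/-- The weight of a monomial, where `x_n` and `y_n` have weight `n`. -/
def wt (d : Var →₀ ℕ) : ℤ := d.sum fun u e => ((u.2 : ℤ) + 1) * (e : ℤ)

theorem wt_zero : wt 0 = 0 := Finsupp.sum_zero_index

theorem wt_add (d e : Var →₀ ℕ) : wt (d + e) = wt d + wt e :=
  Finsupp.sum_add_index' (by simp) (by intros; push_cast; ring)

theorem wt_single (u : Var) (n : ℕ) : wt (Finsupp.single u n) = ((u.2 : ℤ) + 1) * n :=
  Finsupp.sum_single_index (by simp)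

theorem wt_nonneg (d : Var →₀ ℕ) : 0 ≤ wt d :=
  Finset.sum_nonneg fun _ _ => by positivity

/-- All monomials of `f` have weight at least `n`. -/
def WtGE (n : ℤ) (f : Fn K) : Prop := ∀ d, wt d < n → coeff d f = 0

theorem WtGE.mul_right {n : ℤ} {f : Fn K} (hf : WtGE n f) (g : Fn K) : WtGE n (f * g) := by
  classical
  intro d hd
  rw [coeff_mul]
  refine Finset.sum_eq_zero fun p hp => ?_
  rw [hf, zero_mul]
  have h := congrArg wt (Finset.HasAntidiagonal.mem_antidiagonal.1 hp)
  have := wt_nonneg p.2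
  rw [wt_add] at h
  omega

theorem WtGE.mul_left {n : ℤ} {f : Fn K} (hf : WtGE n f) (g : Fn K) : WtGE n (g * f) := by
  rw [mul_comm]; exact hf.mul_right g

theorem WtGE.lsum {ι : Type*} {n : ℤ} {f : ι → Fn K} (hf : ∀ i, WtGE n (f i)) :
    WtGE n (lsum f) := by
  intro d hd
  rw [coeff_lsum]
  simp [hf _ d hd]

theorem LF.of_wtGE {ι : Type*} {f : ι → Fn K} (w : ι → ℤ) (hw : ∀ i, WtGE (w i) (f i))
    (hfin : ∀ N : ℤ, {i | w i ≤ N ∧ f i ≠ 0}.Finite) : LF f := fun d =>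
  (hfin (wt d)).subset fun i hi => by
    refine ⟨?_, fun h => hi (by rw [h, map_zero])⟩
    by_contra hc
    exact hi (hw i d (by omega))

section Exponential

variable (v : Bool) (ε : K)

theorem coeff_expXi (k : ℤ) (d : Var →₀ ℕ) : coeff d (expXi v ε k) =
    open Classical in
    if (∀ i : ℕ, d (!v, i) = 0) ∧ wt d = k then d.prod fun _ e => ε ^ e / (e.factorial : K)
    else 0 := rfl

theorem wtGE_expXi (k : ℤ) : WtGE k (expXi v ε k) := by
  intro d hd
  rw [coeff_expXi, if_neg (by omega)]

theorem expXi_of_neg {k : ℤ} (hk : k < 0) : expXi v ε k = 0 := by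
  ext d
  have := wt_nonneg d
  rw [coeff_expXi, if_neg (by omega), coeff_zero]

theorem coeff_zero_expXi (k : ℤ) :
    coeff (0 : Var →₀ ℕ) (expXi v ε k) = if k = 0 then 1 else 0 := by
  rw [coeff_expXi]
  by_cases h : k = 0
  · rw [if_pos h, if_pos ⟨fun _ => rfl, by rw [wt_zero, h]⟩, Finsupp.prod_zero_index]
  · rw [if_neg h, if_neg]
    rw [wt_zero]
    exact fun hh => h hh.2.symm

theorem pderiv_expXi_other (n : ℕ) (k : ℤ) : pderiv K ((!v, n) : Var) (expXi v ε k) = 0 := by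
  ext d
  rw [coeff_pderiv, coeff_expXi, if_neg, zero_mul, coeff_zero]
  intro h
  have := h.1 n
  simp at this

theorem pderiv_expXi [CharZero K] (n : ℕ) (k : ℤ) :
    pderiv K ((v, n) : Var) (expXi v ε k) = C ε * expXi v ε (k - (n + 1)) := by
  classical
  ext d
  rw [coeff_pderiv, coeff_expXi, coeff_C_mul, coeff_expXi, wt_add, wt_single]
  have h1 : (∀ i : ℕ, (d + Finsupp.single ((v, n) : Var) 1 : Var →₀ ℕ) (!v, i) = 0) ↔
      ∀ i : ℕ, d (!v, i) = 0 := by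
    refine forall_congr' fun i => ?_
    simp
  rw [h1]
  by_cases h : (∀ i : ℕ, d (!v, i) = 0) ∧ wt d = k - (n + 1)
  · rw [if_pos h, if_pos ⟨h.1, by rw [h.2]; push_cast; ring⟩]
    rw [← Finsupp.mul_prod_erase' (d + Finsupp.single ((v, n) : Var) 1) (v, n) _ (by simp),
      ← Finsupp.mul_prod_erase' d (v, n) _ (by simp)]
    have h2 : (d + Finsupp.single ((v, n) : Var) 1).erase (v, n) = d.erase (v, n) := by
      ext u
      by_cases hu : u = (v, n)
      · subst hu; simp
      · rw [Finsupp.erase_ne hu, Finsupp.erase_ne hu, Finsupp.add_apply,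
          Finsupp.single_eq_of_ne hu, add_zero]
    rw [h2, Finsupp.add_apply, Finsupp.single_eq_same, Nat.factorial_succ]
    have h3 : ((d (v, n) : K) + 1) ≠ 0 := by
      exact_mod_cast Nat.succ_ne_zero (d (v, n))
    have h4 : ((d (v, n)).factorial : K) ≠ 0 := by exact_mod_cast Nat.factorial_ne_zero _
    push_cast
    field_simp
    ring
  · rw [if_neg h, if_neg, zero_mul, mul_zero]
    rintro ⟨h5, h6⟩
    exact h ⟨h5, by push_cast at h6; linarith⟩

theorem hop_expXi_other (c : K) (n : ℕ) (k : ℤ) :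
    hop (!v) c n (expXi v ε k) = if n = 0 then expXi v ε k else 0 := by
  obtain _ | m := n
  · simp [hop_zero]
  · rw [hop_succ', if_neg (Nat.succ_ne_zero m), Finset.sum_eq_zero, smul_zero]
    intro p _
    rw [pderiv_expXi_other, map_zero]

theorem lf_expXi_mul (ε ε' : K) (k : ℤ) : LF fun l : ℤ => expXi v ε l * expXi v ε' (k - l) := by
  refine LF.of_subset (Set.finite_Icc 0 k) fun l hl => ?_
  by_cases h : l < 0
  · rw [expXi_of_neg _ _ h, zero_mul]
  · rw [expXi_of_neg v ε' (k := k - l) (by simp only [Set.mem_Icc, not_and] at hl; omega), mul_zero]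

variable [CharZero K]

/-- Since `ξ([ζ], z) = -log(1 - ζz)`, the shift by `c[ζ]` multiplies `e^{εξ}` by `(1 - ζz)^{-cε}`;
here this is a geometric series. -/
theorem hop_expXi_of_mul_eq_one {c : K} (h : c * ε = 1) (n : ℕ) (k : ℤ) :
    hop v c n (expXi v ε k) = expXi v ε (k - n) := by
  induction n using Nat.strong_induction_on generalizing k with
  | _ n ih =>
    obtain _ | m := n
    · simp [hop_zero]
    · apply natCast_mul_cancel (n := m)
      rw [hop_succ_nat]
      have e : ∀ p ∈ antidiagonal m, hop v c p.2 (pderiv K ((v, p.1) : Var) (expXi v ε k)) =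
          C ε * expXi v ε (k - (m + 1 : ℕ)) := by
        intro p hp
        have hp' := Finset.HasAntidiagonal.mem_antidiagonal.1 hp
        rw [pderiv_expXi, ← smul_eq_C_mul, map_smul, ih _ (by omega), smul_eq_C_mul]
        congr 2
        omega
      rw [Finset.sum_congr rfl e, Finset.sum_const, Finset.Nat.card_antidiagonal, nsmul_eq_mul,
        mul_left_comm, ← mul_assoc (C c), ← map_mul, h, map_one, one_mul]

/-- Now the factor is `1 - ζz` itself, so only orders 0 and 1 in `ζ` survive. -/
theorem hop_expXi_of_mul_eq_neg_one {c : K} (h : c * ε = -1) (n : ℕ) (k : ℤ) :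
    hop v c n (expXi v ε k) =
      if n = 0 then expXi v ε k else if n = 1 then -expXi v ε (k - 1) else 0 := by
  induction n using Nat.strong_induction_on generalizing k with
  | _ n ih =>
    obtain _ | m := n
    · simp [hop_zero]
    · rw [if_neg (Nat.succ_ne_zero m)]
      have hC : C c * C ε = (-1 : Fn K) := by rw [← map_mul, h, map_neg, map_one]
      apply natCast_mul_cancel (n := m)
      rw [hop_succ_nat]
      obtain _ | m := m
      · simp [hop_zero, pderiv_expXi, ← mul_assoc, hC]
      · rw [if_neg (by omega), mul_zero, Finset.Nat.sum_antidiagonal_succ',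
          -- From order 2 on, the recursion contains just the contributions of orders 0 and 1 of the
          -- smaller operators, and these cancel.
          Finset.sum_eq_single (m, 0)]
        · simp only [pderiv_expXi, ← smul_eq_C_mul, map_smul]
          rw [ih _ (by omega), ih _ (by omega), if_pos rfl, if_neg (by omega), if_pos (by omega)]
          have : k - ((m : ℤ) + 1) - 1 = k - (((m + 1 : ℕ) : ℤ) + 1) := by push_cast; ring
          rw [this, smul_neg, add_neg_cancel, smul_zero]
        · rintro ⟨i, j⟩ hp hne
          have hp' := Finset.HasAntidiagonal.mem_antidiagonal.1 hp
          simp only at hp' ⊢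
          rw [pderiv_expXi, ← smul_eq_C_mul, map_smul, ih _ (by omega), if_neg (by omega),
            if_neg, smul_zero]
          intro hj
          apply hne
          rw [Prod.mk.injEq]
          omega
        · intro hh
          exact absurd (by simp) hh

/-- All derivatives of the product vanish and its constant term is known; in characteristic zero
this determines it. -/
theorem lsum_expXi_mul {ε ε' : K} (h : ε + ε' = 0) (k : ℤ) :
    (lsum fun l : ℤ => expXi v ε l * expXi v ε' (k - l)) = if k = 0 then 1 else 0 := by
  refine pderiv.ext ?_ ?_
  · intro u
    have hr : pderiv K u (if k = 0 then 1 else 0 : Fn K) = 0 := by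
      split_ifs <;> simp
    rw [hr, pderiv_lsum u (lf_expXi_mul v ε ε' k)]
    obtain ⟨w, n⟩ := u
    by_cases hw : w = v
    · subst hw
      simp only [Derivation.leibniz, pderiv_expXi, smul_eq_mul]
      have h1 := lf_expXi_mul w ε ε' (k - (n + 1))
      rw [lsum_add]
      · have e1 : (lsum fun l : ℤ => expXi w ε l * (C ε' * expXi w ε' (k - l - (n + 1)))) =
            C ε' * lsum fun l : ℤ => expXi w ε l * expXi w ε' (k - (n + 1) - l) := by
          rw [mul_lsum _ h1]
          congr 1; ext1 l
          rw [mul_left_comm, sub_right_comm]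
        have e2 : (lsum fun l : ℤ => expXi w ε' (k - l) * (C ε * expXi w ε (l - (n + 1)))) =
            C ε * lsum fun l : ℤ => expXi w ε l * expXi w ε' (k - (n + 1) - l) := by
          rw [mul_lsum _ h1]
          refine Eq.trans ?_ (lsum_equiv (Equiv.subRight ((n : ℤ) + 1)) _)
          congr 1; ext1 l
          simp only [Equiv.subRight_apply]
          rw [show k - (n + 1 : ℤ) - (l - (n + 1)) = k - l by ring]
          ring
        rw [e1, e2, ← add_mul, ← map_add, add_comm ε', h, map_zero, zero_mul]
      · convert h1.const_mul (C ε') using 2 with l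
        rw [mul_left_comm, sub_right_comm]
      · convert (h1.comp (Equiv.subRight ((n : ℤ) + 1)).injective).const_mul (C ε) using 2 with l
        simp only [Equiv.subRight_apply]
        rw [show k - (n + 1 : ℤ) - (l - (n + 1)) = k - l by ring]
        ring
    · obtain rfl : w = !v := by cases w <;> cases v <;> simp_all
      simp only [Derivation.leibniz, pderiv_expXi_other, smul_zero, add_zero]
      exact lsum_zero
  · rw [← coeff_zero_eq_constantCoeff_apply, ← coeff_zero_eq_constantCoeff_apply, coeff_lsum,
      finsum_eq_single _ (0 : ℤ)]
    · rw [coeff_zero_eq_constantCoeff_apply, map_mul, ← coeff_zero_eq_constantCoeff_apply,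
        ← coeff_zero_eq_constantCoeff_apply, coeff_zero_expXi, coeff_zero_expXi, if_pos rfl,
        one_mul, sub_zero]
      split_ifs <;> simp
    · intro l hl
      rw [coeff_zero_eq_constantCoeff_apply, map_mul, ← coeff_zero_eq_constantCoeff_apply,
        coeff_zero_expXi, if_neg hl, zero_mul]

end Exponential

end

section


/-! ### A ring of infinite matrices -/

open Finset.HasAntidiagonal (antidiagonal)

/-- In each monomial, the entries of the matrix vanish far above (`ε = 1`) or far below (`ε = -1`)
the diagonal. -/
def Bdd (ε : ℤˣ) (P : Mat K) : Prop :=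
  ∀ d, ∃ N : ℤ, ∀ i j : ℤ, N < ε * (j - i) → coeff d (P i j) = 0

theorem exists_of_coeff_mul_ne_zero {f g : Fn K} {d : Var →₀ ℕ} (h : coeff d (f * g) ≠ 0) :
    ∃ p ∈ antidiagonal d, coeff p.1 f ≠ 0 ∧ coeff p.2 g ≠ 0 := by
  classical
  rw [coeff_mul] at h
  obtain ⟨p, hp, hne⟩ := Finset.exists_ne_zero_of_sum_ne_zero h
  exact ⟨p, hp, left_ne_zero_of_mul hne, right_ne_zero_of_mul hne⟩

theorem finite_unit_Icc (ε : ℤˣ) (i j N M : ℤ) :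
    {k : ℤ | (ε : ℤ) * (k - i) ≤ N ∧ (ε : ℤ) * (j - k) ≤ M}.Finite := by
  rcases Int.units_eq_one_or ε with rfl | rfl
  · refine (Set.finite_Icc (j - M) (N + i)).subset fun k hk => ?_
    simp only [Units.val_one, one_mul, Set.mem_ofPred_eq] at hk
    simp only [Set.mem_Icc]
    omega
  · refine (Set.finite_Icc (i - N) (M + j)).subset fun k hk => ?_
    simp only [Units.val_neg, Units.val_one, neg_mul, one_mul, Set.mem_ofPred_eq] at hk
    simp only [Set.mem_Icc]
    omega

namespace Bdd

variable {ε : ℤˣ} {P Q R : Mat K}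

theorem lf_mul (hP : Bdd ε P) (hQ : Bdd ε Q) (i j : ℤ) : LF fun k : ℤ => P i k * Q k j := by
  classical
  intro d
  choose N hN using hP
  choose M hM using hQ
  refine ((antidiagonal d).finite_toSet.biUnion fun p _ =>
    finite_unit_Icc ε i j (N p.1) (M p.2)).subset fun k hk => ?_
  obtain ⟨p, hp, h1, h2⟩ := exists_of_coeff_mul_ne_zero hk
  refine Set.mem_biUnion hp ⟨?_, ?_⟩
  · by_contra hc
    exact h1 (hN _ _ _ (by omega))
  · by_contra hc
    exact h2 (hM _ _ _ (by omega))

/-- The three displacements add up to the fixed number `j - i` and each is bounded on the same side,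
so each is bounded on the other side too. This licenses the exchange of sums in associativity. -/
theorem lf_mul_mul (hP : Bdd ε P) (hQ : Bdd ε Q) (hR : Bdd ε R) (i j : ℤ) :
    LF fun p : ℤ × ℤ => P i p.1 * Q p.1 p.2 * R p.2 j := by
  classical
  intro d
  choose N hN using hP
  choose M hM using hQ
  choose L hL using hR
  refine ((antidiagonal d).finite_toSet.biUnion fun p _ =>
    (antidiagonal p.1).finite_toSet.biUnion fun q _ =>
      (finite_unit_Icc ε i j (N q.1) (M q.2 + L p.2)).prod
        (finite_unit_Icc ε i j (N q.1 + M q.2) (L p.2))).subset fun k hk => ?_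
  obtain ⟨p, hp, h1, h2⟩ := exists_of_coeff_mul_ne_zero hk
  obtain ⟨q, hq, h3, h4⟩ := exists_of_coeff_mul_ne_zero h1
  refine Set.mem_biUnion hp (Set.mem_biUnion hq ?_)
  have b1 : (ε : ℤ) * (k.1 - i) ≤ N q.1 := by
    by_contra hc; exact h3 (hN _ _ _ (by omega))
  have b2 : (ε : ℤ) * (k.2 - k.1) ≤ M q.2 := by
    by_contra hc; exact h4 (hM _ _ _ (by omega))
  have b3 : (ε : ℤ) * (j - k.2) ≤ L p.2 := by
    by_contra hc; exact h2 (hL _ _ _ (by omega))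
  have e1 : (ε : ℤ) * (j - k.1) = ε * (k.2 - k.1) + ε * (j - k.2) := by ring
  have e2 : (ε : ℤ) * (k.2 - i) = ε * (k.1 - i) + ε * (k.2 - k.1) := by ring
  exact ⟨⟨b1, by omega⟩, ⟨by omega, b3⟩⟩

theorem mul (hP : Bdd ε P) (hQ : Bdd ε Q) : Bdd ε (mmul P Q) := by
  classical
  intro d
  choose N hN using hP
  choose M hM using hQ
  obtain ⟨B, hB⟩ := ((antidiagonal d).image fun p => N p.1 + M p.2).exists_le
  refine ⟨B, fun i j hij => ?_⟩
  rw [mmul, coeff_lsum]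
  refine finsum_eq_zero_of_forall_eq_zero fun k => ?_
  by_contra hk
  obtain ⟨p, hp, h1, h2⟩ := exists_of_coeff_mul_ne_zero hk
  have b1 : (ε : ℤ) * (k - i) ≤ N p.1 := by
    by_contra hc; exact h1 (hN _ _ _ (by omega))
  have b2 : (ε : ℤ) * (j - k) ≤ M p.2 := by
    by_contra hc; exact h2 (hM _ _ _ (by omega))
  have b3 := hB _ (Finset.mem_image_of_mem _ hp)
  have e1 : (ε : ℤ) * (j - i) = ε * (k - i) + ε * (j - k) := by ring
  omega

theorem add (hP : Bdd ε P) (hQ : Bdd ε Q) : Bdd ε (P + Q) := by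
  intro d
  obtain ⟨N, hN⟩ := hP d
  obtain ⟨M, hM⟩ := hQ d
  refine ⟨max N M, fun i j hij => ?_⟩
  rw [max_lt_iff] at hij
  rw [Pi.add_apply, Pi.add_apply, map_add, hN _ _ hij.1, hM _ _ hij.2, add_zero]

theorem neg (hP : Bdd ε P) : Bdd ε (-P) := by
  intro d
  obtain ⟨N, hN⟩ := hP d
  exact ⟨N, fun i j hij => by rw [Pi.neg_apply, Pi.neg_apply, map_neg, hN _ _ hij, neg_zero]⟩

theorem of_le (N : ℤ) (h : ∀ i j : ℤ, N < ε * (j - i) → P i j = 0) : Bdd ε P :=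
  fun d => ⟨N, fun i j hij => by rw [h i j hij, map_zero]⟩

theorem map (hP : Bdd ε P) {T : Fn K →+ Fn K} (hT : Cts T) : Bdd ε fun i j => T (P i j) := by
  classical
  intro d
  obtain ⟨D, hD⟩ := hT d
  choose N hN using hP
  obtain ⟨B, hB⟩ := (D.image N).exists_le
  refine ⟨B, fun i j hij => hD _ fun e he => hN e _ _ ?_⟩
  have := hB _ (Finset.mem_image_of_mem N he)
  omega

end Bdd

/-- The subgroup of matrices bounded on one side. -/
def bddSubgroup (K : Type*) [Field K] (ε : ℤˣ) : AddSubgroup (Mat K) where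
  carrier := {P | Bdd ε P}
  zero_mem' := Bdd.of_le 0 fun _ _ _ => rfl
  add_mem' := Bdd.add
  neg_mem' := Bdd.neg

/-- The ring of matrices bounded on one side. -/
def LMat (K : Type*) [Field K] (ε : ℤˣ) : Type _ := bddSubgroup K ε

namespace LMat

variable {ε : ℤˣ}

instance : AddCommGroup (LMat K ε) := inferInstanceAs (AddCommGroup (bddSubgroup K ε))

/-- The entries. -/
def val (P : LMat K ε) : Mat K := Subtype.val P

theorem bdd (P : LMat K ε) : Bdd ε P.val := Subtype.property P

/-- A matrix bounded on one side. -/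
def mk (P : Mat K) (hP : Bdd ε P) : LMat K ε := ⟨P, hP⟩

@[simp] theorem val_mk (P : Mat K) (hP : Bdd ε P) : (mk P hP).val = P := rfl

@[ext] theorem ext {P Q : LMat K ε} (h : ∀ i j, P.val i j = Q.val i j) : P = Q :=
  Subtype.ext (funext fun i => funext fun j => h i j)

theorem val_add (P Q : LMat K ε) (i j : ℤ) : (P + Q).val i j = P.val i j + Q.val i j := rfl
theorem val_neg (P : LMat K ε) (i j : ℤ) : (-P).val i j = -P.val i j := rfl
theorem val_sub (P Q : LMat K ε) (i j : ℤ) : (P - Q).val i j = P.val i j - Q.val i j := rfl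
theorem val_zero (i j : ℤ) : (0 : LMat K ε).val i j = 0 := rfl

theorem lf (P Q : LMat K ε) (i j : ℤ) : LF fun k : ℤ => P.val i k * Q.val k j :=
  P.bdd.lf_mul Q.bdd i j

theorem bdd_mone : Bdd ε (mone : Mat K) := Bdd.of_le 0 fun i j hij => by
  rw [mone, if_neg]
  rintro rfl
  simp at hij

instance : Mul (LMat K ε) := ⟨fun P Q => mk (mmul P.val Q.val) (P.bdd.mul Q.bdd)⟩
instance : One (LMat K ε) := ⟨mk mone bdd_mone⟩

theorem val_mul (P Q : LMat K ε) (i j : ℤ) :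
    (P * Q).val i j = lsum fun k : ℤ => P.val i k * Q.val k j := rfl

theorem val_mul' (P Q : LMat K ε) : (P * Q).val = mmul P.val Q.val := rfl

theorem val_one (i j : ℤ) : (1 : LMat K ε).val i j = if i = j then 1 else 0 := rfl

instance : Ring (LMat K ε) where
  __ := (inferInstance : AddCommGroup (LMat K ε))
  mul_assoc P Q R := by
    refine ext fun i j => ?_
    simp only [val_mul]
    have h := P.bdd.lf_mul_mul Q.bdd R.bdd i j
    have e1 : ∀ l, (lsum fun k => P.val i k * Q.val k l) * R.val l j =
        lsum fun k => P.val i k * Q.val k l * R.val l j := fun l => lsum_mul _ (P.lf Q i l)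
    have e2 : ∀ k, (P.val i k * lsum fun l => Q.val k l * R.val l j) =
        lsum fun l => P.val i k * Q.val k l * R.val l j := fun k => by
      rw [mul_lsum _ (Q.lf R k j)]
      simp only [mul_assoc]
    simp only [e1, e2]
    exact (lsum_comm h).symm
  one_mul P := by
    refine ext fun i j => ?_
    rw [val_mul, lsum_eq_single i, val_one, if_pos rfl, one_mul]
    intro k hk
    rw [val_one, if_neg hk.symm, zero_mul]
  mul_one P := by
    refine ext fun i j => ?_
    rw [val_mul, lsum_eq_single j, val_one, if_pos rfl, mul_one]
    intro k hk
    rw [val_one, if_neg hk, mul_zero]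
  left_distrib P Q R := by
    refine ext fun i j => ?_
    simp only [val_mul, val_add, mul_add]
    exact lsum_add (P.lf Q i j) (P.lf R i j)
  right_distrib P Q R := by
    refine ext fun i j => ?_
    simp only [val_mul, val_add, add_mul]
    exact lsum_add (P.lf R i j) (Q.lf R i j)
  zero_mul P := by
    refine ext fun i j => ?_
    simp only [val_mul, val_zero, zero_mul]
    exact lsum_zero
  mul_zero P := by
    refine ext fun i j => ?_
    simp only [val_mul, val_zero, mul_zero]
    exact lsum_zero

theorem val_sum {σ : Type*} (s : Finset σ) (P : σ → LMat K ε) (i j : ℤ) :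
    (∑ a ∈ s, P a).val i j = ∑ a ∈ s, (P a).val i j := by
  classical
  induction s using Finset.induction_on with
  | empty => simp [val_zero]
  | insert a s ha ih => rw [Finset.sum_insert ha, Finset.sum_insert ha, val_add, ih]

theorem val_pow (P : LMat K ε) (m : ℕ) : (P ^ m).val = mpow P.val m := by
  induction m with
  | zero => rfl
  | succ m ih => rw [pow_succ', val_mul', ih, mpow]

/-- Diagonal matrices. -/
def diag (f : ℤ → Fn K) : LMat K ε := mk (fun i j => if i = j then f i else 0) <|
  Bdd.of_le 0 fun i j hij => by
    rw [if_neg]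
    rintro rfl
    simp at hij

theorem val_diag (f : ℤ → Fn K) (i j : ℤ) :
    (diag f : LMat K ε).val i j = if i = j then f i else 0 := rfl

theorem diag_mul (f : ℤ → Fn K) (P : LMat K ε) (i j : ℤ) :
    (diag f * P).val i j = f i * P.val i j := by
  rw [val_mul, lsum_eq_single i, val_diag, if_pos rfl]
  intro k hk
  rw [val_diag, if_neg hk.symm, zero_mul]

theorem mul_diag (f : ℤ → Fn K) (P : LMat K ε) (i j : ℤ) :
    (P * diag f).val i j = P.val i j * f j := by
  rw [val_mul, lsum_eq_single j, val_diag, if_pos rfl]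
  intro k hk
  rw [val_diag, if_neg hk, mul_zero]

/-- The shift matrices `Λ ^ n`. -/
def lam (n : ℤ) : LMat K ε := mk (shiftMat n) <| Bdd.of_le (ε * n) fun i j hij => by
  rw [shiftMat, if_neg]
  intro h
  rw [h] at hij
  omega

theorem lam_mul (n : ℤ) (P : LMat K ε) (i j : ℤ) : (lam n * P).val i j = P.val (i + n) j := by
  rw [val_mul, lsum_eq_single (i + n)]
  · rw [lam, val_mk, shiftMat, if_pos (by ring), one_mul]
  · intro k hk
    rw [lam, val_mk, shiftMat, if_neg (by omega), zero_mul]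

theorem mul_lam (n : ℤ) (P : LMat K ε) (i j : ℤ) : (P * lam n).val i j = P.val i (j - n) := by
  rw [val_mul, lsum_eq_single (j - n)]
  · rw [lam, val_mk, shiftMat, if_pos (by ring), mul_one]
  · intro k hk
    rw [lam, val_mk, shiftMat, if_neg (by omega), mul_zero]

/-- An additive operator with finite dependence applied to all entries. -/
def mapM (T : Fn K →+ Fn K) (hT : Cts T) : LMat K ε →+ LMat K ε where
  toFun P := mk (fun i j => T (P.val i j)) (P.bdd.map hT)
  map_zero' := by refine ext fun i j => ?_; exact map_zero T
  map_add' P Q := by refine ext fun i j => ?_; exact map_add T _ _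

/-- Entrywise shift coefficients. -/
def hopM (v : Bool) (c : K) (n : ℕ) : LMat K ε →+ LMat K ε := mapM _ (cts_hop v c n)

/-- Entrywise partial derivative. -/
def pderivM (u : Var) : LMat K ε →+ LMat K ε := mapM _ (Cts.pderiv u)

theorem val_hopM (v : Bool) (c : K) (n : ℕ) (P : LMat K ε) (i j : ℤ) :
    (hopM v c n P).val i j = hop v c n (P.val i j) := rfl

theorem val_pderivM (u : Var) (P : LMat K ε) (i j : ℤ) :
    (pderivM u P).val i j = pderiv K u (P.val i j) := rfl

theorem hopM_zero (v : Bool) (c : K) (P : LMat K ε) : hopM v c 0 P = P := by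
  refine ext fun i j => ?_
  rw [val_hopM, hop_zero]

theorem hopM_succ (v : Bool) (c : K) (k : ℕ) (P : LMat K ε) : hopM v c (k + 1) P =
    diag (fun _ => C (c / ((k : K) + 1))) *
      ∑ p ∈ antidiagonal k, hopM v c p.2 (pderivM (v, p.1) P) := by
  refine ext fun i j => ?_
  rw [val_hopM, hop_succ', diag_mul, val_sum, smul_eq_C_mul]
  rfl

theorem hopM_mul [CharZero K] (v : Bool) (c : K) (n : ℕ) (P Q : LMat K ε) :
    hopM v c n (P * Q) = ∑ p ∈ antidiagonal n, hopM v c p.1 P * hopM v c p.2 Q := by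
  refine ext fun i j => ?_
  rw [val_hopM, val_mul, hop_lsum v c n (P.lf Q i j), val_sum]
  simp only [hop_mul]
  rw [lsum_finset_sum]
  · rfl
  · intro p _
    exact (hopM v c p.1 P).lf (hopM v c p.2 Q) i j

theorem hopM_one (v : Bool) (c : K) (n : ℕ) :
    hopM v c n (1 : LMat K ε) = if n = 0 then 1 else 0 := by
  refine ext fun i j => ?_
  rw [val_hopM, val_one]
  by_cases hij : i = j
  · rw [if_pos hij, hop_one]
    split_ifs
    · rw [val_one, if_pos hij]
    · rfl
  · rw [if_neg hij, map_zero]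
    split_ifs
    · rw [val_one, if_neg hij]
    · rfl

/-- The entrywise shift as a ring homomorphism. -/
def shiftM [CharZero K] (v : Bool) (c : K) : LMat K ε →+* PowerSeries (LMat K ε) where
  toFun P := PowerSeries.mk fun n => hopM v c n P
  map_one' := by
    ext1 n
    rw [PowerSeries.coeff_mk, hopM_one, PowerSeries.coeff_one]
  map_mul' P Q := by
    ext1 n
    simp only [PowerSeries.coeff_mk, hopM_mul, PowerSeries.coeff_mul]
  map_zero' := by ext1 n; simp
  map_add' P Q := by ext1 n; simp

theorem coeff_shiftM [CharZero K] (v : Bool) (c : K) (n : ℕ) (P : LMat K ε) :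
    PowerSeries.coeff n (shiftM v c P) = hopM v c n P := by
  simp [shiftM]

/-- The entries vanish beyond the `a`-th diagonal in the direction `ε`. -/
def DegLE (a : ℤ) (P : LMat K ε) : Prop := ∀ i j : ℤ, a < ε * (j - i) → P.val i j = 0

theorem DegLE.hopM {a : ℤ} {P : LMat K ε} (hP : DegLE a P) (v : Bool) (c : K) (n : ℕ) :
    DegLE a (hopM v c n P) := fun i j hij => by
  rw [val_hopM, hP i j hij, map_zero]

theorem degLE_lam (n : ℤ) : DegLE (ε * n) (lam n : LMat K ε) := fun i j hij => by
  rw [lam, val_mk, shiftMat, if_neg]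
  intro h
  rw [h] at hij
  omega

theorem DegLE.mul {a b : ℤ} {P Q : LMat K ε} (hP : DegLE a P) (hQ : DegLE b Q) :
    DegLE (a + b) (P * Q) := fun i j hij => by
  rw [val_mul]
  convert lsum_zero with k
  by_cases h : a < ε * (k - i)
  · rw [hP _ _ h, zero_mul]
  · rw [hQ, mul_zero]
    have : (ε : ℤ) * (j - i) = ε * (k - i) + ε * (j - k) := by ring
    omega

/-- On the extremal diagonal only the product of the extremal entries survives, as for leading
coefficients of polynomials. -/
theorem DegLE.mul_apply {a b : ℤ} {P Q : LMat K ε} (hP : DegLE a P) (hQ : DegLE b Q) {i j : ℤ}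
    (hij : (ε : ℤ) * (j - i) = a + b) :
    (P * Q).val i j = P.val i (i + ε * a) * Q.val (i + ε * a) j := by
  rw [val_mul, lsum_eq_single (i + ε * a)]
  intro k hk
  have hne : (ε : ℤ) * (k - i) ≠ a := by
    intro h
    apply hk
    rw [← h, ← mul_assoc, ← Units.val_mul, Int.units_mul_self]
    simp
  have : (ε : ℤ) * (j - i) = ε * (k - i) + ε * (j - k) := by ring
  by_cases h : a < ε * (k - i)
  · rw [hP _ _ h, zero_mul]
  · rw [hQ, mul_zero]
    omega

/-- The matrix `exp (c ξ(·, Λ^ε))`. -/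
def expM (ε : ℤˣ) (v : Bool) (c : K) : LMat K ε :=
  mk (fun i j => expXi v c (ε * (j - i))) fun d => ⟨wt d, fun i j hij => by
    rw [coeff_expXi, if_neg (by omega)]⟩

theorem val_expM (v : Bool) (c : K) (i j : ℤ) :
    (expM ε v c).val i j = expXi v c (ε * (j - i)) := rfl

theorem expM_mul [CharZero K] (v : Bool) {c c' : K} (h : c + c' = 0) :
    expM ε v c * expM ε v c' = 1 := by
  refine ext fun i j => ?_
  rw [val_mul, val_one]
  simp only [val_expM]
  have e : (fun k : ℤ => expXi v c (ε * (k - i)) * expXi v c' (ε * (j - k))) = fun k : ℤ =>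
      (fun l : ℤ => expXi v c l * expXi v c' (ε * (j - i) - l))
        (((Equiv.subRight i).trans (Units.mulLeft ε)) k) := by
    ext1 k
    simp only [Equiv.trans_apply, Equiv.subRight_apply, Units.mulLeft_apply]
    congr 2
    ring
  rw [e, lsum_equiv ((Equiv.subRight i).trans (Units.mulLeft ε))
    (fun l : ℤ => expXi v c l * expXi v c' (ε * (j - i) - l)), lsum_expXi_mul v h]
  by_cases hij : i = j
  · rw [if_pos hij, if_pos (by rw [hij]; ring)]
  · rw [if_neg hij, if_neg]
    intro h0
    rcases mul_eq_zero.1 h0 with h1 | h1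
    · exact ε.ne_zero h1
    · omega

theorem expM_lam (v : Bool) (c : K) (n : ℤ) : expM ε v c * lam n = lam n * expM ε v c := by
  refine ext fun i j => ?_
  rw [lam_mul, mul_lam, val_expM, val_expM]
  congr 1
  ring

end LMat

end

section


/-! ### Pairs of wave matrices with common derivatives -/

open Finset.HasAntidiagonal (antidiagonal)

namespace LMat

section Common

variable {ε ε' : ℤˣ}

/-- `(X, Y) = (B W, B W')` for a matrix `B` bounded on both sides. -/
def Common (W : LMat K ε) (W' : LMat K ε') (X : LMat K ε) (Y : LMat K ε') : Prop :=
  ∃ (B : Mat K) (h : Bdd ε B) (h' : Bdd ε' B), X = mk B h * W ∧ Y = mk B h' * W'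

variable {W X X₂ : LMat K ε} {W' Y Y₂ : LMat K ε'}

theorem Common.zero : Common W W' 0 0 := by
  refine ⟨0, Bdd.of_le 0 fun _ _ _ => rfl, Bdd.of_le 0 fun _ _ _ => rfl, ?_, ?_⟩ <;>
  exact (zero_mul _).symm

theorem Common.add (h : Common W W' X Y) (h₂ : Common W W' X₂ Y₂) :
    Common W W' (X + X₂) (Y + Y₂) := by
  obtain ⟨B, h1, h2, rfl, rfl⟩ := h
  obtain ⟨B₂, h3, h4, rfl, rfl⟩ := h₂
  exact ⟨B + B₂, h1.add h3, h2.add h4, (add_mul _ _ _).symm, (add_mul _ _ _).symm⟩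

theorem Common.sum {σ : Type*} (s : Finset σ) {X : σ → LMat K ε} {Y : σ → LMat K ε'}
    (h : ∀ a ∈ s, Common W W' (X a) (Y a)) : Common W W' (∑ a ∈ s, X a) (∑ a ∈ s, Y a) := by
  classical
  induction s using Finset.induction_on with
  | empty => simpa using Common.zero
  | insert a s ha ih =>
    rw [Finset.sum_insert ha, Finset.sum_insert ha]
    exact (h a (by simp)).add (ih fun b hb => h b (by simp [hb]))

theorem Common.mul (h : Common W W' X Y) {A : Mat K} (hA : Bdd ε A) (hA' : Bdd ε' A) :
    Common W W' (mk A hA * X) (mk A hA' * Y) := by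
  obtain ⟨B, h1, h2, rfl, rfl⟩ := h
  exact ⟨mmul A B, hA.mul h1, hA'.mul h2, (mul_assoc _ _ _).symm, (mul_assoc _ _ _).symm⟩

/-- Logarithmic derivatives common to `W` and `W'` integrate to common shift matrices: the recursion
for the shift applied to `B W` involves only shifts of `B` and lower shifts of `W`. Boundedness of
`B` on both sides makes its products with both wave matrices meaningful. -/
theorem Common.hopM [CharZero K] (v : Bool) (c : K)
    (h : ∀ i : ℕ, Common W W' (pderivM (v, i) W) (pderivM (v, i) W')) (n : ℕ) :
    Common W W' (hopM v c n W) (hopM v c n W') := by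
  induction n using Nat.strong_induction_on with
  | _ n ih =>
    obtain _ | k := n
    · rw [hopM_zero, hopM_zero]
      exact ⟨mone, bdd_mone, bdd_mone, (one_mul W).symm, (one_mul W').symm⟩
    · rw [hopM_succ, hopM_succ]
      refine Common.mul (A := (diag (ε := ε) fun _ => C (c / ((k : K) + 1))).val)
        (Common.sum _ fun p hp => ?_) (LMat.bdd _)
        (LMat.bdd (diag (ε := ε') fun _ => C (c / ((k : K) + 1))))
      have hp' := Finset.HasAntidiagonal.mem_antidiagonal.1 hp
      obtain ⟨B, h1, h2, e1, e2⟩ := h p.1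
      rw [e1, e2, hopM_mul, hopM_mul]
      refine Common.sum _ fun q hq => ?_
      have hq' := Finset.HasAntidiagonal.mem_antidiagonal.1 hq
      exact (ih q.2 (by omega)).mul (h1.map (cts_hop v c q.1)) (h2.map (cts_hop v c q.1))

end Common

/-! ### Shifts that act through matrices with two diagonals -/

section Bidiagonal

variable {ε : ℤˣ}

theorem hop_expXi_of_ne {v w : Bool} (h : w ≠ v) (a c : K) (n : ℕ) (k : ℤ) :
    hop w c n (expXi v a k) = if n = 0 then expXi v a k else 0 := by
  obtain rfl : w = !v := by cases w <;> cases v <;> simp_all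
  exact hop_expXi_other v a c n k

variable {d e : ℤ → PowerSeries (Fn K)}

/-- The coefficient of a series of matrices with two diagonals. -/
def IsBidiag (ε : ℤˣ) (d e : ℤ → PowerSeries (Fn K)) (n : ℕ) (B : Mat K) : Prop :=
  ∀ i j : ℤ, B i j = (if j = i then PowerSeries.coeff n (d i) else 0) -
      (if j = i + ε then PowerSeries.coeff n (PowerSeries.X * e i) else 0)

theorem IsBidiag.mul {n : ℕ} {B : LMat K ε} {ε' : ℤˣ} (hB : IsBidiag ε' d e n B.val) (P : LMat K ε)
    (i j : ℤ) : (B * P).val i j = PowerSeries.coeff n (d i) * P.val i j -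
      PowerSeries.coeff n (PowerSeries.X * e i) * P.val (i + ε') j := by
  have hε0 : (ε' : ℤ) ≠ 0 := ε'.ne_zero
  rw [val_mul, lsum_eq_sum {i, i + (ε' : ℤ)}, Finset.sum_pair (by omega), hB, hB, if_pos rfl,
    if_neg (by omega), if_neg (by omega), if_pos rfl]
  · ring
  · intro k hk
    simp only [Finset.mem_insert, Finset.mem_singleton, not_or] at hk
    rw [hB, if_neg hk.1, if_neg hk.2, sub_zero, zero_mul]

theorem IsBidiag.mul' {n : ℕ} {B : LMat K ε} {ε' : ℤˣ} (hB : IsBidiag ε' d e n B.val) (P : LMat K ε)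
    (i j : ℤ) : (P * B).val i j = P.val i j * PowerSeries.coeff n (d j) -
      P.val i (j - ε') * PowerSeries.coeff n (PowerSeries.X * e (j - ε')) := by
  have hε0 : (ε' : ℤ) ≠ 0 := ε'.ne_zero
  rw [val_mul, lsum_eq_sum {j, j - (ε' : ℤ)}, Finset.sum_pair (by omega), hB, hB, if_pos rfl,
    if_neg (by omega), if_neg (by omega), if_pos (by omega)]
  · ring
  · intro k hk
    simp only [Finset.mem_insert, Finset.mem_singleton, not_or] at hk
    rw [hB, if_neg (by omega), if_neg (by omega), sub_zero, mul_zero]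

variable [CharZero K]

theorem shiftM_expM_of_ne {v w : Bool} (h : w ≠ v) (a c : K) :
    shiftM w c (expM ε v a) = PowerSeries.C (expM ε v a) := by
  ext1 n
  rw [coeff_shiftM, PowerSeries.coeff_C]
  refine ext fun i j => ?_
  rw [val_hopM, val_expM, hop_expXi_of_ne h]
  split_ifs <;> rfl

theorem unit_mul_sub (ε : ℤˣ) (i j : ℤ) : (ε : ℤ) * (j - (i + ε)) = ε * (j - i) - 1 := by
  have : (ε : ℤ) * ε = 1 := by rw [← Units.val_mul, Int.units_mul_self, Units.val_one]
  linear_combination -this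

/-- The matrix form of `e^{ξ(x-[ζ],z)} = (1 - ζz) e^{ξ(x,z)}` at `z = Λ^ε`. -/
theorem shiftM_expM (v : Bool) :
    shiftM v (-1) (expM (K := K) ε v 1) =
      (1 - PowerSeries.X * PowerSeries.C (lam ε)) * PowerSeries.C (expM ε v 1) := by
  ext1 n
  rw [coeff_shiftM, PowerSeries.coeff_mul_C, map_sub, PowerSeries.coeff_one]
  refine ext fun i j => ?_
  rw [val_hopM, val_expM, hop_expXi_of_mul_eq_neg_one v 1 (by ring)]
  obtain _ | n := n
  · simp [val_expM]
  · rw [if_neg (Nat.succ_ne_zero n), if_neg (Nat.succ_ne_zero n), PowerSeries.coeff_succ_X_mul,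
      PowerSeries.coeff_C, zero_sub, neg_mul, val_neg]
    obtain _ | n := n
    · rw [if_pos rfl, if_pos rfl, lam_mul, val_expM, unit_mul_sub]
    · rw [if_neg (by omega), if_neg (by omega), zero_mul, val_zero, neg_zero]

theorem shiftM_mul_expM (v : Bool) (P : LMat K ε) :
    shiftM v (-1) (P * expM ε v 1) =
      shiftM v (-1) P * (1 - PowerSeries.X * PowerSeries.C (lam ε)) *
        PowerSeries.C (expM ε v 1) := by
  rw [map_mul, shiftM_expM, mul_assoc]

/-- If `W = s e^{ξ(Λ^ε)}` and `W' = s' e^{ξ'(Λ^{-ε})}` are transformed by a shift of the variables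
of `ξ` through multiplication by the same matrices, then these have two diagonals. -/
theorem bidiagonal {ε' : ℤˣ} (hε : ε' = -ε) (v : Bool) {s si : LMat K ε} {s' si' : LMat K ε'}
    (hs : DegLE 0 s) (hsi : DegLE 0 si) (hs' : DegLE 0 s') (hsi' : DegLE 0 si')
    (h1 : s * si = 1) (h1' : s' * si' = 1) {B : Mat K} {n : ℕ} (hB : Bdd ε B) (hB' : Bdd ε' B)
    (hW : hopM v (-1) n (s * expM ε v 1) = mk B hB * (s * expM ε v 1))
    (hW' : hopM v (-1) n (s' * expM ε' (!v) 1) = mk B hB' * (s' * expM ε' (!v) 1)) (i j : ℤ) :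
    B i j = (if j = i then PowerSeries.coeff n
        (shiftHom v (-1) (s'.val i i) * PowerSeries.C (si'.val i i)) else 0) -
      (if j = i + ε then PowerSeries.coeff n (PowerSeries.X *
        (shiftHom v (-1) (s.val i i) * PowerSeries.C (si.val (i + ε) (i + ε)))) else 0) := by
  have hE : expM ε v (1 : K) * expM ε v (-1) = 1 := expM_mul v (by ring)
  have hE' : expM ε' (!v) (1 : K) * expM ε' (!v) (-1) = 1 := expM_mul (!v) (by ring)
  -- Solved for `B` through the first wave matrix: at most one diagonal lies beyond the main one in
  -- the direction `ε`, and it carries the factor `ζ`.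
  have hB1 : mk B hB = PowerSeries.coeff n
      (shiftM v (-1) s * (1 - PowerSeries.X * PowerSeries.C (lam ε))) * si := by
    have h3 : mk B hB = hopM v (-1) n (s * expM ε v 1) * (expM ε v (-1) * si) := by
      rw [hW, mul_assoc, mul_assoc s, ← mul_assoc _ _ si, hE, one_mul, h1, mul_one]
    rw [h3, ← coeff_shiftM, shiftM_mul_expM, PowerSeries.coeff_mul_C, mul_assoc,
      ← mul_assoc _ _ si, hE, one_mul]
  -- Solved for `B` through the second wave matrix, whose exponential does not feel the shift:
  -- nothing lies on the opposite side, and the main diagonal can be read off.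
  have hB2 : mk B hB' = hopM v (-1) n s' * si' := by
    have h3 : mk B hB' = hopM v (-1) n (s' * expM ε' (!v) 1) * (expM ε' (!v) (-1) * si') := by
      rw [hW', mul_assoc, mul_assoc s', ← mul_assoc _ _ si', hE', one_mul, h1', mul_one]
    rw [h3, ← coeff_shiftM, map_mul, shiftM_expM_of_ne (by simp), PowerSeries.coeff_mul_C,
      coeff_shiftM, mul_assoc, ← mul_assoc _ _ si', hE', one_mul]
  have hd2 : DegLE (0 + 0) (mk B hB') := hB2 ▸ (hs'.hopM v (-1) n).mul hsi'
  have hj : B i i = hop v (-1) n (s'.val i i) * si'.val i i := by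
    have := congrArg (fun P => LMat.val P i i) hB2
    simp only [val_mk] at this
    rw [this, (hs'.hopM v (-1) n).mul_apply hsi' (by ring)]
    simp [val_hopM]
  rw [PowerSeries.coeff_mul_C, coeff_shiftHom]
  have hεε : (ε : ℤ) * ε = 1 := by rw [← Units.val_mul, Int.units_mul_self, Units.val_one]
  have hε0 : (ε : ℤ) ≠ 0 := ε.ne_zero
  by_cases hji : j = i
  · subst hji
    rw [if_pos rfl, if_neg (by omega), sub_zero, hj]
  rw [if_neg hji, zero_sub]
  -- Entries on the negative side are killed by `hB2`; those on the positive side are computed from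
  -- `hB1`.
  by_cases hneg : (ε : ℤ) * (j - i) < 0
  · have : B i j = 0 := hd2 i j (by rw [hε, Units.val_neg]; linarith)
    rw [this, if_neg, neg_zero]
    rintro rfl
    rw [add_sub_cancel_left, hεε] at hneg
    omega
  have hpos : 0 < (ε : ℤ) * (j - i) := by
    refine lt_of_le_of_ne (not_lt.1 hneg) fun h => ?_
    rcases mul_eq_zero.1 h.symm with h | h
    · exact hε0 h
    · omega
  have hcase : PowerSeries.coeff n
      (shiftM v (-1) s * (1 - PowerSeries.X * PowerSeries.C (lam (K := K) (ε := ε) ε))) =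
      hopM v (-1) n s - (if n = 0 then 0 else hopM v (-1) (n - 1) s * lam ε) := by
    rw [mul_sub, mul_one, map_sub, coeff_shiftM, ← mul_assoc, PowerSeries.coeff_mul_C]
    congr 1
    obtain _ | m := n
    · simp
    · rw [PowerSeries.coeff_succ_mul_X, coeff_shiftM, if_neg (Nat.succ_ne_zero m),
        Nat.add_sub_cancel]
  rw [hcase] at hB1
  have hval : B i j = (hopM v (-1) n s * si).val i j -
      (if n = 0 then 0 else ((hopM v (-1) (n - 1) s * lam ε) * si).val i j) := by
    have := congrArg (fun P => LMat.val P i j) hB1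
    simp only [val_mk] at this
    rw [this, sub_mul, val_sub]
    split_ifs
    · rw [zero_mul, val_zero]
    · rfl
  have hlam : DegLE (0 + 1) (hopM v (-1) (n - 1) s * lam (K := K) (ε := ε) ε) := by
    have := degLE_lam (K := K) (ε := ε) ε
    rw [hεε] at this
    exact (hs.hopM v (-1) (n - 1)).mul this
  rw [hval, (hs.hopM v (-1) n).mul hsi i j (by omega), zero_sub, neg_inj]
  obtain _ | m := n
  · simp
  · rw [if_neg (Nat.succ_ne_zero m), PowerSeries.coeff_succ_X_mul, PowerSeries.coeff_mul_C,
      coeff_shiftHom, Nat.add_sub_cancel]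
    rw [Nat.add_sub_cancel] at hlam
    by_cases hji1 : j = i + ε
    · subst hji1
      rw [if_pos rfl, hlam.mul_apply hsi (by rw [add_sub_cancel_left, hεε]; ring), mul_lam,
        val_hopM]
      simp
    · rw [if_neg hji1, hlam.mul hsi]
      by_contra hc
      apply hji1
      have h5 : (ε : ℤ) * (j - i) = 1 := by omega
      linear_combination (ε : ℤ) * h5 - (j - i) * hεε

variable {v : Bool} {ε' : ℤˣ}

/-- The shift acts through a bidiagonal matrix. -/
theorem shift_of_bidiag {P : LMat K ε} (h : ∀ n, ∃ B : LMat K ε, IsBidiag ε' d e n B.val ∧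
    hopM v (-1) n P = B * P) (i j : ℤ) :
    shiftHom v (-1) (P.val i j) = d i * PowerSeries.C (P.val i j) -
      PowerSeries.X * e i * PowerSeries.C (P.val (i + ε') j) := by
  ext1 n
  obtain ⟨B, hB, hP⟩ := h n
  rw [coeff_shiftHom, map_sub, PowerSeries.coeff_mul_C, PowerSeries.coeff_mul_C, ← hB.mul, ← hP]
  rfl

/-- Shifting `Q P = 1`, with `P` shifted to `B P`, and cancelling `P` gives `Q(shifted) B = Q`: the
inverse obeys the adjoint relation. -/
theorem shift_inv_of_bidiag {P Q : LMat K ε} (hPQ : P * Q = 1) (hQP : Q * P = 1)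
    (h : ∀ n, ∃ B : LMat K ε, IsBidiag ε' d e n B.val ∧ hopM v (-1) n P = B * P) (i j : ℤ) :
    shiftHom v (-1) (Q.val i j) * d j -
      shiftHom v (-1) (Q.val i (j - ε')) * (PowerSeries.X * e (j - ε')) =
      PowerSeries.C (Q.val i j) := by
  choose B hB hP using h
  have h1 : shiftM v (-1) P = PowerSeries.mk B * PowerSeries.C P := by
    ext1 n
    rw [coeff_shiftM, PowerSeries.coeff_mul_C, PowerSeries.coeff_mk, hP]
  have h2 : shiftM v (-1) Q * PowerSeries.mk B = PowerSeries.C Q := by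
    have h3 : shiftM v (-1) Q * (PowerSeries.mk B * PowerSeries.C P) = 1 := by
      rw [← h1, ← map_mul, hQP, map_one]
    calc shiftM v (-1) Q * PowerSeries.mk B
        = shiftM v (-1) Q * (PowerSeries.mk B * PowerSeries.C P) * PowerSeries.C Q := by
          rw [mul_assoc, mul_assoc, ← map_mul PowerSeries.C, hPQ, map_one, mul_one]
      _ = PowerSeries.C Q := by rw [h3, one_mul]
  ext1 n
  have h4 : (PowerSeries.coeff n (shiftM v (-1) Q * PowerSeries.mk B)).val i j =
      (PowerSeries.coeff n (PowerSeries.C Q)).val i j := by rw [h2]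
  rw [PowerSeries.coeff_mul] at h4
  simp only [PowerSeries.coeff_mk, coeff_shiftM, val_sum,
    (hB _).mul', val_hopM, Finset.sum_sub_distrib] at h4
  rw [map_sub, PowerSeries.coeff_mul, PowerSeries.coeff_mul]
  simp only [coeff_shiftHom]
  rw [h4, PowerSeries.coeff_C, PowerSeries.coeff_C]
  split_ifs <;> rfl

/-- The same for a matrix multiplied by an exponential on the right. -/
theorem shift_of_bidiag_exp {P : LMat K ε} (h : ∀ n, ∃ B : LMat K ε, IsBidiag ε' d e n B.val ∧
    hopM v (-1) n (P * expM ε v 1) = B * (P * expM ε v 1)) (i j : ℤ) :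
    shiftHom v (-1) (P.val i j) - PowerSeries.X * shiftHom v (-1) (P.val i (j - ε)) =
      d i * PowerSeries.C (P.val i j) - PowerSeries.X * e i * PowerSeries.C (P.val (i + ε') j) := by
  have hE : expM ε v (1 : K) * expM ε v (-1) = 1 := expM_mul v (by ring)
  ext1 n
  obtain ⟨B, hB, hP⟩ := h n
  have h1 : PowerSeries.coeff n
      (shiftM v (-1) P * (1 - PowerSeries.X * PowerSeries.C (lam ε))) = B * P := by
    have h2 : hopM v (-1) n (P * expM ε v 1) * expM ε v (-1) = B * P := by
      rw [hP, mul_assoc, mul_assoc, hE, mul_one]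
    rw [← h2, ← coeff_shiftM, shiftM_mul_expM, PowerSeries.coeff_mul_C, mul_assoc, hE, mul_one]
  rw [map_sub, map_sub, coeff_shiftHom, PowerSeries.coeff_mul_C, PowerSeries.coeff_mul_C,
    ← hB.mul, ← h1, mul_sub, mul_one, map_sub, coeff_shiftM, val_sub, val_hopM, ← mul_assoc,
    PowerSeries.coeff_mul_C, mul_lam]
  congr 1
  obtain _ | m := n
  · simp [val_zero]
  · rw [PowerSeries.coeff_succ_mul_X, PowerSeries.coeff_succ_X_mul, coeff_shiftM, coeff_shiftHom,
      val_hopM]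

end Bidiagonal

end LMat

end

section


/-! ### Wave matrices without their exponential factors -/

open LMat

namespace Dressing

variable (S : Dressing K)

/-- `S₁` as an element of the ring of matrices bounded above. -/
def s₁ : LMat K 1 := LMat.mk S.S₁ <| Bdd.of_le 0 fun i j h => S.S₁_lower i j (by simpa using h)

/-- `S₁⁻¹` as an element of the ring of matrices bounded above. -/
def s₁i : LMat K 1 := LMat.mk S.S₁inv <| Bdd.of_le 0 fun i j h => S.S₁inv_lower i j (by simpa using h)

/-- `S₂` as an element of the ring of matrices bounded below. -/
def s₂ : LMat K (-1) := LMat.mk S.S₂ <| Bdd.of_le 0 fun i j h => S.S₂_upper i j (by simpa using h)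

/-- `S₂⁻¹` as an element of the ring of matrices bounded below. -/
def s₂i : LMat K (-1) := LMat.mk S.S₂inv <| Bdd.of_le 0 fun i j h => S.S₂inv_upper i j (by simpa using h)

theorem degLE_s₁ : DegLE 0 S.s₁ := fun i j h => S.S₁_lower i j (by simpa using h)
theorem degLE_s₁i : DegLE 0 S.s₁i := fun i j h => S.S₁inv_lower i j (by simpa using h)
theorem degLE_s₂ : DegLE 0 S.s₂ := fun i j h => S.S₂_upper i j (by simpa using h)
theorem degLE_s₂i : DegLE 0 S.s₂i := fun i j h => S.S₂inv_upper i j (by simpa using h)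

theorem s₁_mul : S.s₁ * S.s₁i = 1 := Subtype.ext S.S₁_mul_inv
theorem s₁i_mul : S.s₁i * S.s₁ = 1 := Subtype.ext S.S₁_inv_mul
theorem s₂_mul : S.s₂ * S.s₂i = 1 := Subtype.ext S.S₂_mul_inv
theorem s₂i_mul : S.s₂i * S.s₂ = 1 := Subtype.ext S.S₂_inv_mul

/-- The wave matrix `W₁`. -/
def w₁ : LMat K 1 := S.s₁ * expM 1 false 1

/-- The wave matrix `W₂`. -/
def w₂ : LMat K (-1) := S.s₂ * expM (-1) true 1

/-- The inverse of `W₁`. -/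
def w₁i : LMat K 1 := expM 1 false (-1) * S.s₁i

/-- The inverse of `W₂`. -/
def w₂i : LMat K (-1) := expM (-1) true (-1) * S.s₂i

theorem expM_one (v : Bool) (c : K) : (expM 1 v c).val = fun i j => expXi v c (j - i) := by
  funext i j
  rw [val_expM, Units.val_one, one_mul]

theorem expM_neg_one (v : Bool) (c : K) : (expM (-1) v c).val = fun i j => expXi v c (i - j) := by
  funext i j
  rw [val_expM, Units.val_neg, Units.val_one]
  congr 1
  ring

theorem val_w₁ : S.w₁.val = S.W₁ := by rw [w₁, val_mul', expM_one]; rfl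
theorem val_w₂ : S.w₂.val = S.W₂ := by rw [w₂, val_mul', expM_neg_one]; rfl
theorem val_w₁i : S.w₁i.val = S.W₁inv := by rw [w₁i, val_mul', expM_one]; rfl
theorem val_w₂i : S.w₂i.val = S.W₂inv := by rw [w₂i, val_mul', expM_neg_one]; rfl

section

variable [CharZero K]

theorem expM_mul_neg {ε : ℤˣ} (v : Bool) : expM ε v (1 : K) * expM ε v (-1) = 1 :=
  expM_mul v (by ring)

theorem expM_neg_mul {ε : ℤˣ} (v : Bool) : expM ε v (-1 : K) * expM ε v 1 = 1 :=
  expM_mul v (by ring)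

theorem w₁_mul : S.w₁ * S.w₁i = 1 := by
  rw [w₁, w₁i, mul_assoc, ← mul_assoc _ _ S.s₁i, expM_mul_neg, one_mul, s₁_mul]

theorem w₁i_mul : S.w₁i * S.w₁ = 1 := by
  rw [w₁, w₁i, mul_assoc, ← mul_assoc S.s₁i, s₁i_mul, one_mul, expM_neg_mul]

theorem w₂_mul : S.w₂ * S.w₂i = 1 := by
  rw [w₂, w₂i, mul_assoc, ← mul_assoc _ _ S.s₂i, expM_mul_neg, one_mul, s₂_mul]

theorem w₂i_mul : S.w₂i * S.w₂ = 1 := by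
  rw [w₂, w₂i, mul_assoc, ← mul_assoc S.s₂i, s₂i_mul, one_mul, expM_neg_mul]

end

end Dressing

/-! ### Matrices of shifted functions -/

/-- `τ(s; x - [z⁻¹])` as a matrix. -/
def nM₁ (f : ℤ → Fn K) : LMat K 1 := mk (fun s l => shift false (-1) (f s) (s - l)) <|
  Bdd.of_le 0 fun i j h => shift_of_neg _ _ _ (by simp at h; omega)

/-- `τ(s + 1; y - [z])` as a matrix. -/
def nM₂ (f : ℤ → Fn K) : LMat K (-1) := mk (fun s l => shift true (-1) (f (s + 1)) (l - s)) <|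
  Bdd.of_le 0 fun i j h => shift_of_neg _ _ _ (by simp at h; omega)

/-- `τ(s + 1; x + [z⁻¹])` as a matrix. -/
def nM₁star (f : ℤ → Fn K) : LMat K 1 := mk (fun l s => shift false 1 (f (s + 1)) (l - s)) <|
  Bdd.of_le 0 fun i j h => shift_of_neg _ _ _ (by simp at h; omega)

/-- `τ(s; y + [z])` as a matrix. -/
def nM₂star (f : ℤ → Fn K) : LMat K (-1) := mk (fun l s => shift true 1 (f s) (s - l)) <|
  Bdd.of_le 0 fun i j h => shift_of_neg _ _ _ (by simp at h; omega)

theorem tauSide₁_eq (f : ℤ → Fn K) (s k : ℤ) :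
    tauSide₁ f s k = (nM₁ f * expM 1 false 1).val s k := by
  rw [val_mul, Dressing.expM_one, ← lsum_equiv (Equiv.addLeft s)]
  simp only [tauSide₁, Ser.zpow_mul, Ser.mul, Ser.flip, nM₁, val_mk, Equiv.coe_addLeft]
  congr 1
  funext i
  congr 2 <;> ring

theorem tauSide₂_eq (f : ℤ → Fn K) (s k : ℤ) :
    tauSide₂ f s k = (nM₂ f * expM (-1) true 1).val s k := by
  rw [val_mul, Dressing.expM_neg_one, ← lsum_equiv (Equiv.addLeft s)]
  simp only [tauSide₂, Ser.zpow_mul, Ser.mul, Ser.flip, nM₂, val_mk, Equiv.coe_addLeft]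
  congr 1
  funext i
  congr 2 <;> ring

theorem tauSide₁star_eq (f : ℤ → Fn K) (s k : ℤ) :
    tauSide₁star f s k = (expM 1 false (-1) * nM₁star f).val (-k) s := by
  rw [val_mul, Dressing.expM_one, ← lsum_equiv (Equiv.subLeft s)]
  simp only [tauSide₁star, Ser.zpow_mul, Ser.mul, Ser.flip, nM₁star, val_mk, Equiv.subLeft_apply]
  congr 1
  funext i
  rw [mul_comm]
  congr 2 <;> ring

theorem tauSide₂star_eq (f : ℤ → Fn K) (s k : ℤ) :
    tauSide₂star f s k = (expM (-1) true (-1) * nM₂star f).val (-k) s := by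
  rw [val_mul, Dressing.expM_neg_one, ← lsum_equiv (Equiv.subLeft s)]
  simp only [tauSide₂star, Ser.zpow_mul, Ser.mul, Ser.flip, nM₂star, val_mk, Equiv.subLeft_apply]
  congr 1
  funext i
  rw [mul_comm]
  congr 2 <;> ring

section

variable [CharZero K] {ε : ℤˣ} {v : Bool} {P Q : LMat K ε}

theorem mul_expM_cancel : (∀ i j, (P * expM ε v 1).val i j = (Q * expM ε v 1).val i j) ↔
    ∀ i j, P.val i j = Q.val i j := by
  refine ⟨fun h i j => ?_, fun h i j => by rw [LMat.ext h]⟩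
  have := congrArg (· * expM ε v (-1)) (LMat.ext h)
  simp only [mul_assoc, Dressing.expM_mul_neg, mul_one] at this
  rw [this]

theorem expM_mul_cancel : (∀ i j, (expM ε v (-1) * P).val i j = (expM ε v (-1) * Q).val i j) ↔
    ∀ i j, P.val i j = Q.val i j := by
  refine ⟨fun h i j => ?_, fun h i j => by rw [LMat.ext h]⟩
  have := congrArg (expM ε v 1 * ·) (LMat.ext h)
  simp only [← mul_assoc, Dressing.expM_mul_neg, one_mul] at this
  rw [this]

end

variable {S : Dressing K} {τ : ℤ → Fn K} [CharZero K]

/-- The relations between the linearized tau function and the flow, without exponentials. -/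
structure IsDressingDeriv (S : Dressing K) (τ : ℤ → Fn K) (A : MatPair K) (σ : ℤ → Fn K) :
    Prop where
  wave₁ : ∀ s j, σ s * S.S₁ s j + τ s * (lsum fun i : ℤ => A.1 s i * S.S₁ i j) =
    shift false (-1) (σ s) (s - j)
  wave₂ : ∀ s j, σ s * S.S₂ s j + τ s * (lsum fun i : ℤ => A.2 s i * S.S₂ i j) =
    shift true (-1) (σ (s + 1)) (j - s)
  wave₁star : ∀ l s, S.S₁inv l s * σ (s + 1) - (lsum fun i : ℤ => S.S₁inv l i * A.1 i s) *
    τ (s + 1) = shift false 1 (σ (s + 1)) (l - s)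
  wave₂star : ∀ l s, S.S₂inv l s * σ (s + 1) - (lsum fun i : ℤ => S.S₂inv l i * A.2 i s) *
    τ (s + 1) = shift true 1 (σ s) (s - l)

/-- The exponential matrices are invertible and stand on the outer side of every term, so they
cancel. The bounds on `A` make the regrouping of products legitimate. -/
theorem isTauDeriv_iff {A : MatPair K} (h1 : Bdd 1 A.1) (h2 : Bdd (-1) A.2) (σ : ℤ → Fn K) :
    IsTauDeriv S τ A σ ↔ IsDressingDeriv S τ A σ := by
  set a₁ : LMat K 1 := mk A.1 h1
  set a₂ : LMat K (-1) := mk A.2 h2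
  have e1 : (∀ s k, σ s * S.Ψ₁ s k + τ s * (lsum fun i : ℤ => A.1 s i * S.Ψ₁ i k) =
      tauSide₁ σ s k) ↔ ∀ s j, σ s * S.S₁ s j + τ s * (lsum fun i : ℤ => A.1 s i * S.S₁ i j) =
        shift false (-1) (σ s) (s - j) := by
    have l : ∀ s k, σ s * S.Ψ₁ s k + τ s * (lsum fun i : ℤ => A.1 s i * S.Ψ₁ i k) =
        ((diag σ * S.s₁ + diag τ * (a₁ * S.s₁)) * expM 1 false 1).val s k := by
      intro s k
      rw [add_mul, val_add, mul_assoc, diag_mul, mul_assoc, diag_mul, mul_assoc]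
      change _ = σ s * S.w₁.val s k + τ s * (lsum fun i : ℤ => a₁.val s i * S.w₁.val i k)
      rw [S.val_w₁]; rfl
    simp only [l, tauSide₁_eq, mul_expM_cancel, val_add, diag_mul]
    rfl
  have e2 : (∀ s k, σ s * S.Ψ₂ s k + τ s * (lsum fun i : ℤ => A.2 s i * S.Ψ₂ i k) =
      tauSide₂ σ s k) ↔ ∀ s j, σ s * S.S₂ s j + τ s * (lsum fun i : ℤ => A.2 s i * S.S₂ i j) =
        shift true (-1) (σ (s + 1)) (j - s) := by
    have l : ∀ s k, σ s * S.Ψ₂ s k + τ s * (lsum fun i : ℤ => A.2 s i * S.Ψ₂ i k) =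
        ((diag σ * S.s₂ + diag τ * (a₂ * S.s₂)) * expM (-1) true 1).val s k := by
      intro s k
      rw [add_mul, val_add, mul_assoc, diag_mul, mul_assoc, diag_mul, mul_assoc]
      change _ = σ s * S.w₂.val s k + τ s * (lsum fun i : ℤ => a₂.val s i * S.w₂.val i k)
      rw [S.val_w₂]; rfl
    simp only [l, tauSide₂_eq, mul_expM_cancel, val_add, diag_mul]
    rfl
  have e3 : (∀ s k, σ (s + 1) * S.Ψ₁star s k - τ (s + 1) *
      (lsum fun i : ℤ => A.1 i s * S.Ψ₁star i k) = tauSide₁star σ s k) ↔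
      ∀ l s, S.S₁inv l s * σ (s + 1) - (lsum fun i : ℤ => S.S₁inv l i * A.1 i s) *
        τ (s + 1) = shift false 1 (σ (s + 1)) (l - s) := by
    have l : ∀ s k, σ (s + 1) * S.Ψ₁star s k - τ (s + 1) *
        (lsum fun i : ℤ => A.1 i s * S.Ψ₁star i k) = (expM 1 false (-1) *
          (S.s₁i * diag (fun s => σ (s + 1)) - (S.s₁i * a₁) * diag (fun s => τ (s + 1)))).val
            (-k) s := by
      intro s k
      rw [mul_sub, val_sub, ← mul_assoc, mul_diag, ← mul_assoc, mul_diag, ← mul_assoc]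
      change _ = S.w₁i.val (-k) s * σ (s + 1) -
        (lsum fun i : ℤ => S.w₁i.val (-k) i * a₁.val i s) * τ (s + 1)
      rw [S.val_w₁i]
      simp only [mul_comm _ (τ (s + 1)), mul_comm _ (σ (s + 1)), mul_comm _ (a₁.val _ _)]
      rfl
    simp only [l, tauSide₁star_eq]
    have := expM_mul_cancel (v := false) (P := S.s₁i * diag (fun s => σ (s + 1)) -
      (S.s₁i * a₁) * diag (fun s => τ (s + 1))) (Q := nM₁star σ)
    simp only [val_sub, mul_diag] at this
    refine Iff.trans ⟨fun h i j => ?_, fun h s k => h (-k) s⟩ this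
    simpa using h j (-i)
  have e4 : (∀ s k, σ (s + 1) * S.Ψ₂star s k - τ (s + 1) *
      (lsum fun i : ℤ => A.2 i s * S.Ψ₂star i k) = tauSide₂star σ s k) ↔
      ∀ l s, S.S₂inv l s * σ (s + 1) - (lsum fun i : ℤ => S.S₂inv l i * A.2 i s) *
        τ (s + 1) = shift true 1 (σ s) (s - l) := by
    have l : ∀ s k, σ (s + 1) * S.Ψ₂star s k - τ (s + 1) *
        (lsum fun i : ℤ => A.2 i s * S.Ψ₂star i k) = (expM (-1) true (-1) *
          (S.s₂i * diag (fun s => σ (s + 1)) - (S.s₂i * a₂) * diag (fun s => τ (s + 1)))).val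
            (-k) s := by
      intro s k
      rw [mul_sub, val_sub, ← mul_assoc, mul_diag, ← mul_assoc, mul_diag, ← mul_assoc]
      change _ = S.w₂i.val (-k) s * σ (s + 1) -
        (lsum fun i : ℤ => S.w₂i.val (-k) i * a₂.val i s) * τ (s + 1)
      rw [S.val_w₂i]
      simp only [mul_comm _ (τ (s + 1)), mul_comm _ (σ (s + 1)), mul_comm _ (a₂.val _ _)]
      rfl
    simp only [l, tauSide₂star_eq]
    have := expM_mul_cancel (v := true) (P := S.s₂i * diag (fun s => σ (s + 1)) -
      (S.s₂i * a₂) * diag (fun s => τ (s + 1))) (Q := nM₂star σ)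
    simp only [val_sub, mul_diag] at this
    refine Iff.trans ⟨fun h i j => ?_, fun h s k => h (-k) s⟩ this
    simpa using h j (-i)
  exact ⟨fun h => ⟨e1.1 h.1, e2.1 h.2, e3.1 h.3, e4.1 h.4⟩,
    fun h => ⟨e1.2 h.1, e2.2 h.2, e3.2 h.3, e4.2 h.4⟩⟩

/-- A tau function determines the dressing matrices. -/
theorem isDressingDeriv_zero (hτ : IsTau S τ) : IsDressingDeriv S τ 0 τ := by
  refine (isTauDeriv_iff (Bdd.of_le 0 fun _ _ _ => rfl) (Bdd.of_le 0 fun _ _ _ => rfl) τ).1 ?_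
  have h : ∀ f : ℤ → Fn K, (lsum fun i : ℤ => (0 : Fn K) * f i) = 0 := fun f => by
    simp only [zero_mul]; exact lsum_zero
  have h1 : ∀ (s : ℤ) (f : ℤ → Fn K), (lsum fun i : ℤ => (0 : MatPair K).1 s i * f i) = 0 :=
    fun _ => h
  have h2 : ∀ (s : ℤ) (f : ℤ → Fn K), (lsum fun i : ℤ => (0 : MatPair K).2 s i * f i) = 0 :=
    fun _ => h
  have h3 : ∀ (s : ℤ) (f : ℤ → Fn K), (lsum fun i : ℤ => (0 : MatPair K).1 i s * f i) = 0 :=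
    fun _ => h
  have h4 : ∀ (s : ℤ) (f : ℤ → Fn K), (lsum fun i : ℤ => (0 : MatPair K).2 i s * f i) = 0 :=
    fun _ => h
  refine ⟨fun s k => ?_, fun s k => ?_, fun s k => ?_, fun s k => ?_⟩
  · rw [← hτ.wave₁, h1, mul_zero, add_zero]
  · rw [← hτ.wave₂, h2, mul_zero, add_zero]
  · rw [← hτ.wave₁star, h3, mul_zero, sub_zero]
  · rw [← hτ.wave₂star, h4, mul_zero, sub_zero]

theorem IsTau.S₁ (hτ : IsTau S τ) (s j : ℤ) : τ s * S.S₁ s j = shift false (-1) (τ s) (s - j) := by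
  have h : (lsum fun i : ℤ => (0 : MatPair K).1 s i * S.S₁ i j) = 0 :=
    (congrArg lsum (funext fun i => zero_mul _)).trans lsum_zero
  rw [← (isDressingDeriv_zero hτ).wave₁ s j, h, mul_zero, add_zero]

theorem IsTau.S₂ (hτ : IsTau S τ) (s j : ℤ) :
    τ s * S.S₂ s j = shift true (-1) (τ (s + 1)) (j - s) := by
  have h : (lsum fun i : ℤ => (0 : MatPair K).2 s i * S.S₂ i j) = 0 :=
    (congrArg lsum (funext fun i => zero_mul _)).trans lsum_zero
  rw [← (isDressingDeriv_zero hτ).wave₂ s j, h, mul_zero, add_zero]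

theorem IsTau.S₁inv (hτ : IsTau S τ) (l s : ℤ) :
    S.S₁inv l s * τ (s + 1) = shift false 1 (τ (s + 1)) (l - s) := by
  have h : (lsum fun i : ℤ => S.S₁inv l i * (0 : MatPair K).1 i s) = 0 :=
    (congrArg lsum (funext fun i => mul_zero _)).trans lsum_zero
  rw [← (isDressingDeriv_zero hτ).wave₁star l s, h, zero_mul, sub_zero]

theorem IsTau.S₂inv (hτ : IsTau S τ) (l s : ℤ) :
    S.S₂inv l s * τ (s + 1) = shift true 1 (τ s) (s - l) := by
  have h : (lsum fun i : ℤ => S.S₂inv l i * (0 : MatPair K).2 i s) = 0 :=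
    (congrArg lsum (funext fun i => mul_zero _)).trans lsum_zero
  rw [← (isDressingDeriv_zero hτ).wave₂star l s, h, zero_mul, sub_zero]

end

section



/-! ### Bidiagonal shifts of the wave matrices -/

open LMat

namespace Dressing

variable {S : Dressing K}

/-- `L₁^n` vanishes above the `n`-th diagonal, so its upper part is a band and may act on `W₁` and
on `W₂` alike. -/
theorem bdd_upper_L₁ (S : Dressing K) (n : ℤ) (ε : ℤˣ) : Bdd ε (upper (S.L₁ n) + lower 0) := by
  refine Bdd.of_le |n| fun i j hij => ?_
  have h := ((degLE_s₁ S).mul (degLE_lam (ε := 1) n)).mul (degLE_s₁i S)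
  have h1 : S.L₁ n = (S.s₁ * lam n * S.s₁i).val := rfl
  have h2 : lower (0 : Mat K) i j = 0 := by simp [lower]
  rw [Pi.add_apply, Pi.add_apply, h2, add_zero, upper]
  split_ifs with hle
  · rw [h1, h]
    simp only [Units.val_one, one_mul, zero_add, add_zero]
    have := le_abs_self n
    rcases Int.units_eq_one_or ε with rfl | rfl
    · simp at hij; omega
    · have := abs_nonneg n
      simp at hij; omega
  · rfl

theorem bdd_lower_L₂ (S : Dressing K) (n : ℤ) (ε : ℤˣ) : Bdd ε (upper 0 + lower (S.L₂ n)) := by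
  refine Bdd.of_le |n| fun i j hij => ?_
  have h := ((degLE_s₂ S).mul (degLE_lam (ε := -1) (-n))).mul (degLE_s₂i S)
  have h1 : S.L₂ n = (S.s₂ * lam (-n) * S.s₂i).val := rfl
  have h2 : upper (0 : Mat K) i j = 0 := by simp [upper]
  rw [Pi.add_apply, Pi.add_apply, h2, zero_add, lower]
  split_ifs with hle
  · rw [h1, h]
    simp only [Units.val_neg, Units.val_one, neg_mul, one_mul, zero_add, add_zero]
    have := le_abs_self n
    rcases Int.units_eq_one_or ε with rfl | rfl
    · have := abs_nonneg n
      simp at hij; omega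
    · simp at hij; omega
  · rfl

theorem IsTodaSolution.common_false (hS : S.IsTodaSolution) (i : ℕ) :
    Common S.w₁ S.w₂ (pderivM (false, i) S.w₁) (pderivM (false, i) S.w₂) := by
  refine ⟨_, bdd_upper_L₁ S (i + 1) 1, bdd_upper_L₁ S (i + 1) (-1), LMat.ext fun s t => ?_,
    LMat.ext fun s t => ?_⟩
  · rw [val_pderivM, val_mul', val_w₁]
    exact congrFun (congrFun (hS i).1 s) t
  · rw [val_pderivM, val_mul', val_w₂]
    exact congrFun (congrFun (hS i).2.1 s) t

theorem IsTodaSolution.common_true (hS : S.IsTodaSolution) (i : ℕ) :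
    Common S.w₂ S.w₁ (pderivM (true, i) S.w₂) (pderivM (true, i) S.w₁) := by
  refine ⟨_, bdd_lower_L₂ S (i + 1) (-1), bdd_lower_L₂ S (i + 1) 1, LMat.ext fun s t => ?_,
    LMat.ext fun s t => ?_⟩
  · rw [val_pderivM, val_mul', val_w₂]
    exact congrFun (congrFun (hS i).2.2.2 s) t
  · rw [val_pderivM, val_mul', val_w₁]
    exact congrFun (congrFun (hS i).2.2.1 s) t

theorem s₁_diag (S : Dressing K) (i : ℤ) : S.s₁.val i i = 1 := S.S₁_diag i

theorem s₁i_diag (S : Dressing K) (i : ℤ) : S.s₁i.val i i = 1 := by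
  have := (degLE_s₁ S).mul_apply (degLE_s₁i S) (i := i) (j := i) (by simp)
  rw [s₁_mul, val_one, if_pos rfl] at this
  simp only [mul_zero, add_zero] at this
  rw [s₁_diag, one_mul] at this
  exact this.symm

variable [CharZero K]

/-- The unit diagonal of `S₁` makes the off-diagonal coefficient exactly `ζ`; the diagonal one comes
from `S₂(s,s) = τ_{s+1}/τ_s`. -/
theorem isBidiag_false (hS : S.IsTodaSolution) (n : ℕ) : ∃ (B : Mat K) (h : Bdd 1 B)
    (h' : Bdd (-1) B), IsBidiag 1 (fun s => shiftHom false (-1) (S.S₂ s s) *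
      PowerSeries.C (S.S₂inv s s)) (fun _ => 1) n B ∧
    hopM false (-1) n S.w₁ = LMat.mk B h * S.w₁ ∧
    hopM false (-1) n S.w₂ = LMat.mk B h' * S.w₂ := by
  obtain ⟨B, h, h', e1, e2⟩ := Common.hopM false (-1) hS.common_false n
  refine ⟨B, h, h', fun i j => ?_, e1, e2⟩
  rw [bidiagonal (by simp) false (degLE_s₁ S) (degLE_s₁i S) (degLE_s₂ S) (degLE_s₂i S)
    S.s₁_mul S.s₂_mul h h' e1 e2, s₁i_diag, s₁_diag, map_one, map_one, mul_one]
  rfl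

theorem isBidiag_true (hS : S.IsTodaSolution) (n : ℕ) : ∃ (B : Mat K) (h : Bdd (-1) B)
    (h' : Bdd 1 B), IsBidiag (-1) (fun _ => 1) (fun s => shiftHom true (-1) (S.S₂ s s) *
      PowerSeries.C (S.S₂inv (s - 1) (s - 1))) n B ∧
    hopM true (-1) n S.w₂ = LMat.mk B h * S.w₂ ∧
    hopM true (-1) n S.w₁ = LMat.mk B h' * S.w₁ := by
  obtain ⟨B, h, h', e1, e2⟩ := Common.hopM true (-1) hS.common_true n
  refine ⟨B, h, h', fun i j => ?_, e1, e2⟩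
  rw [bidiagonal (by simp) true (degLE_s₂ S) (degLE_s₂i S) (degLE_s₁ S) (degLE_s₁i S)
    S.s₂_mul S.s₁_mul h h' e1 e2, s₁i_diag, s₁_diag, map_one, map_one, mul_one]
  rfl

end Dressing

/-! ### Linear relations of the tau functions and the wave functions -/

variable [CharZero K]

/-- The linear equations satisfied by `θ_s = τ_s Ψ(s)` under shifts of the variables. -/
def IsWave (v : Bool) (τ θ : ℤ → Fn K) : Prop := ∀ s,
  PowerSeries.C (τ (s + 1)) * shiftHom v (-1) (θ s) =
    shiftHom v (-1) (τ (s + 1)) * PowerSeries.C (θ s) -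
      PowerSeries.X * shiftHom v (-1) (τ s) * PowerSeries.C (θ (s + 1))

/-- The linear equations satisfied by `φ_s = τ_s Ψ*(s - 1)` under shifts of the variables. -/
def IsAdjWave (v : Bool) (τ φ : ℤ → Fn K) : Prop := ∀ s,
  PowerSeries.C (φ (s + 1)) * shiftHom v (-1) (τ s) =
    PowerSeries.C (τ s) * shiftHom v (-1) (φ (s + 1)) -
      PowerSeries.X * PowerSeries.C (τ (s + 1)) * shiftHom v (-1) (φ s)

variable {S : Dressing K} {τ : ℤ → Fn K}

theorem IsTau.S₂_diag (hτ : IsTau S τ) (s : ℤ) : τ s * S.S₂ s s = τ (s + 1) := by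
  rw [hτ.S₂, sub_self, ← Int.natCast_zero, shift_natCast, hop_zero]

theorem IsTau.S₂inv_diag (hτ : IsTau S τ) (s : ℤ) : S.S₂inv s s * τ (s + 1) = τ s := by
  rw [hτ.S₂inv, sub_self, ← Int.natCast_zero, shift_natCast, hop_zero]

theorem IsTau.isUnit_C (hτ : IsTau S τ) (s : ℤ) : IsUnit (PowerSeries.C (τ s)) :=
  (hτ.unit s).map _

theorem IsTau.isUnit_shiftHom (hτ : IsTau S τ) (v : Bool) (c : K) (s : ℤ) :
    IsUnit (shiftHom v c (τ s)) := (hτ.unit s).map _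

/-- The shift of the ratio `τ_{s+1} / τ_s`. -/
theorem IsTau.shift_S₂_diag (hτ : IsTau S τ) (v : Bool) (s : ℤ) :
    shiftHom v (-1) (S.S₂ s s) * shiftHom v (-1) (τ s) = shiftHom v (-1) (τ (s + 1)) := by
  rw [← map_mul, mul_comm, hτ.S₂_diag]

section

variable {ε : ℤˣ} {P Q : LMat K ε}

/-- The bidiagonal relation after clearing the denominators in `S₂(s,s) = τ_{s+1}/τ_s`. It holds for
any `P` transformed by these matrices, hence for both wave matrices. -/
theorem isWave_false (hτ : IsTau S τ) (h : ∀ n, ∃ B : LMat K ε, IsBidiag 1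
      (fun s => shiftHom false (-1) (S.S₂ s s) * PowerSeries.C (S.S₂inv s s)) (fun _ => 1) n B.val ∧
      hopM false (-1) n P = B * P) (b : ℤ) : IsWave false τ fun s => τ s * P.val s b := fun s => by
  have h1 := shift_of_bidiag h s b
  have h2 := hτ.shift_S₂_diag false s
  have h3 := congrArg (PowerSeries.C (R := Fn K)) (hτ.S₂inv_diag s)
  simp only [map_mul, Units.val_one] at *
  linear_combination (PowerSeries.C (τ (s + 1)) * shiftHom false (-1) (τ s)) * h1 +
    PowerSeries.C (P.val s b) * PowerSeries.C (S.S₂inv s s) * PowerSeries.C (τ (s + 1)) * h2 +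
    PowerSeries.C (P.val s b) * shiftHom false (-1) (τ (s + 1)) * h3

theorem isAdjWave_false (hτ : IsTau S τ) (hPQ : P * Q = 1) (hQP : Q * P = 1)
    (h : ∀ n, ∃ B : LMat K ε, IsBidiag 1
      (fun s => shiftHom false (-1) (S.S₂ s s) * PowerSeries.C (S.S₂inv s s)) (fun _ => 1) n B.val ∧
      hopM false (-1) n P = B * P) (k : ℤ) :
    IsAdjWave false τ fun s => τ s * Q.val k (s - 1) := fun s => by
  have h1 := shift_inv_of_bidiag hPQ hQP h k s
  have h2 := hτ.shift_S₂_diag false s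
  have h3 := congrArg (PowerSeries.C (R := Fn K)) (hτ.S₂inv_diag s)
  simp only [map_mul, Units.val_one, add_sub_cancel_right] at *
  linear_combination (-PowerSeries.C (τ (s + 1)) * shiftHom false (-1) (τ s)) * h1 +
    shiftHom false (-1) (Q.val k s) * PowerSeries.C (S.S₂inv s s) * PowerSeries.C (τ (s + 1)) * h2 +
    shiftHom false (-1) (Q.val k s) * shiftHom false (-1) (τ (s + 1)) * h3

/-- The `y`-shift couples `s` with `s - 1` instead of `s + 1`; reversing the index and using `s ↦ 1
- s` on `τ` restores the form of the `x`-relation. -/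
theorem isWave_true (hτ : IsTau S τ) (h : ∀ n, ∃ B : LMat K ε, IsBidiag (-1) (fun _ => 1)
      (fun s => shiftHom true (-1) (S.S₂ s s) * PowerSeries.C (S.S₂inv (s - 1) (s - 1))) n B.val ∧
      hopM true (-1) n P = B * P) (b : ℤ) :
    IsWave true (fun s => τ (1 - s)) fun s => τ (-s) * P.val (-s) b := fun s => by
  obtain ⟨t, rfl⟩ : ∃ t, s = -t := ⟨-s, by ring⟩
  have h1 := shift_of_bidiag h t b
  have h2 := hτ.shift_S₂_diag true t
  have h3 := congrArg (PowerSeries.C (R := Fn K)) (hτ.S₂inv_diag (t - 1))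
  have e1 : 1 - (-t + 1) = t := by ring
  have e2 : -(-t + 1) = t - 1 := by ring
  have e3 : 1 - -t = t + 1 := by ring
  simp only [map_mul, Units.val_one, Units.val_neg, e1, e2, e3, neg_neg, sub_add_cancel,
    ← sub_eq_add_neg] at *
  linear_combination (PowerSeries.C (τ t) * shiftHom true (-1) (τ t)) * h1 -
    PowerSeries.X * PowerSeries.C (P.val (t - 1) b) * PowerSeries.C (S.S₂inv (t - 1) (t - 1)) *
      PowerSeries.C (τ t) * h2 -
    PowerSeries.X * PowerSeries.C (P.val (t - 1) b) * shiftHom true (-1) (τ (t + 1)) * h3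

theorem isAdjWave_true (hτ : IsTau S τ) (hPQ : P * Q = 1) (hQP : Q * P = 1)
    (h : ∀ n, ∃ B : LMat K ε, IsBidiag (-1) (fun _ => 1)
      (fun s => shiftHom true (-1) (S.S₂ s s) * PowerSeries.C (S.S₂inv (s - 1) (s - 1))) n B.val ∧
      hopM true (-1) n P = B * P) (k : ℤ) :
    IsAdjWave true (fun s => τ (1 - s)) fun s => τ (2 - s) * Q.val k (1 - s) := fun s => by
  obtain ⟨t, rfl⟩ : ∃ t, s = -t := ⟨-s, by ring⟩
  have h1 := shift_inv_of_bidiag hPQ hQP h k t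
  have h2 := hτ.shift_S₂_diag true (t + 1)
  have h3 := congrArg (PowerSeries.C (R := Fn K)) (hτ.S₂inv_diag t)
  have e1 : 1 - (-t + 1) = t := by ring
  have e2 : 2 - (-t + 1) = t + 1 := by ring
  have e3 : 1 - -t = t + 1 := by ring
  have e4 : 2 - -t = t + 1 + 1 := by ring
  simp only [map_mul, Units.val_one, Units.val_neg, e1, e2, e3, e4, sub_neg_eq_add,
    add_sub_cancel_right, mul_one] at *
  linear_combination (-PowerSeries.C (τ (t + 1)) * shiftHom true (-1) (τ (t + 1))) * h1 -
    PowerSeries.X * shiftHom true (-1) (Q.val k (t + 1)) * PowerSeries.C (S.S₂inv t t) *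
      PowerSeries.C (τ (t + 1)) * h2 -
    PowerSeries.X * shiftHom true (-1) (Q.val k (t + 1)) * shiftHom true (-1) (τ (t + 1 + 1)) * h3

end

end

section



/-! ### Coefficients with integer indices -/

open Finset.HasAntidiagonal (antidiagonal)

/-- The coefficient with an integer index. -/
def zcoeff {A : Type*} [Semiring A] (q : ℤ) : PowerSeries A →+ A :=
  if 0 ≤ q then (PowerSeries.coeff q.toNat).toAddMonoidHom else 0

section

variable {A : Type*} [CommSemiring A]

theorem zcoeff_of_neg {q : ℤ} (hq : q < 0) (F : PowerSeries A) : zcoeff q F = 0 := by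
  rw [zcoeff, if_neg (by omega)]
  rfl

theorem zcoeff_natCast (n : ℕ) (F : PowerSeries A) : zcoeff n F = PowerSeries.coeff n F := by
  rw [zcoeff, if_pos (by omega)]
  rfl

theorem zcoeff_C_mul (q : ℤ) (a : A) (F : PowerSeries A) :
    zcoeff q (PowerSeries.C a * F) = a * zcoeff q F := by
  rcases lt_or_ge q 0 with h | h
  · rw [zcoeff_of_neg h, zcoeff_of_neg h, mul_zero]
  · lift q to ℕ using h
    rw [zcoeff_natCast, zcoeff_natCast, PowerSeries.coeff_C_mul]

theorem zcoeff_X_mul (q : ℤ) (F : PowerSeries A) :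
    zcoeff q (PowerSeries.X * F) = zcoeff (q - 1) F := by
  rcases lt_or_ge q 0 with h | h
  · rw [zcoeff_of_neg h, zcoeff_of_neg (by omega)]
  · lift q to ℕ using h
    obtain _ | n := q
    · rw [zcoeff_natCast, zcoeff_of_neg (by simp), PowerSeries.coeff_zero_X_mul]
    · rw [zcoeff_natCast, PowerSeries.coeff_succ_X_mul, ← zcoeff_natCast]
      congr 2
      push_cast
      ring

theorem zcoeff_map {B : Type*} [CommSemiring B] (f : A →+* B) (q : ℤ) (F : PowerSeries A) :
    zcoeff q (PowerSeries.map f F) = f (zcoeff q F) := by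
  rcases lt_or_ge q 0 with h | h
  · rw [zcoeff_of_neg h, zcoeff_of_neg h, map_zero]
  · lift q to ℕ using h
    rw [zcoeff_natCast, zcoeff_natCast, PowerSeries.coeff_map]

theorem ext_zcoeff {F G : PowerSeries A} (h : ∀ q, zcoeff q F = zcoeff q G) : F = G := by
  ext1 n
  rw [← zcoeff_natCast, h, zcoeff_natCast]

end

variable [CharZero K]

theorem zcoeff_shiftHom (v : Bool) (c : K) (q : ℤ) (f : Fn K) :
    zcoeff q (shiftHom v c f) = shift v c f q := by
  rcases lt_or_ge q 0 with h | h
  · rw [zcoeff_of_neg h, shift_of_neg v c f h]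
  · lift q to ℕ using h
    rw [zcoeff_natCast, coeff_shiftHom, shift_natCast]

theorem shift_zero (v : Bool) (c : K) (q : ℤ) : shift v c 0 q = 0 := by
  rw [← zcoeff_shiftHom, map_zero, map_zero]

theorem shift_comm (v w : Bool) (c d : K) (f : Fn K) (p q : ℤ) :
    shift v c (shift w d f q) p = shift w d (shift v c f p) q := by
  rcases lt_or_ge p 0 with h | h
  · rw [shift_of_neg v c _ h, shift_of_neg v c _ h, shift_zero]
  rcases lt_or_ge q 0 with h' | h'
  · rw [shift_of_neg w d _ h', shift_of_neg w d _ h', shift_zero]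
  lift p to ℕ using h
  lift q to ℕ using h'
  simp only [shift_natCast]
  exact hop_comm _ _ _ _ _ _ _

/-- The shift operator extended to power series in the shift parameter. -/
def extHom (v : Bool) (c : K) : PowerSeries (Fn K) →+* PowerSeries (Fn K) where
  toFun F := PowerSeries.mk fun n =>
    ∑ p ∈ antidiagonal n, hop v c p.1 (PowerSeries.coeff p.2 F)
  map_one' := by
    ext1 n
    rw [PowerSeries.coeff_mk, Finset.sum_eq_single (n, 0)]
    · rw [PowerSeries.coeff_zero_one, hop_one, PowerSeries.coeff_one]
    · rintro ⟨a, b⟩ hp hne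
      rw [PowerSeries.coeff_one, if_neg, map_zero]
      rintro rfl
      exact hne (by simpa using hp)
    · simp
  map_mul' F G := by
    ext1 n
    simp only [PowerSeries.coeff_mk, PowerSeries.coeff_mul, map_sum, hop_mul, Finset.sum_mul_sum]
    have e1 : ∀ p : ℕ × ℕ, (∑ x ∈ antidiagonal p.2, ∑ y ∈ antidiagonal p.1,
        hop v c y.1 (PowerSeries.coeff x.1 F) * hop v c y.2 (PowerSeries.coeff x.2 G)) =
        ∑ y ∈ antidiagonal p.1, ∑ x ∈ antidiagonal p.2,
        hop v c y.1 (PowerSeries.coeff x.1 F) * hop v c y.2 (PowerSeries.coeff x.2 G) :=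
      fun p => Finset.sum_comm
    simp only [e1]
    rw [← sum_antidiagonal_assoc fun a b j => ∑ x ∈ antidiagonal j,
        hop v c a (PowerSeries.coeff x.1 F) * hop v c b (PowerSeries.coeff x.2 G),
      ← sum_antidiagonal_assoc fun a b j => ∑ x ∈ antidiagonal j,
        hop v c a (PowerSeries.coeff b F) * hop v c x.1 (PowerSeries.coeff x.2 G)]
    refine Finset.sum_congr rfl fun p _ => ?_
    exact sum_antidiagonal_left_comm (fun b i d => hop v c p.1 (PowerSeries.coeff i F) *
      hop v c b (PowerSeries.coeff d G)) p.2
  map_zero' := by ext1 n; simp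
  map_add' F G := by ext1 n; simp [Finset.sum_add_distrib]

theorem coeff_extHom (v : Bool) (c : K) (n : ℕ) (F : PowerSeries (Fn K)) :
    PowerSeries.coeff n (extHom v c F) =
      ∑ p ∈ antidiagonal n, hop v c p.1 (PowerSeries.coeff p.2 F) := by
  simp [extHom]

theorem extHom_C (v : Bool) (c : K) (f : Fn K) : extHom v c (PowerSeries.C f) = shiftHom v c f := by
  ext1 n
  rw [coeff_extHom, coeff_shiftHom, Finset.sum_eq_single (n, 0)]
  · rw [PowerSeries.coeff_zero_C]
  · rintro ⟨a, b⟩ hp hne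
    rw [PowerSeries.coeff_C, if_neg, map_zero]
    rintro rfl
    exact hne (by simpa using hp)
  · simp

theorem extHom_X (v : Bool) (c : K) : extHom v c PowerSeries.X = PowerSeries.X := by
  ext1 n
  rw [coeff_extHom, PowerSeries.coeff_X]
  simp only [PowerSeries.coeff_X, apply_ite, map_zero, hop_one]
  obtain _ | n := n
  · simp
  · rw [Finset.sum_eq_single (n, 1)]
    · simp
    · rintro ⟨a, b⟩ hp hne
      have := Finset.HasAntidiagonal.mem_antidiagonal.1 hp
      rw [if_neg]
      intro (h : b = 1)
      apply hne
      ext <;> simp_all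
    · simp

/-- The shift, extended so that its own parameter is fixed, undoes the opposite shift; it is used to
turn negative shifts into positive ones. -/
theorem extHom_shiftHom (v : Bool) (c : K) (f : Fn K) :
    extHom v c (shiftHom v (-c) f) = PowerSeries.C f := by
  ext1 n
  rw [coeff_extHom, PowerSeries.coeff_C, ← hop_inv v c n f]
  simp only [coeff_shiftHom]

/-! ### Two shift parameters -/

/-- Power series in `α` and `ζ`. -/
abbrev TwoSer (K : Type*) [Field K] : Type _ := PowerSeries (PowerSeries (Fn K))

/-- Constant series. -/
def cc : Fn K →+* TwoSer K := PowerSeries.C.comp PowerSeries.C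

/-- The shift by `α`. -/
def sα (v : Bool) (c : K) : Fn K →+* TwoSer K := PowerSeries.C.comp (shiftHom v c)

/-- The shift by `ζ`. -/
def sζ (v : Bool) (c : K) : Fn K →+* TwoSer K := (PowerSeries.map PowerSeries.C).comp (shiftHom v c)

/-- The shifts by `α` and `ζ`. -/
def sαζ (v : Bool) (c : K) (w : Bool) (d : K) : Fn K →+* TwoSer K :=
  (PowerSeries.map (shiftHom v c)).comp (shiftHom w d)

/-- The parameter `α`. -/
def pα : TwoSer K := PowerSeries.C PowerSeries.X

/-- The parameter `ζ`. -/
def pζ : TwoSer K := PowerSeries.X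

/-- The coefficient of `α ^ p ζ ^ q`. -/
def cf (p q : ℤ) : TwoSer K →+ Fn K := (zcoeff p).comp (zcoeff q)

section cf

variable (v w : Bool) (c d : K) (f g : Fn K) (F : TwoSer K) (p q : ℤ)

theorem ext_cf {F G : TwoSer K} (h : ∀ p q, cf p q F = cf p q G) : F = G :=
  ext_zcoeff fun q => ext_zcoeff fun p => h p q

theorem cf_pα_mul : cf p q (pα * F) = cf (p - 1) q F := by
  rw [cf, AddMonoidHom.comp_apply, pα, zcoeff_C_mul, zcoeff_X_mul]
  rfl

theorem cf_pζ_mul : cf p q (pζ * F) = cf p (q - 1) F := by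
  rw [cf, AddMonoidHom.comp_apply, pζ, zcoeff_X_mul]
  rfl

theorem cf_cc_mul_sαζ : cf p q (cc f * sαζ v c w d g) = f * shift v c (shift w d g q) p := by
  simp only [cf, AddMonoidHom.comp_apply, cc, sαζ, RingHom.comp_apply]
  rw [zcoeff_C_mul, zcoeff_C_mul, zcoeff_map, zcoeff_shiftHom, zcoeff_shiftHom]

theorem cf_sα_mul_sζ : cf p q (sα v c f * sζ w d g) = shift v c f p * shift w d g q := by
  simp only [cf, AddMonoidHom.comp_apply, sα, sζ, RingHom.comp_apply]
  rw [zcoeff_C_mul, zcoeff_map, mul_comm, zcoeff_C_mul, zcoeff_shiftHom, zcoeff_shiftHom, mul_comm]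

end cf

/-- The inverse of the shift by `-α`. -/
def unshift (v : Bool) : TwoSer K →+* TwoSer K := PowerSeries.map (extHom v 1)

section unshift

variable (v w : Bool) (d : K) (f : Fn K)

theorem unshift_pα : unshift v (pα : TwoSer K) = pα := by
  rw [unshift, pα, PowerSeries.map_C, extHom_X]

theorem unshift_pζ : unshift v (pζ : TwoSer K) = pζ := by
  rw [unshift, pζ, PowerSeries.map_X]

theorem unshift_cc : unshift v (cc f) = sα v 1 f := by
  rw [unshift, cc, RingHom.comp_apply, PowerSeries.map_C, extHom_C]
  rfl

theorem unshift_sα : unshift v (sα v (-1) f) = cc f := by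
  rw [unshift, sα, RingHom.comp_apply, PowerSeries.map_C, extHom_shiftHom]
  rfl

theorem unshift_sζ : unshift v (sζ w d f) = sαζ v 1 w d f := by
  rw [unshift, sζ, sαζ, RingHom.comp_apply, RingHom.comp_apply]
  ext1 n
  rw [PowerSeries.coeff_map, PowerSeries.coeff_map, extHom_C, PowerSeries.coeff_map]

theorem unshift_sαζ : unshift v (sαζ v (-1) w d f) = sζ w d f := by
  rw [unshift, sζ, sαζ, RingHom.comp_apply, RingHom.comp_apply]
  ext1 n
  rw [PowerSeries.coeff_map, PowerSeries.coeff_map, extHom_shiftHom, PowerSeries.coeff_map]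

end unshift

end

section



/-! ### Bilinear identities of the tau functions -/

open LMat Dressing

variable [CharZero K]

/-- The bilinear identity for two shifts of the same set of variables. -/
def IsHirota (v : Bool) (τ : ℤ → Fn K) : Prop := ∀ s,
  pα * (cc (τ (s + 1)) * sαζ v (-1) v (-1) (τ s)) -
    pζ * (cc (τ (s + 1)) * sαζ v (-1) v (-1) (τ s)) =
  pα * (sα v (-1) (τ s) * sζ v (-1) (τ (s + 1))) - pζ * (sα v (-1) (τ (s + 1)) * sζ v (-1) (τ s))

/-- The bilinear identity for shifts of both sets of variables. -/
def IsMixedHirota (v : Bool) (τ : ℤ → Fn K) : Prop := ∀ s p q,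
  τ s * shift v (-1) (shift (!v) (-1) (τ s) q) p =
    shift v (-1) (τ s) p * shift (!v) (-1) (τ s) q -
      shift v (-1) (τ (s - 1)) (p - 1) * shift (!v) (-1) (τ (s + 1)) (q - 1)

variable {S : Dressing K} {τ : ℤ → Fn K}

theorem IsHirota.of_shift {v : Bool} (h : ∀ s p, PowerSeries.C (τ (s + 1)) *
      shiftHom v (-1) (shift v (-1) (τ s) (p - 1)) -
      PowerSeries.X * (PowerSeries.C (τ (s + 1)) * shiftHom v (-1) (shift v (-1) (τ s) p)) =
    PowerSeries.C (shift v (-1) (τ s) (p - 1)) * shiftHom v (-1) (τ (s + 1)) -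
      PowerSeries.X * (PowerSeries.C (shift v (-1) (τ (s + 1)) p) * shiftHom v (-1) (τ s))) :
    IsHirota v τ := fun s => ext_cf fun p q => by
  have h1 := congrArg (zcoeff q) (h s p)
  simp only [map_sub, zcoeff_X_mul, zcoeff_C_mul, zcoeff_shiftHom] at h1
  simp only [map_sub, cf_pα_mul, cf_pζ_mul, cf_cc_mul_sαζ, cf_sα_mul_sζ]
  rw [shift_comm v v (-1) (-1) (τ s) (p - 1) q, shift_comm v v (-1) (-1) (τ s) p (q - 1), h1]

/-- The entries of `S₁` are coefficients of `τ(x-[z⁻¹])/τ`, so the bidiagonal law for `S₁`, with the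
extra factor `1 - ζΛ` from the exponential, is already a bilinear identity for `τ`. -/
theorem isHirota_false (hS : S.IsTodaSolution) (hτ : IsTau S τ) : IsHirota false τ := by
  refine IsHirota.of_shift fun s p => ?_
  have h1 := shift_of_bidiag_exp (P := S.s₁) (fun n => by
    obtain ⟨B, h, h', e, e1, e2⟩ := isBidiag_false hS n
    exact ⟨LMat.mk B h, e, e1⟩) s (s - (p - 1))
  -- The column `s - (p - 1)` was chosen so that the three entries of `S₁` involved are the shift
  -- coefficients of order `p - 1`, `p` and `p`.
  have h2 := hτ.shift_S₂_diag false s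
  have h3 := congrArg (PowerSeries.C (R := Fn K)) (hτ.S₂inv_diag s)
  have a1 := hτ.S₁ s (s - (p - 1))
  have a2 := hτ.S₁ s (s - (p - 1) - 1)
  have a3 := hτ.S₁ (s + 1) (s - (p - 1))
  rw [show s - (s - (p - 1)) = p - 1 by ring] at a1
  rw [show s - (s - (p - 1) - 1) = p by ring] at a2
  rw [show s + 1 - (s - (p - 1)) = p by ring] at a3
  rw [← a1, ← a2, ← a3]
  simp only [Units.val_one, map_mul] at *
  change shiftHom false (-1) (S.S₁ s (s - (p - 1))) - PowerSeries.X *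
    shiftHom false (-1) (S.S₁ s (s - (p - 1) - 1)) = _ * PowerSeries.C (S.S₁ s (s - (p - 1))) -
      _ * PowerSeries.C (S.S₁ (s + 1) (s - (p - 1))) at h1
  linear_combination (PowerSeries.C (τ (s + 1)) * shiftHom false (-1) (τ s)) * h1 +
    PowerSeries.C (S.S₁ s (s - (p - 1))) * PowerSeries.C (S.S₂inv s s) *
      PowerSeries.C (τ (s + 1)) * h2 +
    PowerSeries.C (S.S₁ s (s - (p - 1))) * shiftHom false (-1) (τ (s + 1)) * h3

theorem isHirota_true (hS : S.IsTodaSolution) (hτ : IsTau S τ) :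
    IsHirota true fun s => τ (1 - s) := by
  refine IsHirota.of_shift fun s p => ?_
  obtain ⟨t, rfl⟩ : ∃ t, s = -t := ⟨-s, by ring⟩
  have h1 := shift_of_bidiag_exp (P := S.s₂) (fun n => by
    obtain ⟨B, h, h', e, e1, e2⟩ := isBidiag_true hS n
    exact ⟨LMat.mk B h, e, e1⟩) t (t + (p - 1))
  have h2 := hτ.shift_S₂_diag true t
  have h3 := congrArg (PowerSeries.C (R := Fn K)) (hτ.S₂inv_diag (t - 1))
  have a1 := hτ.S₂ t (t + (p - 1))
  have a2 := hτ.S₂ t (t + (p - 1) + 1)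
  have a3 := hτ.S₂ (t - 1) (t + (p - 1))
  rw [show t + (p - 1) - t = p - 1 by ring] at a1
  rw [show t + (p - 1) + 1 - t = p by ring] at a2
  rw [show t + (p - 1) - (t - 1) = p by ring] at a3
  have e1 : 1 - (-t + 1) = t := by ring
  have e3 : 1 - -t = t + 1 := by ring
  simp only [e1, e3, sub_add_cancel] at *
  rw [← a1, ← a2, ← a3]
  simp only [Units.val_one, Units.val_neg, map_mul, sub_neg_eq_add, ← sub_eq_add_neg] at *
  change shiftHom true (-1) (S.S₂ t (t + (p - 1))) - PowerSeries.X *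
    shiftHom true (-1) (S.S₂ t (t + (p - 1) + 1)) = _ * PowerSeries.C (S.S₂ t (t + (p - 1))) -
      _ * PowerSeries.C (S.S₂ (t - 1) (t + (p - 1))) at h1
  linear_combination (PowerSeries.C (τ t) * shiftHom true (-1) (τ t)) * h1 -
    PowerSeries.X * PowerSeries.C (S.S₂ (t - 1) (t + (p - 1))) *
      PowerSeries.C (S.S₂inv (t - 1) (t - 1)) * PowerSeries.C (τ t) * h2 -
    PowerSeries.X * PowerSeries.C (S.S₂ (t - 1) (t + (p - 1))) *
      shiftHom true (-1) (τ (t + 1)) * h3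

/-- The `y`-shift leaves `e^{ξ(x,Λ)}` unchanged, so `S₁` is transformed by the bidiagonal matrix
without the extra factor. -/
theorem isMixedHirota_false (hS : S.IsTodaSolution) (hτ : IsTau S τ) : IsMixedHirota false τ := by
  intro s p q
  have h1 := shift_of_bidiag (v := true) (P := S.s₁) (fun n => by
    obtain ⟨B, h, h', e, e1, e2⟩ := isBidiag_true hS n
    refine ⟨LMat.mk B h', e, ?_⟩
    have e3 : hopM true (-1) n S.w₁ = hopM true (-1) n S.s₁ * expM 1 false 1 := by
      rw [← coeff_shiftM, w₁, map_mul, shiftM_expM_of_ne (by simp), PowerSeries.coeff_mul_C,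
        coeff_shiftM]
    rw [e3, w₁, ← mul_assoc] at e2
    have e4 := congrArg (· * expM 1 false (-1)) e2
    simpa only [mul_assoc, expM_mul_neg, mul_one] using e4) s (s - p)
  have h2 := hτ.shift_S₂_diag true s
  have h3 := congrArg (PowerSeries.C (R := Fn K)) (hτ.S₂inv_diag (s - 1))
  have a1 := hτ.S₁ s (s - p)
  have a2 := hτ.S₁ (s - 1) (s - p)
  rw [show s - (s - p) = p by ring] at a1
  rw [show s - 1 - (s - p) = p - 1 by ring] at a2
  have h : PowerSeries.C (τ s) * shiftHom true (-1) (shift false (-1) (τ s) p) =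
      PowerSeries.C (shift false (-1) (τ s) p) * shiftHom true (-1) (τ s) - PowerSeries.X *
        (PowerSeries.C (shift false (-1) (τ (s - 1)) (p - 1)) * shiftHom true (-1) (τ (s + 1))) := by
    rw [← a1, ← a2]
    simp only [Units.val_one, Units.val_neg, map_mul, sub_add_cancel, ← sub_eq_add_neg] at *
    change shiftHom true (-1) (S.S₁ s (s - p)) = _ * PowerSeries.C (S.S₁ s (s - p)) -
      _ * PowerSeries.C (S.S₁ (s - 1) (s - p)) at h1
    linear_combination (PowerSeries.C (τ s) * shiftHom true (-1) (τ s)) * h1 -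
      PowerSeries.X * PowerSeries.C (S.S₁ (s - 1) (s - p)) *
        PowerSeries.C (S.S₂inv (s - 1) (s - 1)) * PowerSeries.C (τ s) * h2 -
      PowerSeries.X * PowerSeries.C (S.S₁ (s - 1) (s - p)) *
        shiftHom true (-1) (τ (s + 1)) * h3
  have h4 := congrArg (zcoeff q) h
  simp only [map_sub, zcoeff_X_mul, zcoeff_C_mul, zcoeff_shiftHom] at h4
  rw [shift_comm, Bool.not_false, h4]

theorem IsMixedHirota.reflect {v : Bool} (h : IsMixedHirota v τ) :
    IsMixedHirota (!v) fun s => τ (1 - s) := fun s p q => by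
  have h1 := h (1 - s) q p
  have e1 : 1 - (s - 1) = 1 - s + 1 := by ring
  have e2 : 1 - (s + 1) = 1 - s - 1 := by ring
  simp only [Bool.not_not, e1, e2]
  rw [shift_comm, h1]
  ring

/-- The equations satisfied by a tau function `τ` and by `θ_s = τ_s Ψ(s)`, `φ_s = τ_s Ψ*(s - 1)`. -/
structure IsSystem (v : Bool) (τ θ φ : ℤ → Fn K) : Prop where
  unit : ∀ s, IsUnit (τ s)
  hirota : IsHirota v τ
  hirota' : IsHirota (!v) fun s => τ (1 - s)
  mixed : IsMixedHirota v τ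
  wave : IsWave v τ θ
  wave' : IsWave (!v) (fun s => τ (1 - s)) fun s => θ (-s)
  adj : IsAdjWave v τ φ
  adj' : IsAdjWave (!v) (fun s => τ (1 - s)) fun s => φ (2 - s)

variable {v : Bool} {θ φ : ℤ → Fn K}

/-- Exchanging the two sets of variables. -/
theorem IsSystem.reflect (h : IsSystem v τ θ φ) :
    IsSystem (!v) (fun s => τ (1 - s)) (fun s => θ (-s)) fun s => φ (2 - s) where
  unit s := h.unit _
  hirota := h.hirota'
  hirota' := by simpa using h.hirota
  mixed := h.mixed.reflect
  wave := h.wave'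
  wave' := by simpa using h.wave
  adj := h.adj'
  adj' := by simpa using h.adj

/-- Only the transformation law of the invertible matrix `P` enters, so `W₁` and `W₂` are treated at
once. -/
theorem isSystem {ε : ℤˣ} {P Q : LMat K ε} (hS : S.IsTodaSolution) (hτ : IsTau S τ)
    (hPQ : P * Q = 1) (hQP : Q * P = 1)
    (h : ∀ n, ∃ B : LMat K ε, IsBidiag 1 (fun s => shiftHom false (-1) (S.S₂ s s) *
      PowerSeries.C (S.S₂inv s s)) (fun _ => 1) n B.val ∧ hopM false (-1) n P = B * P)
    (h' : ∀ n, ∃ B : LMat K ε, IsBidiag (-1) (fun _ => 1)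
      (fun s => shiftHom true (-1) (S.S₂ s s) * PowerSeries.C (S.S₂inv (s - 1) (s - 1))) n B.val ∧
      hopM true (-1) n P = B * P) (b k : ℤ) :
    IsSystem false τ (fun s => τ s * P.val s b) fun s => τ s * Q.val k (s - 1) where
  unit := hτ.unit
  hirota := isHirota_false hS hτ
  hirota' := isHirota_true hS hτ
  mixed := isMixedHirota_false hS hτ
  wave := isWave_false hτ h b
  wave' := isWave_true hτ h' b
  adj := isAdjWave_false hτ hPQ hQP h k
  adj' := by
    have h1 := isAdjWave_true hτ hPQ hQP h' k
    have e : ∀ s : ℤ, 2 - s - 1 = 1 - s := fun s => by ring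
    simp only [e]
    exact h1

theorem isSystem₁ (hS : S.IsTodaSolution) (hτ : IsTau S τ) (b k : ℤ) :
    IsSystem false τ (fun s => τ s * S.W₁ s b) fun s => τ s * S.W₁inv k (s - 1) := by
  rw [← S.val_w₁, ← S.val_w₁i]
  refine isSystem hS hτ S.w₁_mul S.w₁i_mul (fun n => ?_) (fun n => ?_) b k
  · obtain ⟨B, h, h', e, e1, e2⟩ := isBidiag_false hS n
    exact ⟨LMat.mk B h, e, e1⟩
  · obtain ⟨B, h, h', e, e1, e2⟩ := isBidiag_true hS n
    exact ⟨LMat.mk B h', e, e2⟩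

theorem isSystem₂ (hS : S.IsTodaSolution) (hτ : IsTau S τ) (b k : ℤ) :
    IsSystem false τ (fun s => τ s * S.W₂ s b) fun s => τ s * S.W₂inv k (s - 1) := by
  rw [← S.val_w₂, ← S.val_w₂i]
  refine isSystem hS hτ S.w₂_mul S.w₂i_mul (fun n => ?_) (fun n => ?_) b k
  · obtain ⟨B, h, h', e, e1, e2⟩ := isBidiag_false hS n
    exact ⟨LMat.mk B h', e, e2⟩
  · obtain ⟨B, h, h', e, e1, e2⟩ := isBidiag_true hS n
    exact ⟨LMat.mk B h, e, e1⟩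

/-! ### Identities with two shifts for the tau function and a wave function -/

namespace IsSystem

theorem isUnit_cc {f : Fn K} (hf : IsUnit f) : IsUnit (cc f) := hf.map _

theorem wave_α {v : Bool} {τ θ : ℤ → Fn K} (h : IsWave v τ θ) (s : ℤ) :
    cc (τ (s + 1)) * sα v (-1) (θ s) =
    sα v (-1) (τ (s + 1)) * cc (θ s) - pα * sα v (-1) (τ s) * cc (θ (s + 1)) := by
  have := congrArg (PowerSeries.C (R := PowerSeries (Fn K))) (h s)
  simp only [map_mul, map_sub] at this
  exact this

theorem wave_ζ {v : Bool} {τ θ : ℤ → Fn K} (h : IsWave v τ θ) (s : ℤ) :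
    cc (τ (s + 1)) * sζ v (-1) (θ s) =
    sζ v (-1) (τ (s + 1)) * cc (θ s) - pζ * sζ v (-1) (τ s) * cc (θ (s + 1)) := by
  have := congrArg (PowerSeries.map (PowerSeries.C (R := Fn K))) (h s)
  simp only [map_mul, map_sub, PowerSeries.map_C, PowerSeries.map_X] at this
  exact this

theorem wave'_ζ (h : IsSystem v τ θ φ) (s : ℤ) : cc (τ s) * sζ (!v) (-1) (θ s) =
    sζ (!v) (-1) (τ s) * cc (θ s) - pζ * sζ (!v) (-1) (τ (s + 1)) * cc (θ (s - 1)) := by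
  have := wave_ζ h.wave' (-s)
  simpa [show 1 - (-s + 1) = s by ring, show -(-s + 1) = s - 1 by ring,
    show 1 - -s = s + 1 by ring] using this

theorem mixed' (h : IsSystem v τ θ φ) (s : ℤ) : cc (τ s) * sαζ v (-1) (!v) (-1) (τ s) =
    sα v (-1) (τ s) * sζ (!v) (-1) (τ s) -
      pα * (pζ * (sα v (-1) (τ (s - 1)) * sζ (!v) (-1) (τ (s + 1)))) := ext_cf fun p q => by
  simp only [map_sub, cf_pα_mul, cf_pζ_mul, cf_cc_mul_sαζ, cf_sα_mul_sζ]
  exact h.mixed s p q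

/-- The Hirota identity with one `τ` replaced by `θ`: `(α-ζ) θ_s τ_s(-[α]-[ζ]) + ζ θ_s(-[α])
τ_s(-[ζ]) = α τ_s(-[α]) θ_s(-[ζ])`, then translated by `[α]` so that the `α`-shifts become positive
or disappear. -/
theorem fay₁ (h : IsSystem v τ θ φ) (s p q : ℤ) :
    shift v 1 (θ s) (p - 1) * shift v (-1) (τ s) q -
      shift v 1 (θ s) p * shift v (-1) (τ s) (q - 1) +
      θ s * shift v 1 (shift v (-1) (τ s) (q - 1)) p =
    τ s * shift v 1 (shift v (-1) (θ s) q) (p - 1) := by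
  have h1 : pα * (cc (θ s) * sαζ v (-1) v (-1) (τ s)) - pζ * (cc (θ s) * sαζ v (-1) v (-1) (τ s)) +
      pζ * (sα v (-1) (θ s) * sζ v (-1) (τ s)) = pα * (sα v (-1) (τ s) * sζ v (-1) (θ s)) := by
    -- After multiplication by `τ_{s+1}`, the Hirota identity and the wave relations for the two
    -- parameters eliminate every other term.
    refine (isUnit_cc (h.unit (s + 1))).mul_left_cancel ?_
    linear_combination cc (θ s) * h.hirota s + pζ * sζ v (-1) (τ s) * wave_α h.wave s -
      pα * sα v (-1) (τ s) * wave_ζ h.wave s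
  have h2 := congrArg (cf p q) (congrArg (unshift v) h1)
  simp only [map_add, map_sub, map_mul, unshift_pα, unshift_pζ, unshift_cc, unshift_sα, unshift_sζ,
    unshift_sαζ] at h2
  simpa only [map_add, map_sub, cf_pα_mul, cf_pζ_mul, cf_cc_mul_sαζ, cf_sα_mul_sζ] using h2

theorem fay₂ (h : IsSystem v τ θ φ) (s p q : ℤ) :
    shift v 1 (θ (s + 1)) (p - 1) * shift v (-1) (τ s) q -
      shift v 1 (θ (s + 1)) p * shift v (-1) (τ s) (q - 1) +
      θ s * shift v 1 (shift v (-1) (τ (s + 1)) q) p =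
    τ (s + 1) * shift v 1 (shift v (-1) (θ s) q) p := by
  have h1 : pα * (cc (θ (s + 1)) * sαζ v (-1) v (-1) (τ s)) -
      pζ * (cc (θ (s + 1)) * sαζ v (-1) v (-1) (τ s)) +
      sα v (-1) (θ s) * sζ v (-1) (τ (s + 1)) = sα v (-1) (τ (s + 1)) * sζ v (-1) (θ s) := by
    refine (isUnit_cc (h.unit (s + 1))).mul_left_cancel ?_
    linear_combination cc (θ (s + 1)) * h.hirota s + sζ v (-1) (τ (s + 1)) * wave_α h.wave s -
      sα v (-1) (τ (s + 1)) * wave_ζ h.wave s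
  have h2 := congrArg (cf p q) (congrArg (unshift v) h1)
  simp only [map_add, map_sub, map_mul, unshift_pα, unshift_pζ, unshift_cc, unshift_sα, unshift_sζ,
    unshift_sαζ] at h2
  simpa only [map_add, map_sub, cf_pα_mul, cf_pζ_mul, cf_cc_mul_sαζ, cf_sα_mul_sζ] using h2

/-- The analogue for shifts in different sets of variables: the mixed bilinear identity takes the
place of Hirota's, and one wave relation of each type is used. -/
theorem fay₃ (h : IsSystem v τ θ φ) (s p q : ℤ) :
    shift v 1 (θ s) p * shift (!v) (-1) (τ (s + 1)) q -
      θ s * shift v 1 (shift (!v) (-1) (τ (s + 1)) q) p =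
    τ s * shift v 1 (shift (!v) (-1) (θ (s + 1)) q) (p - 1) := by
  have h1 : cc (θ s) * sαζ v (-1) (!v) (-1) (τ (s + 1)) -
      sα v (-1) (θ s) * sζ (!v) (-1) (τ (s + 1)) =
      pα * (sα v (-1) (τ s) * sζ (!v) (-1) (θ (s + 1))) := by
    refine (isUnit_cc (h.unit (s + 1))).mul_left_cancel ?_
    have h3 := h.mixed' (s + 1)
    have h4 := h.wave'_ζ (s + 1)
    rw [add_sub_cancel_right] at h3 h4
    linear_combination cc (θ s) * h3 - sζ (!v) (-1) (τ (s + 1)) * wave_α h.wave s -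
      pα * sα v (-1) (τ s) * h4
  have h2 := congrArg (cf p q) (congrArg (unshift v) h1)
  simp only [map_sub, map_mul, unshift_pα, unshift_cc, unshift_sα, unshift_sζ,
    unshift_sαζ] at h2
  simpa only [map_sub, cf_pα_mul, cf_cc_mul_sαζ, cf_sα_mul_sζ] using h2

theorem fay₄ (h : IsSystem v τ θ φ) (s p q : ℤ) :
    shift v 1 (θ s) p * shift (!v) (-1) (τ s) q -
      θ (s - 1) * shift v 1 (shift (!v) (-1) (τ (s + 1)) (q - 1)) p =
    τ s * shift v 1 (shift (!v) (-1) (θ s) q) p := by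
  have h1 : cc (θ s) * sαζ v (-1) (!v) (-1) (τ s) -
      pζ * (sα v (-1) (θ (s - 1)) * sζ (!v) (-1) (τ (s + 1))) =
      sα v (-1) (τ s) * sζ (!v) (-1) (θ s) := by
    refine (isUnit_cc (h.unit s)).mul_left_cancel ?_
    have h3 := h.mixed' s
    have h4 := h.wave'_ζ s
    have h5 := wave_α h.wave (s - 1)
    rw [sub_add_cancel] at h5
    linear_combination cc (θ s) * h3 - pζ * sζ (!v) (-1) (τ (s + 1)) * h5 -
      sα v (-1) (τ s) * h4
  have h2 := congrArg (cf p q) (congrArg (unshift v) h1)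
  simp only [map_sub, map_mul, unshift_pζ, unshift_cc, unshift_sα, unshift_sζ,
    unshift_sαζ] at h2
  simpa only [map_sub, cf_pζ_mul, cf_cc_mul_sαζ, cf_sα_mul_sζ] using h2

end IsSystem

end

section



/-! ### Sums of shifted functions against an exponential -/

variable [CharZero K] {v : Bool}

theorem shift_add (v : Bool) (c : K) (f g : Fn K) (q : ℤ) :
    shift v c (f + g) q = shift v c f q + shift v c g q := by
  simp only [← zcoeff_shiftHom, map_add]

theorem shift_smul (v : Bool) (c a : K) (f : Fn K) (q : ℤ) :
    shift v c (a • f) q = a • shift v c f q := by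
  rcases lt_or_ge q 0 with h | h
  · rw [shift_of_neg v c _ h, shift_of_neg v c _ h, smul_zero]
  · lift q to ℕ using h
    rw [shift_natCast, shift_natCast, map_smul]

theorem LF.shift {ι : Type*} {f : ι → Fn K} (hf : LF f) (v : Bool) (c : K) (q : ℤ) :
    LF fun i => shift v c (f i) q := by
  rcases lt_or_ge q 0 with h | h
  · simp only [shift_of_neg v c _ h]
    exact LF.zero
  · lift q to ℕ using h
    simp only [shift_natCast]
    exact LF.hop v c q hf

theorem shift_lsum {ι : Type*} {f : ι → Fn K} (hf : LF f) (v : Bool) (c : K) (q : ℤ) :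
    shift v c (lsum f) q = lsum fun i => shift v c (f i) q := by
  rcases lt_or_ge q 0 with h | h
  · simp only [shift_of_neg v c _ h]
    exact lsum_zero.symm
  · lift q to ℕ using h
    simp only [shift_natCast]
    exact hop_lsum v c q hf

theorem lf_expXi (v : Bool) (ε : K) (F : ℤ → Fn K) : LF fun p => expXi v ε p * F p := by
  refine LF.mul_right (fun d => ?_) F
  refine (Set.finite_Icc 0 (wt d)).subset fun p hp => ?_
  by_contra hc
  rw [Set.mem_Icc, not_and_or, not_le, not_le] at hc
  rcases hc with h | h
  · exact hp (by rw [expXi_of_neg v ε h, map_zero])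
  · exact hp (wtGE_expXi v ε p d h)

/-- The sum of a sequence of functions against `e^{-ξ}`. -/
def expSum (v : Bool) (F : ℤ → Fn K) : Fn K := lsum fun p => expXi v (-1) p * F p

theorem expSum_add (F G : ℤ → Fn K) : expSum v (fun p => F p + G p) = expSum v F + expSum v G := by
  simp only [expSum, mul_add]
  exact lsum_add (lf_expXi v _ F) (lf_expXi v _ G)

theorem expSum_sub (F G : ℤ → Fn K) : expSum v (fun p => F p - G p) = expSum v F - expSum v G := by
  simp only [expSum, mul_sub]
  exact lsum_sub (lf_expXi v _ F) (lf_expXi v _ G)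

theorem expSum_mul (F : ℤ → Fn K) (g : Fn K) :
    expSum v (fun p => F p * g) = expSum v F * g := by
  rw [expSum, expSum, lsum_mul g (lf_expXi v _ F)]
  simp only [mul_assoc]

theorem expSum_const_mul (F : ℤ → Fn K) (g : Fn K) :
    expSum v (fun p => g * F p) = g * expSum v F := by
  rw [mul_comm g, ← expSum_mul]
  simp only [mul_comm]

/-- The coefficient of `z ^ N` in `f(x + [z⁻¹]) e^{-ξ(x, z)}`. -/
def vsum (v : Bool) (N : ℤ) (f : Fn K) : Fn K := expSum v fun p => shift v 1 f (p - N)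

/-- The left side is multiplication by `1 - ζz`, which removes the factor `1/(1 - ζz)` that the
exponential acquires under the shift. -/
theorem shift_expXi_mul {c ε : K} (hc : c * ε = 1) (f : Fn K) (p q : ℤ) :
    shift v c (expXi v ε p * f) q - shift v c (expXi v ε (p - 1) * f) (q - 1) =
      expXi v ε p * shift v c f q := by
  have h : shiftHom v c (expXi v ε p) - PowerSeries.X * shiftHom v c (expXi v ε (p - 1)) =
      PowerSeries.C (expXi v ε p) := by
    ext1 n
    rw [map_sub, coeff_shiftHom, hop_expXi_of_mul_eq_one v _ hc]
    obtain _ | n := n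
    · simp
    · rw [PowerSeries.coeff_succ_X_mul, coeff_shiftHom, hop_expXi_of_mul_eq_one v _ hc,
        PowerSeries.coeff_C, if_neg (Nat.succ_ne_zero n), sub_eq_zero]
      congr 1
      push_cast
      ring
  have h1 := congrArg (zcoeff q) (congrArg (· * shiftHom v c f) h)
  simp only [sub_mul, mul_assoc, ← map_mul, map_sub, zcoeff_X_mul, zcoeff_C_mul,
    zcoeff_shiftHom] at h1
  exact h1

theorem shift_not_expXi_mul (f : Fn K) (p q : ℤ) :
    shift (!v) (-1) (expXi v (-1) p * f) q = expXi v (-1) p * shift (!v) (-1) f q := by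
  have h : shiftHom (!v) (-1) (expXi v (-1) p) = PowerSeries.C (expXi v (-1 : K) p) := by
    ext1 n
    rw [coeff_shiftHom, hop_expXi_other, PowerSeries.coeff_C]
  rw [← zcoeff_shiftHom, map_mul, h, zcoeff_C_mul, zcoeff_shiftHom]

/-- The shift by `-[ζ]` multiplies `e^{-ξ(x,z)}` by `1/(1 - ζz)`; the difference on the left clears
it. -/
theorem shift_vsum (N : ℤ) (f : Fn K) (q : ℤ) : shift v (-1) (vsum v N f) q -
    shift v (-1) (vsum v (N - 1) f) (q - 1) =
      expSum v fun p => shift v 1 (shift v (-1) f q) (p - N) := by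
  have h : vsum v (N - 1) f = lsum fun p => expXi v (-1) (p - 1) * shift v 1 f (p - N) := by
    rw [vsum, expSum, ← lsum_equiv (Equiv.subRight (1 : ℤ))]
    simp only [Equiv.subRight_apply, sub_sub_sub_cancel_right]
  have hl : LF fun p => expXi v (-1) (p - 1) * shift v 1 f (p - N) := by
    have := (lf_expXi v (-1) fun p => shift v 1 f (p - (N - 1))).comp
      (Equiv.subRight (1 : ℤ)).injective
    simpa only [Equiv.subRight_apply, sub_sub_sub_cancel_right] using this
  have hl' := lf_expXi v (-1) fun p => shift v 1 f (p - N)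
  rw [h, vsum, expSum, shift_lsum hl', shift_lsum hl, ← lsum_sub (hl'.shift _ _ _) (hl.shift _ _ _)]
  simp only [shift_expXi_mul (show (-1 : K) * -1 = 1 by ring), shift_comm v v (1 : K) (-1 : K)]
  rfl

/-- For the other set of variables the exponential is inert and no correction factor appears. -/
theorem shift_not_vsum (N : ℤ) (f : Fn K) (q : ℤ) : shift (!v) (-1) (vsum v N f) q =
    expSum v fun p => shift v 1 (shift (!v) (-1) f q) (p - N) := by
  rw [vsum, expSum, shift_lsum (lf_expXi v (-1) _)]
  simp only [shift_not_expXi_mul, shift_comm v (!v) (1 : K) (-1 : K)]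
  rfl

/-- Injectivity of multiplication by `1 - ζz`: the relation propagates vanishing from negative
powers of `ζ` to all powers. -/
theorem eq_zero_of_shift_invariant {Z : ℤ → ℤ → Fn K} (h0 : ∀ N q, q < 0 → Z N q = 0)
    (h : ∀ N q, Z N q = Z (N - 1) (q - 1)) (N q : ℤ) : Z N q = 0 := by
  have : ∀ n : ℕ, ∀ N q : ℤ, q < n → Z N q = 0 := by
    intro n
    induction n with
    | zero => exact fun N q hq => h0 N q (by simpa using hq)
    | succ n ih => exact fun N q hq => by rw [h, ih]; push_cast at hq; omega
  exact this (q + 1).toNat N q (by omega)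

namespace IsSystem

variable {τ θ φ : ℤ → Fn K}

/-- Summing `fay₁` against `e^{-ξ}` proves the identity multiplied by `1 - ζz`, and this factor is
then cancelled. -/
theorem vsum₁ (h : IsSystem v τ θ φ) (s N q : ℤ) :
    vsum v N (θ s) * shift v (-1) (τ s) q +
      θ s * shift v (-1) (vsum v (N - 1) (τ s)) (q - 1) =
    τ s * shift v (-1) (vsum v N (θ s)) q := by
  rw [← sub_eq_zero]
  refine eq_zero_of_shift_invariant (Z := fun N q => vsum v N (θ s) * shift v (-1) (τ s) q +
      θ s * shift v (-1) (vsum v (N - 1) (τ s)) (q - 1) -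
      τ s * shift v (-1) (vsum v N (θ s)) q) (fun N q hq => ?_) (fun N q => ?_) N q
  · simp only [shift_of_neg _ _ _ hq, shift_of_neg _ _ _ (show q - 1 < 0 by omega)]
    ring
  · have h1 := shift_vsum (v := v) N (θ s) q
    have h2 := shift_vsum (v := v) (N - 1) (τ s) (q - 1)
    have h3 : vsum v (N - 1) (θ s) = expSum v fun p => shift v 1 (θ s) (p - N + 1) := by
      rw [vsum]
      congr 2
      funext p
      congr 1
      ring
    have h4 : expSum v (fun p => shift v 1 (θ s) (p - N) * shift v (-1) (τ s) q -
      shift v 1 (θ s) (p - N + 1) * shift v (-1) (τ s) (q - 1) +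
      θ s * shift v 1 (shift v (-1) (τ s) (q - 1)) (p - (N - 1))) =
      expSum v fun p => τ s * shift v 1 (shift v (-1) (θ s) q) (p - N) := by
      congr 1
      funext p
      have := h.fay₁ s (p - N + 1) q
      rw [add_sub_cancel_right] at this
      rw [← this, show p - (N - 1) = p - N + 1 by ring]
    rw [expSum_add, expSum_sub, expSum_mul, expSum_mul, expSum_const_mul, expSum_const_mul,
      ← h1, ← h2, ← h3] at h4
    rw [← vsum] at h4
    linear_combination h4

theorem vsum₂ (h : IsSystem v τ θ φ) (s N q : ℤ) :
    vsum v (N + 1) (θ (s + 1)) * shift v (-1) (τ s) q +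
      θ s * shift v (-1) (vsum v N (τ (s + 1))) q =
    τ (s + 1) * shift v (-1) (vsum v N (θ s)) q := by
  rw [← sub_eq_zero]
  refine eq_zero_of_shift_invariant
    (Z := fun N q => vsum v (N + 1) (θ (s + 1)) * shift v (-1) (τ s) q +
      θ s * shift v (-1) (vsum v N (τ (s + 1))) q -
      τ (s + 1) * shift v (-1) (vsum v N (θ s)) q) (fun N q hq => ?_) (fun N q => ?_) N q
  · simp only [shift_of_neg _ _ _ hq]
    ring
  · have h1 := shift_vsum (v := v) N (θ s) q
    have h2 := shift_vsum (v := v) N (τ (s + 1)) q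
    have h3 : vsum v (N + 1) (θ (s + 1)) = expSum v fun p => shift v 1 (θ (s + 1)) (p - N - 1) := by
      rw [vsum]
      congr 2
      funext p
      congr 1
      ring
    have h4 : expSum v (fun p => shift v 1 (θ (s + 1)) (p - N - 1) * shift v (-1) (τ s) q -
      shift v 1 (θ (s + 1)) (p - N) * shift v (-1) (τ s) (q - 1) +
      θ s * shift v 1 (shift v (-1) (τ (s + 1)) q) (p - N)) =
      expSum v fun p => τ (s + 1) * shift v 1 (shift v (-1) (θ s) q) (p - N) := by
      congr 1
      funext p
      exact h.fay₂ s (p - N) q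
    rw [expSum_add, expSum_sub, expSum_mul, expSum_mul, expSum_const_mul, expSum_const_mul,
      ← h1, ← h2, ← h3] at h4
    rw [← vsum] at h4
    rw [sub_add_cancel]
    linear_combination h4

theorem vsum₃ (h : IsSystem v τ θ φ) (s N q : ℤ) :
    vsum v N (θ s) * shift (!v) (-1) (τ (s + 1)) q -
      θ s * shift (!v) (-1) (vsum v N (τ (s + 1))) q =
    τ s * shift (!v) (-1) (vsum v (N + 1) (θ (s + 1))) q := by
  rw [shift_not_vsum, shift_not_vsum, vsum, ← expSum_mul, ← expSum_const_mul, ← expSum_const_mul,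
    ← expSum_sub]
  congr 1
  funext p
  rw [h.fay₃, show p - (N + 1) = p - N - 1 by ring]

theorem vsum₄ (h : IsSystem v τ θ φ) (s N q : ℤ) :
    vsum v N (θ s) * shift (!v) (-1) (τ s) q -
      θ (s - 1) * shift (!v) (-1) (vsum v N (τ (s + 1))) (q - 1) =
    τ s * shift (!v) (-1) (vsum v N (θ s)) q := by
  rw [shift_not_vsum, shift_not_vsum, vsum, ← expSum_mul, ← expSum_const_mul, ← expSum_const_mul,
    ← expSum_sub]
  congr 1
  funext p
  rw [h.fay₄]

end IsSystem

end

section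



/-! ### Vertex operators -/

variable [CharZero K] {v : Bool}

theorem shift_expXi (p q : ℤ) :
    shift v 1 (expXi v (1 : K) p) q = if 0 ≤ q then expXi v 1 (p - q) else 0 := by
  rcases lt_or_ge q 0 with h | h
  · rw [shift_of_neg v _ _ h, if_neg (by omega)]
  · rw [if_pos h]
    lift q to ℕ using h
    rw [shift_natCast, hop_expXi_of_mul_eq_one v _ (by ring)]

theorem shift_mul (v : Bool) (c : K) (f g : Fn K) (q : ℤ) :
    shift v c (f * g) q = lsum fun n : ℤ => shift v c f n * shift v c g (q - n) := by
  rcases lt_or_ge q 0 with h | h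
  · rw [shift_of_neg v c _ h]
    refine lsum_zero.symm.trans (congrArg lsum (funext fun n : ℤ => ?_))
    by_cases hn : n < 0
    · rw [shift_of_neg v c _ hn, zero_mul]
    · rw [shift_of_neg v c g (by omega), mul_zero]
  · lift q to ℕ using h
    rw [shift_natCast, hop_mul, lsum_eq_sum ((Finset.range (q + 1)).image fun n : ℕ => (n : ℤ)),
      Finset.sum_image (by simp), Finset.Nat.sum_antidiagonal_eq_sum_range_succ
        fun a b => hop v c a f * hop v c b g]
    · refine Finset.sum_congr rfl fun n hn => ?_
      rw [shift_natCast, ← Nat.cast_sub (by simpa [Nat.lt_succ_iff] using hn), shift_natCast]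
    · intro n hn
      by_cases hn0 : n < 0
      · rw [shift_of_neg v c _ hn0, zero_mul]
      · rw [shift_of_neg v c g, mul_zero]
        by_contra hc
        apply hn
        rw [Finset.mem_image]
        exact ⟨n.toNat, by rw [Finset.mem_range]; omega, by omega⟩

/-- For a fixed monomial of weight `w`, the two exponentials bound `i + n` and `j - n` between 0 and
`w`; together with `n ≥ 0` and the lower bound on `i` this confines all three indices. -/
theorem lf_vertex (N : ℤ) (g : ℤ → ℤ → Fn K) (hg : ∀ i j, i < N → g i j = 0) :
    LF fun t : ℤ × ℤ × ℤ => expXi v (-1) (t.1 + t.2.2) *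
      (shift v 1 (expXi v 1 t.2.1) t.2.2 * g t.1 t.2.1) := by
  intro d
  refine ((Set.finite_Icc N (wt d)).prod ((Set.finite_Icc 0 (wt d + (wt d - N))).prod
    (Set.finite_Icc 0 (wt d - N)))).subset ?_
  rintro ⟨i, j, n⟩ hne
  have h : coeff d (expXi v (-1) (i + n) * (shift v 1 (expXi v 1 j) n * g i j)) ≠ 0 := hne
  have h1 : 0 ≤ i + n := by
    by_contra hc
    exact h (by rw [expXi_of_neg v _ (not_le.1 hc), zero_mul, map_zero])
  have h2 : i + n ≤ wt d := by
    by_contra hc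
    exact h ((wtGE_expXi v _ (i + n)).mul_right _ d (not_le.1 hc))
  have h3 : 0 ≤ n := by
    by_contra hc
    exact h (by simp only [shift_of_neg v _ _ (not_le.1 hc)]; rw [zero_mul, mul_zero, map_zero])
  have h4 : N ≤ i := by
    by_contra hc
    exact h (by simp only [hg i j (not_le.1 hc)]; rw [mul_zero, mul_zero, map_zero])
  have h5 : 0 ≤ j - n := by
    by_contra hc
    exact h (by
      simp only [shift_expXi, if_pos h3, expXi_of_neg v (1 : K) (not_le.1 hc)]
      rw [zero_mul, mul_zero, map_zero])
  have h6 : j - n ≤ wt d := by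
    by_contra hc
    refine h (((WtGE.mul_right ?_ _).mul_left _ : WtGE (j - n) _) d (not_le.1 hc))
    simp only [shift_expXi, if_pos h3]
    exact wtGE_expXi v _ _
  simp only [Set.mem_prod, Set.mem_Icc]
  omega

/-- `f(x - [z⁻¹]) e^{ξ(x, z)}`: the coefficient of `z ^ b`. -/
def wave (v : Bool) (f : Fn K) (b : ℤ) : Fn K :=
  lsum fun j => expXi v 1 j * shift v (-1) f (j - b)

/-- The vertex operator is two successive steps: form `e^{ξ(x,μ)} f(x-[μ⁻¹])`, then shift by `[λ⁻¹]`
and multiply by `e^{-ξ(x,λ)}`. The shift also reaches the exponential in `μ`, which gives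
`e^{ξ(x+[λ⁻¹],μ)}`. The prefactor `λ⁻¹` accounts for `a + 1`. -/
theorem vertexOp_eq (f : Fn K) (a b : ℤ) :
    vertexOp v f a b = vsum v (a + 1) (wave v f b) := by
  set G : ℤ → ℤ → Fn K := fun i j =>
    shift v 1 (shift v (-1) f (j - b)) (i - (a + 1)) with hG
  have hG0 : ∀ i j, i < a + 1 → G i j = 0 := fun i j h => shift_of_neg _ _ _ (by omega)
  have hlf := lf_vertex (v := v) (a + 1) G hG0
  have h1 : ∀ i j : ℤ, Ser₂.mul (fun a b => Ser.flip (shift v (1 : K) (expXi v 1 b)) a)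
      (fun a b => if b = 0 then expXi v (-1) a else 0) i j =
      lsum fun n : ℤ => expXi v (-1) (i + n) * shift v 1 (expXi v 1 j) n := by
    intro i j
    have hl : LF fun p : ℤ × ℤ => shift v (1 : K) (expXi v 1 p.2) (-p.1) *
        (if j - p.2 = 0 then expXi v (-1) (i - p.1) else 0) := by
      refine LF.of_wtGE (fun p => i - p.1) (fun p => WtGE.mul_left ?_ _) fun N => ?_
      · split_ifs
        · exact wtGE_expXi _ _ _
        · exact fun d _ => map_zero _
      · refine ((Set.finite_Icc (i - N) 0).prod (Set.finite_singleton j)).subset ?_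
        rintro ⟨p, q⟩ ⟨h, h'⟩
        have h2 : ¬ -p < 0 := fun hc => h' (by simp only [shift_of_neg v _ _ hc]; rw [zero_mul])
        have h3 : j - q = 0 := by
          by_contra hc
          exact h' (by simp only [if_neg hc]; rw [mul_zero])
        simp only at h
        exact ⟨⟨by simp; omega, by simp; omega⟩, by simp; omega⟩
    rw [Ser₂.mul]
    simp only [Ser.flip]
    rw [lsum_prod hl, ← lsum_equiv (Equiv.neg ℤ)]
    congr 1
    funext n
    rw [lsum_eq_single j]
    · simp only [Equiv.neg_apply, sub_self, if_pos, neg_neg, sub_neg_eq_add]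
      rw [mul_comm]
    · intro k hk
      rw [if_neg (by omega), mul_zero]
  have h2 : vertexOp v f a b = lsum fun p : ℤ × ℤ => (lsum fun n : ℤ =>
      expXi v (-1) (p.1 + n) * shift v 1 (expXi v 1 p.2) n) * G p.1 p.2 := by
    rw [vertexOp, Ser₂.mon_mul, Ser₂.mul]
    simp only [h1, sub_zero]
    congr 1
    funext p
    congr 1
    simp only [Ser.flip, hG]
    rw [shift_comm, show -(b - p.2) = p.2 - b by ring,
      show -(a - -1 - p.1) = p.1 - (a + 1) by ring]
  have h3 : ∀ p : ℤ × ℤ, (lsum fun n : ℤ =>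
      expXi v (-1) (p.1 + n) * shift v 1 (expXi v 1 p.2) n) * G p.1 p.2 = lsum fun n : ℤ =>
      expXi v (-1) (p.1 + n) * (shift v 1 (expXi v 1 p.2) n * G p.1 p.2) := by
    intro p
    rw [lsum_mul]
    · simp only [mul_assoc]
    · refine LF.mul_right ?_ _
      have := (lf_expXi v (-1 : K) fun _ => 1).comp (Equiv.addLeft p.1).injective
      simpa using this
  have e1 : vertexOp v f a b = lsum fun t : ℤ × ℤ × ℤ => expXi v (-1) (t.1 + t.2.2) *
      (shift v 1 (expXi v 1 t.2.1) t.2.2 * G t.1 t.2.1) := by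
    rw [h2]
    simp only [h3]
    have hlf' := hlf.comp (Equiv.prodAssoc ℤ ℤ ℤ).injective
    rw [← lsum_equiv (Equiv.prodAssoc ℤ ℤ ℤ), lsum_prod hlf']
    rfl
  have e2 : vsum v (a + 1) (wave v f b) = lsum fun i => lsum fun j => lsum fun n =>
      expXi v (-1) i * (shift v 1 (expXi v 1 j) n * G (i - n) j) := by
    rw [vsum, expSum]
    congr 1
    funext i
    rw [wave, shift_lsum (lf_expXi v 1 _), mul_lsum _ (LF.shift (lf_expXi v 1 _) _ _ _)]
    congr 1
    funext j
    rw [shift_mul, mul_lsum]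
    · simp only [hG]
      congr 1
      funext n
      congr 3
      ring
    · refine LF.of_subset (Set.finite_Icc 0 (i - (a + 1))) fun n hn => ?_
      by_cases h : n < 0
      · rw [shift_of_neg _ _ _ h, zero_mul]
      · rw [shift_of_neg v _ (shift v (-1) f (j - b)), mul_zero]
        simp only [Set.mem_Icc, not_and] at hn
        omega
  -- The two triple sums distribute the power of `λ` differently: `n` is the order of the shift
  -- taken by the exponential in `μ`.
  let e : ℤ × ℤ × ℤ ≃ ℤ × ℤ × ℤ :=
    { toFun := fun t => (t.1 - t.2.2, t.2.1, t.2.2)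
      invFun := fun t => (t.1 + t.2.2, t.2.1, t.2.2)
      left_inv := fun t => by simp
      right_inv := fun t => by simp }
  rw [e1, e2, ← lsum_equiv e]
  have hlf' := hlf.comp e.injective
  have e3 : (fun t : ℤ × ℤ × ℤ => expXi v (-1) ((e t).1 + (e t).2.2) *
      (shift v 1 (expXi v 1 (e t).2.1) (e t).2.2 * G (e t).1 (e t).2.1)) =
      fun t : ℤ × ℤ × ℤ => expXi v (-1) t.1 *
        (shift v 1 (expXi v 1 t.2.1) t.2.2 * G (t.1 - t.2.2) t.2.1) := by
    funext t
    simp [e]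
  rw [e3] at hlf' ⊢
  rw [lsum_prod hlf']
  congr 1
  funext i
  rw [lsum_prod (hlf'.slice i)]

end

section



/-! ### The action of squared eigenfunction symmetries on the tau function -/

theorem lsum_telescope_lt {f g : ℤ → Fn K} (m : ℤ) (hg : ∀ i ≤ m, g i = 0)
    (hf : ∀ i, f i = g (i + 1) - g i) (s : ℤ) :
    (lsum fun i => if i < s then f i else 0) = g s := by
  have hf0 : ∀ i < m, f i = 0 := fun i hi => by
    rw [hf, hg _ (by omega), hg _ (by omega), sub_zero]
  rcases le_or_gt s m with hs | hs
  · rw [hg s hs]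
    refine Eq.trans (congrArg lsum (funext fun i => ?_)) lsum_zero
    split_ifs
    · exact hf0 i (by omega)
    · rfl
  obtain ⟨n, rfl⟩ : ∃ n : ℕ, s = m + n := ⟨(s - m).toNat, by omega⟩
  rw [lsum_eq_sum (Finset.Ico m (m + n))]
  · clear hs
    induction n with
    | zero => simp [hg]
    | succ n ih =>
      have h1 : Finset.Ico m (m + (n + 1 : ℕ)) = insert (m + n : ℤ) (Finset.Ico m (m + n)) := by
        ext i
        simp only [Finset.mem_Ico, Finset.mem_insert]
        push_cast
        omega
      rw [h1, Finset.sum_insert (by simp), if_pos (by push_cast; omega), hf]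
      have h2 : ∑ i ∈ Finset.Ico m (m + n), (if i < m + (n + 1 : ℕ) then f i else 0) =
          ∑ i ∈ Finset.Ico m (m + n), if i < m + (n : ℤ) then f i else 0 := by
        refine Finset.sum_congr rfl fun i hi => ?_
        rw [Finset.mem_Ico] at hi
        rw [if_pos hi.2, if_pos (by push_cast; omega)]
      rw [h2, ih]
      push_cast
      rw [← add_assoc]
      ring
  · intro i hi
    rw [Finset.mem_Ico, not_and_or, not_le, not_lt] at hi
    rcases hi with hi | hi
    · rw [hf0 i hi, ite_self]
    · rw [if_neg (by omega)]

theorem lsum_telescope_ge {f g : ℤ → Fn K} (m : ℤ) (hg : ∀ i, m < i → g i = 0)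
    (hf : ∀ i, f i = g i - g (i + 1)) (s : ℤ) :
    (lsum fun i => if s ≤ i then f i else 0) = g s := by
  have h := lsum_telescope_lt (f := fun i => f (-i)) (g := fun i => g (1 - i)) (-m)
    (fun i hi => hg _ (by omega)) (fun i => by
      rw [hf]
      congr 2 <;> ring) (1 - s)
  rw [← lsum_equiv (Equiv.neg ℤ)]
  simp only [Equiv.neg_apply]
  refine Eq.trans (congrArg lsum (funext fun i => ?_)) (h.trans (by congr 1; ring))
  by_cases hi : s ≤ -i
  · rw [if_pos hi, if_pos (by omega)]
  · rw [if_neg hi, if_neg (by omega)]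

variable [CharZero K] {v : Bool} {S : Dressing K} {τ θ φ σ : ℤ → Fn K}

theorem IsAdjWave.shift (h : IsAdjWave v τ φ) (s q : ℤ) : φ (s + 1) * shift v (-1) (τ s) q =
    τ s * Toda.shift v (-1) (φ (s + 1)) q - τ (s + 1) * Toda.shift v (-1) (φ s) (q - 1) := by
  have h1 := congrArg (zcoeff q) (h s)
  simpa only [map_sub, mul_assoc, zcoeff_X_mul, zcoeff_C_mul, zcoeff_shiftHom] using h1

/-- The inverse shift applied to the relation: the roles of shifted and unshifted factors are
exchanged. -/
theorem IsWave.shift (h : IsWave v τ θ) (s q : ℤ) : θ s * shift v 1 (τ (s + 1)) q =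
    τ (s + 1) * Toda.shift v 1 (θ s) q - τ s * Toda.shift v 1 (θ (s + 1)) (q - 1) := by
  have h1 := congrArg (zcoeff q) (congrArg (extHom v 1) (h s))
  simp only [map_mul, map_sub, extHom_C, extHom_shiftHom, extHom_X, mul_assoc] at h1
  rw [mul_comm _ (PowerSeries.C _)] at h1
  simpa only [map_sub, zcoeff_X_mul, zcoeff_C_mul, zcoeff_shiftHom] using h1

/-- The relations between `τ` and its derivative in terms of `τ, θ, φ`. -/
structure IsFlow (τ θ φ σ : ℤ → Fn K) : Prop where
  eq₁ : ∀ s, PowerSeries.C (σ s) * shiftHom false (-1) (τ s) +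
    PowerSeries.X * (PowerSeries.C (θ s) * shiftHom false (-1) (φ s)) =
      PowerSeries.C (τ s) * shiftHom false (-1) (σ s)
  eq₂ : ∀ s, PowerSeries.C (σ s) * shiftHom true (-1) (τ (s + 1)) -
    PowerSeries.C (θ s) * shiftHom true (-1) (φ (s + 1)) =
      PowerSeries.C (τ s) * shiftHom true (-1) (σ (s + 1))

namespace IsFlow

theorem shift₁ (h : IsFlow τ θ φ σ) (s q : ℤ) : σ s * shift false (-1) (τ s) q +
    θ s * shift false (-1) (φ s) (q - 1) = τ s * shift false (-1) (σ s) q := by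
  have h1 := congrArg (zcoeff q) (h.eq₁ s)
  simpa only [map_add, zcoeff_X_mul, zcoeff_C_mul, zcoeff_shiftHom] using h1

theorem shift₂ (h : IsFlow τ θ φ σ) (s q : ℤ) : σ s * shift true (-1) (τ (s + 1)) q -
    θ s * shift true (-1) (φ (s + 1)) q = τ s * shift true (-1) (σ (s + 1)) q := by
  have h1 := congrArg (zcoeff q) (h.eq₂ s)
  simpa only [map_sub, zcoeff_C_mul, zcoeff_shiftHom] using h1

/-- The adjoint forms of the two flow relations contain nothing new: they are obtained by undoing
the shift. -/
theorem shift₃ (h : IsFlow τ θ φ σ) (s q : ℤ) : τ s * shift false 1 (σ s) q +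
    φ s * shift false 1 (θ s) (q - 1) = σ s * shift false 1 (τ s) q := by
  have h1 := congrArg (zcoeff q) (congrArg (extHom false 1) (h.eq₁ s))
  simp only [map_mul, map_add, extHom_C, extHom_shiftHom, extHom_X] at h1
  simpa only [mul_comm (shiftHom _ _ _), map_add, zcoeff_X_mul, zcoeff_C_mul, zcoeff_shiftHom]
    using h1

theorem shift₄ (h : IsFlow τ θ φ σ) (s q : ℤ) : τ (s + 1) * shift true 1 (σ s) q -
    φ (s + 1) * shift true 1 (θ s) q = σ (s + 1) * shift true 1 (τ s) q := by
  have h1 := congrArg (zcoeff q) (congrArg (extHom true 1) (h.eq₂ s))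
  simp only [map_mul, map_sub, extHom_C, extHom_shiftHom] at h1
  simpa only [mul_comm (shiftHom _ _ _), map_sub, zcoeff_C_mul, zcoeff_shiftHom] using h1

end IsFlow

/-- The kernel has rank one and the projection cuts it off at the diagonal, so each product with `S`
or `S⁻¹` is a sum over a half-line. The three-term relation, divided by `τ_i τ_{i+1}`, exhibits the
summand as a difference. What remains is one boundary term, and the claim becomes one of the four
forms of `IsFlow`. -/
theorem isDressingDeriv_of_isFlow (hτ : IsTau S τ) (h : IsSystem false τ θ φ)
    (hσ : IsFlow τ θ φ σ) {P : Mat K} (hP : ∀ i j, τ i * τ (j + 1) * P i j = θ i * φ (j + 1)) :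
    IsDressingDeriv S τ (minusPart (P, 0)) σ := by
  have hu : ∀ s, ∃ t, τ s * t = 1 := fun s => (hτ.unit s).exists_right_inv
  choose τi hi using hu
  have hP1 : ∀ i j, P i j = θ i * τi i * (φ (j + 1) * τi (j + 1)) := fun i j => by
    linear_combination (τi i * τi (j + 1)) * hP i j -
      (P i j * τ (j + 1) * τi (j + 1)) * hi i - P i j * hi (j + 1)
  have hA1 : ∀ i j, (minusPart (P, 0)).1 i j = if j < i then P i j else 0 := fun i j => by
    simp [minusPart, lower]
  have hA2 : ∀ i j, (minusPart (P, 0)).2 i j = if i ≤ j then -P i j else 0 := fun i j => by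
    by_cases hij : i ≤ j <;> simp [minusPart, upper, hij]
  refine ⟨fun s j => ?_, fun s j => ?_, fun l s => ?_, fun l s => ?_⟩
  · have h1 := lsum_telescope_lt (f := fun i => φ (i + 1) * τi (i + 1) * S.S₁ i j)
      -- The primitive is the coefficient of `ζ^{i-j-1}` in `φ_i(x-[ζ])/τ_i`; it vanishes for `i ≤
      -- j` since its order is negative.
      (g := fun i => shift false (-1) (φ i) (i - j - 1) * τi i) j
      (fun i hij => by rw [shift_of_neg _ _ _ (by omega), zero_mul]) (fun i => by
        have h2 := h.adj.shift i (i - j)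
        rw [← hτ.S₁ i j] at h2
        rw [show i + 1 - j - 1 = i - j by ring]
        linear_combination (τi i * τi (i + 1)) * h2 - (φ (i + 1) * τi (i + 1) * S.S₁ i j -
          Toda.shift false (-1) (φ (i + 1)) (i - j) * τi (i + 1)) * hi i -
          Toda.shift false (-1) (φ i) (i - j - 1) * τi i * hi (i + 1)) s
    have h3 : (lsum fun i => (minusPart (P, 0)).1 s i * S.S₁ i j) =
        θ s * τi s * (shift false (-1) (φ s) (s - j - 1) * τi s) := by
      rw [← h1, mul_lsum]
      · congr 1
        funext i
        rw [hA1, hP1]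
        split_ifs <;> ring
      · refine LF.of_subset (Set.finite_Icc j s) fun i hij => ?_
        split_ifs with his
        · rw [S.S₁_lower, mul_zero]
          simp only [Set.mem_Icc, not_and_or] at hij
          omega
        · rfl
    rw [h3]
    have h4 := hσ.shift₁ s (s - j)
    rw [← hτ.S₁ s j] at h4
    refine (hτ.unit s).mul_left_cancel ?_
    linear_combination h4 + θ s * Toda.shift false (-1) (φ s) (s - j - 1) * (τ s * τi s + 1) * hi s
  · have h1 := lsum_telescope_ge (f := fun i => φ (i + 1) * τi (i + 1) * S.S₂ i j)
      (g := fun i => shift true (-1) (φ (i + 1)) (j - i) * τi i) j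
      (fun i hij => by rw [shift_of_neg _ _ _ (by omega), zero_mul]) (fun i => by
        have h2 := h.adj'.shift (-i) (j - i)
        simp only [Bool.not_false, show 2 - (-i + 1) = i + 1 by ring, show 1 - -i = i + 1 by ring,
          show 1 - (-i + 1) = i by ring, show 2 - -i = i + 1 + 1 by ring] at h2
        rw [← hτ.S₂ i j] at h2
        rw [show j - (i + 1) = j - i - 1 by ring]
        linear_combination (τi i * τi (i + 1)) * h2 - (φ (i + 1) * τi (i + 1) * S.S₂ i j +
          Toda.shift true (-1) (φ (i + 1 + 1)) (j - i - 1) * τi (i + 1)) * hi i +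
          Toda.shift true (-1) (φ (i + 1)) (j - i) * τi i * hi (i + 1)) s
    have h3 : (lsum fun i => (minusPart (P, 0)).2 s i * S.S₂ i j) =
        -(θ s * τi s) * (shift true (-1) (φ (s + 1)) (j - s) * τi s) := by
      rw [← h1, mul_lsum]
      · congr 1
        funext i
        rw [hA2, hP1]
        split_ifs <;> ring
      · refine LF.of_subset (Set.finite_Icc s j) fun i hij => ?_
        split_ifs with his
        · rw [S.S₂_upper, mul_zero]
          simp only [Set.mem_Icc, not_and_or] at hij
          omega
        · rfl
    rw [h3]
    have h4 := hσ.shift₂ s (j - s)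
    rw [← hτ.S₂ s j] at h4
    refine (hτ.unit s).mul_left_cancel ?_
    linear_combination h4 - θ s * Toda.shift true (-1) (φ (s + 1)) (j - s) *
      (τ s * τi s + 1) * hi s
  · have h1 := lsum_telescope_ge (f := fun i => θ i * τi i * S.S₁inv l i)
      (g := fun i => shift false 1 (θ i) (l - i) * τi i) l
      (fun i hij => by rw [shift_of_neg _ _ _ (by omega), zero_mul]) (fun i => by
        have h2 := h.wave.shift i (l - i)
        rw [← hτ.S₁inv l i] at h2
        rw [show l - (i + 1) = l - i - 1 by ring]
        linear_combination (τi i * τi (i + 1)) * h2 - (θ i * τi i * S.S₁inv l i -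
          Toda.shift false 1 (θ i) (l - i) * τi i) * hi (i + 1) -
          Toda.shift false 1 (θ (i + 1)) (l - i - 1) * τi (i + 1) * hi i) (s + 1)
    have h3 : (lsum fun i => S.S₁inv l i * (minusPart (P, 0)).1 i s) =
        φ (s + 1) * τi (s + 1) * (shift false 1 (θ (s + 1)) (l - (s + 1)) * τi (s + 1)) := by
      rw [← h1, mul_lsum]
      · congr 1
        funext i
        rw [hA1, hP1]
        simp only [← Int.add_one_le_iff]
        split_ifs <;> ring
      · refine LF.of_subset (Set.finite_Icc (s + 1) l) fun i hij => ?_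
        split_ifs with his
        · rw [S.S₁inv_lower, mul_zero]
          simp only [Set.mem_Icc, not_and_or] at hij
          omega
        · rfl
    rw [h3]
    have h4 := hσ.shift₃ (s + 1) (l - s)
    rw [← hτ.S₁inv l s] at h4
    rw [show l - (s + 1) = l - s - 1 by ring]
    refine (hτ.unit (s + 1)).mul_left_cancel ?_
    linear_combination -h4 - φ (s + 1) * Toda.shift false 1 (θ (s + 1)) (l - s - 1) *
      (τ (s + 1) * τi (s + 1) + 1) * hi (s + 1)
  · have h1 := lsum_telescope_lt (f := fun i => θ i * τi i * S.S₂inv l i)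
      -- The reflected relation ties `i` to `i - 1`. The sum includes `i = s`, so it is evaluated at
      -- the endpoint `s + 1`, where `θ_s` appears.
      (g := fun i => shift true 1 (θ (i - 1)) (i - 1 - l) * τi i) l
      (fun i hij => by rw [shift_of_neg _ _ _ (by omega), zero_mul]) (fun i => by
        have h2 := h.wave'.shift (-i) (i - l)
        simp only [Bool.not_false, show -(-i + 1) = i - 1 by ring, show 1 - -i = i + 1 by ring,
          show 1 - (-i + 1) = i by ring, neg_neg] at h2
        rw [← hτ.S₂inv l i] at h2
        rw [show i + 1 - 1 = i by ring, show i - 1 - l = i - l - 1 by ring]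
        linear_combination (τi i * τi (i + 1)) * h2 - (θ i * τi i * S.S₂inv l i +
          Toda.shift true 1 (θ (i - 1)) (i - l - 1) * τi i) * hi (i + 1) +
          Toda.shift true 1 (θ i) (i - l) * τi (i + 1) * hi i) (s + 1)
    have h3 : (lsum fun i => S.S₂inv l i * (minusPart (P, 0)).2 i s) =
        -(φ (s + 1) * τi (s + 1)) * (shift true 1 (θ s) (s - l) * τi (s + 1)) := by
      rw [add_sub_cancel_right] at h1
      rw [← h1, mul_lsum]
      · congr 1
        funext i
        rw [hA2, hP1]
        simp only [Int.lt_add_one_iff]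
        split_ifs <;> ring
      · refine LF.of_subset (Set.finite_Icc l s) fun i hij => ?_
        split_ifs with his
        · rw [S.S₂inv_upper, mul_zero]
          simp only [Set.mem_Icc, not_and_or] at hij
          omega
        · rfl
    rw [h3]
    have h4 := hσ.shift₄ s (s - l)
    rw [← hτ.S₂inv l s] at h4
    refine (hτ.unit (s + 1)).mul_left_cancel ?_
    linear_combination -h4 + φ (s + 1) * Toda.shift true 1 (θ s) (s - l) *
      (τ (s + 1) * τi (s + 1) + 1) * hi (s + 1)

end

section



/-! ### Tau function symmetries from vertex operators -/

variable [CharZero K] {S : Dressing K} {τ θ φ σ : ℤ → Fn K}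

theorem IsTau.W₁ (hτ : IsTau S τ) (s b : ℤ) : τ s * S.W₁ s b = wave false (τ s) (b - s) := by
  refine (hτ.wave₁ s b).trans ?_
  rw [wave, ← lsum_equiv (Equiv.subLeft (b - s))]
  simp only [tauSide₁, Ser.zpow_mul, Ser.mul, Ser.flip, Equiv.subLeft_apply]
  congr 1
  funext i
  rw [mul_comm, show b - s - i - (b - s) = -i by ring]

theorem IsTau.W₂ (hτ : IsTau S τ) (s b : ℤ) :
    τ s * S.W₂ s b = wave true (τ (s + 1)) (s - b) := by
  refine (hτ.wave₂ s b).trans ?_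
  rw [wave, ← lsum_equiv (Equiv.addRight (s - b))]
  simp only [tauSide₂, Ser.zpow_mul, Ser.mul, Ser.flip, Equiv.coe_addRight]
  congr 1
  funext i
  rw [mul_comm, add_sub_cancel_right, show -(b - s - i) = i + (s - b) by ring]

theorem IsTau.W₁inv (hτ : IsTau S τ) (k s : ℤ) :
    τ (s + 1) * S.W₁inv k s = vsum false (s - k) (τ (s + 1)) := by
  have h := hτ.wave₁star s (-k)
  rw [Dressing.Ψ₁star, neg_neg] at h
  rw [h, vsum, expSum, ← lsum_equiv (Equiv.subLeft (s - k))]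
  simp only [tauSide₁star, Ser.zpow_mul, Ser.mul, Ser.flip, Equiv.subLeft_apply]
  congr 1
  funext i
  rw [mul_comm, show s - k - i - (s - k) = -i by ring, show -k - -s - i = s - k - i by ring]

theorem IsTau.W₂inv (hτ : IsTau S τ) (k s : ℤ) :
    τ (s + 1) * S.W₂inv k s = vsum true (k - s) (τ s) := by
  have h := hτ.wave₂star s (-k)
  rw [Dressing.Ψ₂star, neg_neg] at h
  rw [h, vsum, expSum, ← lsum_equiv (Equiv.addRight (k - s))]
  simp only [tauSide₂star, Ser.zpow_mul, Ser.mul, Ser.flip, Equiv.coe_addRight]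
  congr 1
  funext i
  rw [mul_comm, add_sub_cancel_right, show -(-k - -s - i) = i + (k - s) by ring]

theorem IsTau.vertexX (hτ : IsTau S τ) (s a b : ℤ) :
    vertexX τ s a b = vsum false (a + 1 + s) (τ s * S.W₁ s b) := by
  rw [Toda.vertexX, Ser₂.mon_mul, vertexOp_eq, hτ.W₁]
  congr 1
  ring

theorem IsTau.vertexY (hτ : IsTau S τ) (s a b : ℤ) :
    vertexY τ (s + 1) a b = vsum true (a + 1 - s) (τ s * S.W₂ s (-b)) := by
  rw [Toda.vertexY, Ser₂.mon_mul, vertexXtilde, Ser₂.mon_mul, vertexOp_eq, hτ.W₂,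
    show a - -1 - (s + 1) + 1 = a + 1 - s by ring, show b - 1 - -(s + 1) = s - -b by ring]

/-- Both `φ` and `σ` are transforms against the same `e^{-ξ(x,λ)}`, of `τ` and of `θ`; the summed
identities then are the flow relations. -/
theorem isFlow₁ (h : IsSystem false τ θ φ) {N : ℤ} (hφ : ∀ s, φ s = vsum false (N + s - 1) (τ s))
    (hσ : ∀ s, σ s = vsum false (N + s) (θ s)) : IsFlow τ θ φ σ := by
  refine ⟨fun s => ext_zcoeff fun q => ?_, fun s => ext_zcoeff fun q => ?_⟩
  · simp only [map_add, zcoeff_X_mul, zcoeff_C_mul, zcoeff_shiftHom, hφ, hσ]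
    exact h.vsum₁ s (N + s) q
  · simp only [map_sub, zcoeff_C_mul, zcoeff_shiftHom, hφ, hσ]
    have := h.vsum₃ s (N + s) q
    rw [show N + (s + 1) - 1 = N + s by ring, ← add_assoc]
    exact this

/-- The reflected system is used. Here `φ_{s+1}` and `σ_{s+1}` arise from `τ_s` and `θ_s`; because
of this offset `vsum₄` and `vsum₂` are needed in place of `vsum₁` and `vsum₃`. -/
theorem isFlow₂ (h : IsSystem false τ θ φ) {N : ℤ}
    (hφ : ∀ s, φ (s + 1) = vsum true (N - s) (τ s))
    (hσ : ∀ s, σ (s + 1) = vsum true (N - s) (θ s)) : IsFlow τ (-θ) φ σ := by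
  have h' := h.reflect
  refine ⟨fun s => ext_zcoeff fun q => ?_, fun s => ext_zcoeff fun q => ?_⟩
  · simp only [map_add, zcoeff_X_mul, zcoeff_C_mul, zcoeff_shiftHom, Pi.neg_apply]
    obtain ⟨t, rfl⟩ : ∃ t, s = t + 1 := ⟨s - 1, by ring⟩
    have := h'.vsum₄ (-t) (N - t) q
    simp only [Bool.not_false, Bool.not_true, show 1 - -t = t + 1 by ring,
      show 1 - (-t + 1) = t by ring, show -(-t - 1) = t + 1 by ring, neg_neg, ← hσ, ← hφ] at this
    linear_combination this
  · simp only [map_sub, zcoeff_C_mul, zcoeff_shiftHom, Pi.neg_apply]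
    obtain ⟨t, rfl⟩ : ∃ t, s = t + 1 := ⟨s - 1, by ring⟩
    have := h'.vsum₂ (-(t + 1)) (N - (t + 1)) q
    simp only [Bool.not_false, show 1 - -(t + 1) = t + 1 + 1 by ring, neg_neg,
      show 1 - (-(t + 1) + 1) = t + 1 by ring, show -(-(t + 1) + 1) = t by ring,
      show N - (t + 1) + 1 = N - t by ring, ← hσ, ← hφ] at this
    linear_combination this

/-- The flow `α₂` thereby has the same shape as `α₁`, at the price of a sign, which is absorbed into
`θ`. -/
theorem minusPart_zero_left (P : Mat K) : minusPart (0, P) = minusPart (-P, 0) := by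
  refine Prod.ext ?_ ?_
  · funext i j
    by_cases h : j < i <;> simp [minusPart, lower, h]
  · funext i j
    by_cases h : i ≤ j <;> simp [minusPart, upper, h]

theorem isDressingDeriv_alphaFlow₁ (hS : S.IsTodaSolution) (hτ : IsTau S τ) (a b : ℤ) :
    IsDressingDeriv S τ (alphaFlow₁ S a b) fun n => vertexX τ n a b := by
  have h := isSystem₁ hS hτ b (-(a + 1))
  refine isDressingDeriv_of_isFlow hτ h (isFlow₁ h (N := a + 1) (fun s => ?_) fun s => ?_) ?_
  · have := hτ.W₁inv (-(a + 1)) (s - 1)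
    rw [sub_add_cancel] at this
    rw [this]
    congr 1
    ring
  · exact hτ.vertexX s a b
  · intro i j
    simp only [kron, Ser₂.mon_mul, sub_zero, sub_neg_eq_add, Dressing.Ψ₁, Dressing.Ψ₁star,
      add_sub_cancel_right]
    ring

theorem IsWave.neg {v : Bool} (h : IsWave v τ θ) : IsWave v τ fun s => -θ s := fun s => by
  simp only [map_neg]
  linear_combination -h s

theorem IsSystem.neg {v : Bool} (h : IsSystem v τ θ φ) : IsSystem v τ (-θ) φ :=
  { h with
    wave := h.wave.neg
    wave' := h.wave'.neg }

theorem isDressingDeriv_alphaFlow₂ (hS : S.IsTodaSolution) (hτ : IsTau S τ) (a b : ℤ) :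
    IsDressingDeriv S τ (alphaFlow₂ S a b) fun n => vertexY τ n a b := by
  have h := isSystem₂ hS hτ (-b) (a + 1)
  have h1 := isFlow₂ (σ := fun n => vertexY τ n a b) h (N := a + 1)
    (fun s => by rw [add_sub_cancel_right]; exact hτ.W₂inv (a + 1) s)
    fun s => hτ.vertexY s a b
  rw [alphaFlow₂, minusPart_zero_left]
  refine isDressingDeriv_of_isFlow hτ h.neg h1 fun i j => ?_
  simp only [kron, Ser₂.mon_mul, sub_zero, sub_neg_eq_add, Dressing.Ψ₂, Dressing.Ψ₂star,
    add_sub_cancel_right, Ser.flip, neg_neg, Pi.neg_apply]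
  ring

end

section



/-! ### Values of the derivative of the tau function -/

open LMat
open Finset.HasAntidiagonal (antidiagonal)

variable {S : Dressing K} {τ σ σ' : ℤ → Fn K}

/-- The triangularity of the matrices in the image of the projection `minusPart`. -/
structure IsMinus (A : MatPair K) : Prop where
  fst : ∀ i j, i ≤ j → A.1 i j = 0
  snd : ∀ i j, j < i → A.2 i j = 0

theorem isMinus_minusPart (P : MatPair K) : IsMinus (minusPart P) where
  fst i j h := by simp [minusPart, lower, show ¬ j < i by omega]
  snd i j h := by simp [minusPart, upper, show ¬ i ≤ j by omega]

namespace IsMinus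

variable {A : MatPair K}

theorem neg (h : IsMinus A) : IsMinus (-A) where
  fst i j hij := by rw [Prod.fst_neg, Pi.neg_apply, Pi.neg_apply, h.fst i j hij, neg_zero]
  snd i j hij := by rw [Prod.snd_neg, Pi.neg_apply, Pi.neg_apply, h.snd i j hij, neg_zero]

theorem bdd_fst (h : IsMinus A) : Bdd 1 A.1 := Bdd.of_le 0 fun i j hij =>
  h.fst i j (by simp at hij; omega)

theorem bdd_snd (h : IsMinus A) : Bdd (-1) A.2 := Bdd.of_le 0 fun i j hij =>
  h.snd i j (by simp at hij; omega)

theorem mul_S₁ (h : IsMinus A) (s j i : ℤ) (hi : i ∉ Set.Icc j s) : A.1 s i * S.S₁ i j = 0 := by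
  rw [Set.mem_Icc, not_and_or, not_le, not_le] at hi
  rcases hi with hi | hi
  · rw [S.S₁_lower i j hi, mul_zero]
  · rw [h.fst s i hi.le, zero_mul]

theorem mul_S₂ (h : IsMinus A) (s j i : ℤ) (hi : i ∉ Set.Icc s j) : A.2 s i * S.S₂ i j = 0 := by
  rw [Set.mem_Icc, not_and_or, not_le, not_le] at hi
  rcases hi with hi | hi
  · rw [h.snd s i hi, zero_mul]
  · rw [S.S₂_upper i j hi, mul_zero]

theorem S₁inv_mul (h : IsMinus A) (l s i : ℤ) (hi : i ∉ Set.Icc s l) :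
    S.S₁inv l i * A.1 i s = 0 := by
  rw [Set.mem_Icc, not_and_or, not_le, not_le] at hi
  rcases hi with hi | hi
  · rw [h.fst i s hi.le, mul_zero]
  · rw [S.S₁inv_lower l i hi, zero_mul]

theorem S₂inv_mul (h : IsMinus A) (l s i : ℤ) (hi : i ∉ Set.Icc l s) :
    S.S₂inv l i * A.2 i s = 0 := by
  rw [Set.mem_Icc, not_and_or, not_le, not_le] at hi
  rcases hi with hi | hi
  · rw [S.S₂inv_upper l i hi, zero_mul]
  · rw [h.snd i s hi, mul_zero]

end IsMinus

theorem lf_of_finite_fst {ι κ : Type*} {f : ι → κ → Fn K} {s : Set ι} (hs : s.Finite)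
    (h0 : ∀ i, i ∉ s → ∀ a, f i a = 0) (h : ∀ i, LF (f i)) : LF fun p : ι × κ => f p.1 p.2 := by
  intro d
  refine (hs.biUnion fun i _ => (h i d).image (Prod.mk i)).subset ?_
  rintro ⟨i, a⟩ hp
  refine Set.mem_biUnion (x := i) ?_ ⟨a, hp, rfl⟩
  by_contra hc
  exact hp (by simp only [h0 i hc a, map_zero])

variable [CharZero K]

/-- Infinite sums of flows. -/
theorem IsDressingDeriv.infSum {ι : Type*} {A : ι → MatPair K} {σ : ι → ℤ → Fn K}
    (hA : ∀ a, IsMinus (A a)) (h1 : ∀ i j, LF fun a => (A a).1 i j)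
    (h2 : ∀ i j, LF fun a => (A a).2 i j) (hσ : ∀ s, LF fun a => σ a s)
    (h : ∀ a, IsDressingDeriv S τ (A a) (σ a)) :
    IsDressingDeriv S τ (fun i j => lsum fun a => (A a).1 i j, fun i j => lsum fun a => (A a).2 i j)
      fun s => lsum fun a => σ a s := by
  refine ⟨fun s j => ?_, fun s j => ?_, fun l s => ?_, fun l s => ?_⟩
  · have hl : LF fun p : ℤ × ι => (A p.2).1 s p.1 * S.S₁ p.1 j :=
      lf_of_finite_fst (f := fun i a => (A a).1 s i * S.S₁ i j) (Set.finite_Icc j s)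
        (fun i hi a => (hA a).mul_S₁ s j i hi) fun i => (h1 s i).mul_right _
    have hl' : LF fun a => lsum fun i => (A a).1 s i * S.S₁ i j := hl.swap.fst
    rw [shift_lsum (hσ s)]
    simp only [lsum_mul _ (h1 s _)]
    rw [lsum_comm hl, lsum_mul _ (hσ s), mul_lsum _ hl',
      ← lsum_add ((hσ s).mul_right _) (LF.mul_left hl' _)]
    congr 1
    funext a
    exact (h a).wave₁ s j
  · have hl : LF fun p : ℤ × ι => (A p.2).2 s p.1 * S.S₂ p.1 j :=
      lf_of_finite_fst (f := fun i a => (A a).2 s i * S.S₂ i j) (Set.finite_Icc s j)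
        (fun i hi a => (hA a).mul_S₂ s j i hi) fun i => (h2 s i).mul_right _
    have hl' : LF fun a => lsum fun i => (A a).2 s i * S.S₂ i j := hl.swap.fst
    rw [shift_lsum (hσ (s + 1))]
    simp only [lsum_mul _ (h2 s _)]
    rw [lsum_comm hl, lsum_mul _ (hσ s), mul_lsum _ hl',
      ← lsum_add ((hσ s).mul_right _) (LF.mul_left hl' _)]
    congr 1
    funext a
    exact (h a).wave₂ s j
  · have hl : LF fun p : ℤ × ι => S.S₁inv l p.1 * (A p.2).1 p.1 s :=
      lf_of_finite_fst (f := fun i a => S.S₁inv l i * (A a).1 i s) (Set.finite_Icc s l)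
        (fun i hi a => (hA a).S₁inv_mul l s i hi) fun i => (h1 i s).mul_left _
    have hl' : LF fun a => lsum fun i => S.S₁inv l i * (A a).1 i s := hl.swap.fst
    rw [shift_lsum (hσ (s + 1))]
    simp only [mul_lsum _ (h1 _ s)]
    rw [lsum_comm hl, mul_lsum _ (hσ (s + 1)), lsum_mul _ hl',
      ← lsum_sub ((hσ (s + 1)).mul_left _) (LF.mul_right hl' _)]
    congr 1
    funext a
    exact (h a).wave₁star l s
  · have hl : LF fun p : ℤ × ι => S.S₂inv l p.1 * (A p.2).2 p.1 s :=
      lf_of_finite_fst (f := fun i a => S.S₂inv l i * (A a).2 i s) (Set.finite_Icc l s)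
        (fun i hi a => (hA a).S₂inv_mul l s i hi) fun i => (h2 i s).mul_left _
    have hl' : LF fun a => lsum fun i => S.S₂inv l i * (A a).2 i s := hl.swap.fst
    rw [shift_lsum (hσ s)]
    simp only [mul_lsum _ (h2 _ s)]
    rw [lsum_comm hl, mul_lsum _ (hσ (s + 1)), lsum_mul _ hl',
      ← lsum_sub ((hσ (s + 1)).mul_left _) (LF.mul_right hl' _)]
    congr 1
    funext a
    exact (h a).wave₂star l s

theorem IsDressingDeriv.add {A B : MatPair K} (hA : IsMinus A) (hB : IsMinus B)
    (h : IsDressingDeriv S τ A σ) (h' : IsDressingDeriv S τ B σ') :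
    IsDressingDeriv S τ (A + B) (σ + σ') := by
  refine ⟨fun s j => ?_, fun s j => ?_, fun l s => ?_, fun l s => ?_⟩
  · simp only [Prod.fst_add, Pi.add_apply, add_mul, shift_add, ← h.wave₁ s j, ← h'.wave₁ s j]
    rw [lsum_add (LF.of_subset (Set.finite_Icc j s) (hA.mul_S₁ s j))
      (LF.of_subset (Set.finite_Icc j s) (hB.mul_S₁ s j))]
    ring
  · simp only [Prod.snd_add, Pi.add_apply, add_mul, shift_add, ← h.wave₂ s j, ← h'.wave₂ s j]
    rw [lsum_add (LF.of_subset (Set.finite_Icc s j) (hA.mul_S₂ s j))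
      (LF.of_subset (Set.finite_Icc s j) (hB.mul_S₂ s j))]
    ring
  · simp only [Prod.fst_add, Pi.add_apply, mul_add, shift_add, ← h.wave₁star l s,
      ← h'.wave₁star l s]
    rw [lsum_add (LF.of_subset (Set.finite_Icc s l) (hA.S₁inv_mul l s))
      (LF.of_subset (Set.finite_Icc s l) (hB.S₁inv_mul l s))]
    ring
  · simp only [Prod.snd_add, Pi.add_apply, mul_add, shift_add, ← h.wave₂star l s,
      ← h'.wave₂star l s]
    rw [lsum_add (LF.of_subset (Set.finite_Icc l s) (hA.S₂inv_mul l s))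
      (LF.of_subset (Set.finite_Icc l s) (hB.S₂inv_mul l s))]
    ring

theorem IsDressingDeriv.smul {A : MatPair K} (c : K) (hA : IsMinus A)
    (h : IsDressingDeriv S τ A σ) : IsDressingDeriv S τ (c • A) (c • σ) := by
  refine ⟨fun s j => ?_, fun s j => ?_, fun l s => ?_, fun l s => ?_⟩
  · simp only [Prod.smul_fst, Pi.smul_apply, smul_mul_assoc, shift_smul, ← h.wave₁ s j]
    rw [lsum_smul _ (LF.of_subset (Set.finite_Icc j s) (hA.mul_S₁ s j)), smul_add, mul_smul_comm]
  · simp only [Prod.smul_snd, Pi.smul_apply, smul_mul_assoc, shift_smul, ← h.wave₂ s j]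
    rw [lsum_smul _ (LF.of_subset (Set.finite_Icc s j) (hA.mul_S₂ s j)), smul_add, mul_smul_comm]
  · simp only [Prod.smul_fst, Pi.smul_apply, mul_smul_comm, shift_smul, ← h.wave₁star l s]
    rw [lsum_smul _ (LF.of_subset (Set.finite_Icc s l) (hA.S₁inv_mul l s)), smul_sub,
      smul_mul_assoc]
  · simp only [Prod.smul_snd, Pi.smul_apply, mul_smul_comm, shift_smul, ← h.wave₂star l s]
    rw [lsum_smul _ (LF.of_subset (Set.finite_Icc l s) (hA.S₂inv_mul l s)), smul_sub,
      smul_mul_assoc]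

theorem isMinus_zero : IsMinus (0 : MatPair K) := ⟨fun _ _ _ => rfl, fun _ _ _ => rfl⟩

/-- A function invariant under all shifts of `x` is independent of `x`. -/
theorem pderiv_eq_zero_of_shiftHom {v : Bool} {f : Fn K}
    (h : shiftHom v (-1) f = PowerSeries.C f) (n : ℕ) : pderiv K ((v, n) : Var) f = 0 := by
  -- With all positive orders zero, the recursion determines the derivatives one at a time: once the
  -- lower ones vanish, only `∂_{n+1} f` is left.
  have h0 : ∀ n, hop v (-1) (n + 1) f = 0 := fun n => by
    rw [← coeff_shiftHom, h, PowerSeries.coeff_C, if_neg (Nat.succ_ne_zero n)]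
  induction n using Nat.strong_induction_on with
  | _ n ih =>
    have h1 := hop_succ_nat v (-1) n f
    rw [h0, mul_zero, Finset.sum_eq_single (n, 0)] at h1
    · rw [hop_zero, map_neg, map_one, neg_one_mul] at h1
      exact neg_eq_zero.1 h1.symm
    · rintro ⟨i, j⟩ hp hne
      have hp' := Finset.HasAntidiagonal.mem_antidiagonal.1 hp
      simp only at hp' ⊢
      rw [ih i, map_zero]
      refine lt_of_le_of_ne (by omega) ?_
      rintro rfl
      exact hne (by rw [Prod.mk.injEq]; omega)
    · simp

/-- The tau function is determined up to a constant factor. -/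
theorem IsDressingDeriv.eq_smul (hτ : IsTau S τ) (h : IsDressingDeriv S τ 0 σ) :
    ∃ c : K, ∀ s, σ s = c • τ s := by
  have hu : ∀ s, ∃ t, τ s * t = 1 := fun s => (hτ.unit s).exists_right_inv
  choose τi hi using hu
  have hσ : ∀ s, σ s = σ s * τi s * τ s := fun s => by linear_combination -σ s * hi s
  have e1 : ∀ s q, σ s * shift false (-1) (τ s) q = τ s * shift false (-1) (σ s) q := by
    intro s q
    have h1 := h.wave₁ s (s - q)
    have h0 : (lsum fun i : ℤ => (0 : MatPair K).1 s i * S.S₁ i (s - q)) = 0 :=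
      (congrArg lsum (funext fun i => zero_mul _)).trans lsum_zero
    have h2 := hτ.S₁ s (s - q)
    rw [h0, sub_sub_cancel] at h1
    rw [sub_sub_cancel] at h2
    linear_combination τ s * h1 - σ s * h2
  have e2 : ∀ s q, σ s * shift true (-1) (τ (s + 1)) q = τ s * shift true (-1) (σ (s + 1)) q := by
    intro s q
    have h1 := h.wave₂ s (s + q)
    have h0 : (lsum fun i : ℤ => (0 : MatPair K).2 s i * S.S₂ i (s + q)) = 0 :=
      (congrArg lsum (funext fun i => zero_mul _)).trans lsum_zero
    have h2 := hτ.S₂ s (s + q)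
    rw [h0, add_sub_cancel_left] at h1
    rw [add_sub_cancel_left] at h2
    linear_combination τ s * h1 - σ s * h2
  -- Order zero of the `y`-relation already says that the ratio `σ/τ` does not depend on `s`.
  have e3 : ∀ s, σ (s + 1) * τi (s + 1) = σ s * τi s := fun s => by
    have h1 := e2 s 0
    simp only [← Nat.cast_zero (R := ℤ), shift_natCast, hop_zero] at h1
    linear_combination (-τi s * τi (s + 1)) * h1 + σ s * τi s * hi (s + 1) -
      σ (s + 1) * τi (s + 1) * hi s
  have e4 : ∀ s, σ s * τi s = σ 0 * τi 0 := fun s => by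
    induction s using Int.induction_on with
    | zero => rfl
    | succ n ih => rw [e3, ih]
    | pred n ih => rw [← ih, ← e3 (-n - 1), sub_add_cancel]
  have f1 : shiftHom false (-1) (σ 0 * τi 0) = PowerSeries.C (σ 0 * τi 0) := by
    have h1 : PowerSeries.C (σ 0) * shiftHom false (-1) (τ 0) =
        PowerSeries.C (τ 0) * shiftHom false (-1) (σ 0) := ext_zcoeff fun q => by
      simpa only [zcoeff_C_mul, zcoeff_shiftHom] using e1 0 q
    rw [hσ 0, map_mul, map_mul _ (σ 0 * τi 0) (τ 0)] at h1
    refine ((hτ.isUnit_C 0).mul (hτ.isUnit_shiftHom false (-1) 0)).mul_left_cancel ?_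
    linear_combination -h1
  have f2 : shiftHom true (-1) (σ 0 * τi 0) = PowerSeries.C (σ 0 * τi 0) := by
    have h1 : PowerSeries.C (σ (-1)) * shiftHom true (-1) (τ 0) =
        PowerSeries.C (τ (-1)) * shiftHom true (-1) (σ 0) := ext_zcoeff fun q => by
      have h1 := e2 (-1) q
      rw [neg_add_cancel] at h1
      simpa only [zcoeff_C_mul, zcoeff_shiftHom] using h1
    rw [hσ (-1), hσ 0, map_mul, map_mul _ (σ 0 * τi 0) (τ 0), e4] at h1
    refine ((hτ.isUnit_C (-1)).mul (hτ.isUnit_shiftHom true (-1) 0)).mul_left_cancel ?_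
    linear_combination -h1
  -- Invariance under both shifts kills every partial derivative of the ratio, so it is a constant.
  have hc : σ 0 * τi 0 = C (constantCoeff (σ 0 * τi 0)) := by
    refine pderiv.ext ?_ ?_
    · rintro ⟨v, n⟩
      rw [pderiv_C]
      cases v
      · exact pderiv_eq_zero_of_shiftHom f1 n
      · exact pderiv_eq_zero_of_shiftHom f2 n
    · simp
  refine ⟨constantCoeff (σ 0 * τi 0), fun s => ?_⟩
  rw [smul_eq_C_mul, ← hc, ← e4 s]
  exact hσ s

/-- The values of the derivative of the tau function form a coset of the constant multiples. -/
theorem isTauDeriv_iff_of_isDressingDeriv (hτ : IsTau S τ) {A : MatPair K} (hA : IsMinus A)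
    (h : IsDressingDeriv S τ A σ) (σ' : ℤ → Fn K) :
    IsTauDeriv S τ A σ' ↔ ∃ c : K, ∀ s, σ' s = σ s + c • τ s := by
  rw [isTauDeriv_iff hA.bdd_fst hA.bdd_snd]
  constructor
  · intro h'
    have h1 := h'.add hA ?_ (h.smul (-1) hA)
    · rw [neg_one_smul, neg_one_smul, add_neg_cancel] at h1
      obtain ⟨c, hc⟩ := h1.eq_smul hτ
      refine ⟨c, fun s => ?_⟩
      rw [← hc, Pi.add_apply, Pi.neg_apply]
      ring
    · rw [neg_one_smul]
      exact hA.neg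
  · rintro ⟨c, hc⟩
    have h1 := h.add hA ?_ ((isDressingDeriv_zero hτ).smul c isMinus_zero)
    · rw [smul_zero, add_zero] at h1
      rwa [show σ' = σ + c • τ from funext hc]
    · rw [smul_zero]
      exact isMinus_zero

end

section



/-! ### Additional symmetries and squared eigenfunction symmetries -/

open LMat

theorem factorial_mul_choose_succ (i : ℤ) (m : ℕ) :
    ((m + 1).factorial : ℤ) * Ring.choose i (m + 1) =
      (m.factorial : ℤ) * Ring.choose i m * (i - m) := by
  have h1 := Ring.descPochhammer_eq_factorial_smul_choose i (m + 1)
  have h2 := Ring.descPochhammer_eq_factorial_smul_choose i m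
  rw [descPochhammer_succ_right, Polynomial.smeval_mul, h2, Polynomial.smeval_sub,
    Polynomial.smeval_X, Polynomial.smeval_natCast] at h1
  simpa using h1.symm

/-- `ε`, as an element of the ring of matrices bounded above. -/
def orlovM₁ : LMat K 1 := LMat.mk orlov₁ <| Bdd.of_le 0 fun i j h => by
  rw [orlov₁, if_neg]
  simp at h
  omega

/-- `ε*`, as an element of the ring of matrices bounded below. -/
def orlovM₂ : LMat K (-1) := LMat.mk orlov₂ <| Bdd.of_le 0 fun i j h => by
  simp only [Units.val_neg, Units.val_one, neg_mul, one_mul] at h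
  rw [orlov₂, orlov₁, shiftMat, if_neg (by omega), if_neg (by omega), neg_zero, add_zero]

theorem orlovM₁_mul (P : LMat K 1) (i j : ℤ) :
    (orlovM₁ * P).val i j = (i : Fn K) * P.val (i - 1) j := by
  rw [val_mul, lsum_eq_single (i - 1)]
  · rw [orlovM₁, val_mk, orlov₁, if_pos rfl]
  · intro k hk
    rw [orlovM₁, val_mk, orlov₁, if_neg hk, zero_mul]

/-- The summand `Λ` in `ε*` turns the entry `-(i+1)` of `-εᵀ` into `-i`, so that the powers of `ε*`
produce falling factorials of `-i`. -/
theorem orlovM₂_mul (P : LMat K (-1)) (i j : ℤ) :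
    (orlovM₂ * P).val i j = ((-i : ℤ) : Fn K) * P.val (i + 1) j := by
  rw [val_mul, lsum_eq_single (i + 1)]
  · rw [orlovM₂, val_mk, orlov₂, orlov₁, shiftMat, if_pos (by ring), if_pos (by ring)]
    push_cast
    ring
  · intro k hk
    rw [orlovM₂, val_mk, orlov₂, orlov₁, shiftMat, if_neg (by omega), if_neg (by omega), neg_zero,
      add_zero, zero_mul]

theorem orlovM₁_pow_mul (m : ℕ) (P : LMat K 1) (i j : ℤ) : (orlovM₁ ^ m * P).val i j =
    ((m.factorial * Ring.choose i m : ℤ) : Fn K) * P.val (i - m) j := by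
  induction m generalizing P with
  | zero => simp
  | succ m ih =>
    rw [pow_succ, mul_assoc, ih, orlovM₁_mul, ← mul_assoc, ← Int.cast_mul,
      factorial_mul_choose_succ]
    congr 2
    push_cast
    ring

theorem orlovM₂_pow_mul (m : ℕ) (P : LMat K (-1)) (i j : ℤ) : (orlovM₂ ^ m * P).val i j =
    ((m.factorial * Ring.choose (-i) m : ℤ) : Fn K) * P.val (i + m) j := by
  induction m generalizing P with
  | zero => simp
  | succ m ih =>
    rw [pow_succ, mul_assoc, ih, orlovM₂_mul, ← mul_assoc, ← Int.cast_mul,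
      factorial_mul_choose_succ]
    congr 2
    · congr 2
      ring
    · push_cast
      ring

variable [CharZero K] (S : Dressing K)

theorem mul_mul_pow {A : Type*} [Ring A] {w wi x : A} (h : wi * w = 1) (h' : w * wi = 1) (m : ℕ) :
    (w * x * wi) ^ m = w * x ^ m * wi := by
  induction m with
  | zero => simp [h']
  | succ m ih =>
    rw [pow_succ, ih, pow_succ]
    calc w * x ^ m * wi * (w * x * wi) = w * x ^ m * (wi * w) * x * wi := by noncomm_ring
      _ = w * (x ^ m * x) * wi := by rw [h]; noncomm_ring

/-- The exponential is a series in a power of `Λ`, hence commutes with `Λ^l`: dressing by `W` and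
dressing by `S` give the same `L`. -/
theorem dressed_lam {ε : ℤˣ} {v : Bool} (s si : LMat K ε) (l : ℤ) :
    s * expM ε v 1 * lam l * (expM ε v (-1) * si) = s * lam l * si := by
  calc s * expM ε v 1 * lam l * (expM ε v (-1) * si)
      = s * (expM ε v 1 * lam l) * (expM ε v (-1) * si) := by noncomm_ring
    _ = s * lam l * (expM ε v 1 * expM ε v (-1)) * si := by rw [expM_lam]; noncomm_ring
    _ = s * lam l * si := by rw [Dressing.expM_mul_neg, mul_one]

theorem mpow_M₁_mul_L₁ (m : ℕ) (l : ℤ) : mmul (mpow S.M₁ m) (S.L₁ l) =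
    (S.w₁ * (orlovM₁ ^ m * (lam l * S.w₁i))).val := by
  have h1 : S.M₁ = (S.w₁ * orlovM₁ * S.w₁i).val := by
    rw [val_mul', val_mul', S.val_w₁, S.val_w₁i]
    rfl
  have h2 : S.L₁ l = (S.w₁ * lam l * S.w₁i).val := by
    rw [Dressing.w₁, Dressing.w₁i, dressed_lam]
    rfl
  rw [h1, h2, ← val_pow, ← val_mul', mul_mul_pow S.w₁i_mul S.w₁_mul]
  congr 1
  calc S.w₁ * orlovM₁ ^ m * S.w₁i * (S.w₁ * lam l * S.w₁i)
      = S.w₁ * orlovM₁ ^ m * (S.w₁i * S.w₁) * lam l * S.w₁i := by noncomm_ring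
    _ = _ := by rw [S.w₁i_mul]; noncomm_ring

theorem mpow_M₂_mul_L₂ (m : ℕ) (l : ℤ) : mmul (mpow S.M₂ m) (S.L₂ l) =
    (S.w₂ * (orlovM₂ ^ m * (lam (-l) * S.w₂i))).val := by
  have h1 : S.M₂ = (S.w₂ * orlovM₂ * S.w₂i).val := by
    rw [val_mul', val_mul', S.val_w₂, S.val_w₂i]
    rfl
  have h2 : S.L₂ l = (S.w₂ * lam (-l) * S.w₂i).val := by
    rw [Dressing.w₂, Dressing.w₂i, dressed_lam]
    rfl
  rw [h1, h2, ← val_pow, ← val_mul', mul_mul_pow S.w₂i_mul S.w₂_mul]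
  congr 1
  calc S.w₂ * orlovM₂ ^ m * S.w₂i * (S.w₂ * lam (-l) * S.w₂i)
      = S.w₂ * orlovM₂ ^ m * (S.w₂i * S.w₂) * lam (-l) * S.w₂i := by noncomm_ring
    _ = _ := by rw [S.w₂i_mul]; noncomm_ring

/-- The kernel of the flow `∂_{α₁}`. -/
def kernel₁ (a b : ℤ) : Mat K := kron S.Ψ₁ S.Ψ₁star a b

/-- The kernel of the flow `∂_{α₂}`. -/
def kernel₂ (a b : ℤ) : Mat K :=
  kron (fun n => Ser.flip (S.Ψ₂ n)) (fun n => Ser.flip (S.Ψ₂star n)) a b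

theorem kernel₁_apply (a b i j : ℤ) :
    kernel₁ S a b i j = S.w₁.val i b * S.w₁i.val (-(a + 1)) j := by
  rw [S.val_w₁, S.val_w₁i]
  simp only [kernel₁, kron, Ser₂.mon_mul, sub_zero, sub_neg_eq_add, Dressing.Ψ₁, Dressing.Ψ₁star]
  ring

theorem kernel₂_apply (a b i j : ℤ) :
    kernel₂ S a b i j = S.w₂.val i (-b) * S.w₂i.val (a + 1) j := by
  rw [S.val_w₂, S.val_w₂i]
  simp only [kernel₂, kron, Ser₂.mon_mul, sub_zero, sub_neg_eq_add, Dressing.Ψ₂, Dressing.Ψ₂star,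
    Ser.flip, neg_neg]
  ring

/-- The sum of the kernel along an antidiagonal is an entry of `W₁ Λ^{-(n+1)} W₁⁻¹`, a convergent
matrix product; hence the flow itself can be expanded at `μ = λ`. -/
theorem lf_kernel₁ (n i j : ℤ) : LF fun b => kernel₁ S (n - b) b i j := by
  have h := S.w₁.lf (lam (-(n + 1)) * S.w₁i) i j
  convert h using 2 with b
  rw [kernel₁_apply, lam_mul]
  congr 2
  ring

theorem lf_kernel₂ (n i j : ℤ) : LF fun b => kernel₂ S (n - b) b i j := by
  have h := (S.w₂.lf (lam (n + 1) * S.w₂i) i j).comp (Equiv.neg ℤ).injective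
  convert h using 2 with b
  rw [kernel₂_apply, lam_mul]
  simp only [Equiv.neg_apply]
  congr 2
  ring

/-- Both sides are sums over the column index `b` of `W₁`: `ε^m` contributes `m! (b choose m)` and
moves the row of `W₁⁻¹` to `b + k`, which is where `a + b = -k - 1` puts it. -/
theorem mpow_M₁_mul_L₁_apply (m : ℕ) (k i j : ℤ) : mmul (mpow S.M₁ m) (S.L₁ (m + k)) i j =
    m.factorial • Ser₂.diagCoeff m (-k - m - 1) fun a b => kernel₁ S a b i j := by
  rw [mpow_M₁_mul_L₁, val_mul, nsmul_eq_mul, Ser₂.diagCoeff]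
  simp only [zsmul_eq_mul]
  have hl : LF fun b : ℤ => ((Ring.choose b m : ℤ) : Fn K) *
      kernel₁ S (-k - m - 1 + m - b) b i j := (lf_kernel₁ S _ i j).mul_left _
  rw [mul_lsum _ hl]
  congr 1
  funext b
  rw [orlovM₁_pow_mul, lam_mul, kernel₁_apply]
  rw [show -(-k - m - 1 + m - b + 1) = b - m + (m + k) by ring]
  push_cast
  ring

theorem mpow_M₂_mul_L₂_apply (m : ℕ) (k i j : ℤ) : mmul (mpow S.M₂ m) (S.L₂ (m + k)) i j =
    m.factorial • Ser₂.diagCoeff m (-k - m - 1) fun a b => kernel₂ S a b i j := by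
  rw [mpow_M₂_mul_L₂, val_mul, nsmul_eq_mul, Ser₂.diagCoeff, ← lsum_equiv (Equiv.neg ℤ)]
  simp only [zsmul_eq_mul, Equiv.neg_apply]
  have hl : LF fun b : ℤ => ((Ring.choose b m : ℤ) : Fn K) *
      kernel₂ S (-k - m - 1 + m - b) b i j := (lf_kernel₂ S _ i j).mul_left _
  rw [mul_lsum _ hl]
  congr 1
  funext b
  rw [orlovM₂_pow_mul, lam_mul, kernel₂_apply, neg_neg]
  rw [show -k - m - 1 + m - b + 1 = -b + m + -(m + k) by ring]
  push_cast
  ring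

theorem diagCoeff_zero (m : ℕ) (c : ℤ) : Ser₂.diagCoeff m c (fun _ _ => (0 : Fn K)) = 0 := by
  simp only [Ser₂.diagCoeff, smul_zero]
  exact lsum_zero

theorem diagCoeff_neg (m : ℕ) (c : ℤ) (f : Ser₂ K) :
    Ser₂.diagCoeff m c (fun a b => -f a b) = -Ser₂.diagCoeff m c f := by
  simp only [Ser₂.diagCoeff, smul_neg]
  exact lsum_neg _

theorem minusPart_fst_left (P : Mat K) (i j : ℤ) :
    (minusPart (P, 0)).1 i j = if j < i then P i j else 0 := by simp [minusPart, lower]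

theorem minusPart_snd_left (P : Mat K) (i j : ℤ) :
    (minusPart (P, 0)).2 i j = if i ≤ j then -P i j else 0 := by
  by_cases h : i ≤ j <;> simp [minusPart, upper, h]

theorem minusPart_fst_right (P : Mat K) (i j : ℤ) :
    (minusPart (0, P)).1 i j = if j < i then -P i j else 0 := by
  by_cases h : j < i <;> simp [minusPart, lower, h]

theorem minusPart_snd_right (P : Mat K) (i j : ℤ) :
    (minusPart (0, P)).2 i j = if i ≤ j then P i j else 0 := by simp [minusPart, upper]

theorem addFlow₁_fst (m : ℕ) (k i j : ℤ) : (addFlow₁ S m (m + k)).1 i j = -(m.factorial •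
    Ser₂.diagCoeff m (-k - m - 1) fun a b => (alphaFlow₁ S a b).1 i j) := by
  rw [addFlow₁, Prod.fst_neg, Pi.neg_apply, Pi.neg_apply, minusPart_fst_left,
    mpow_M₁_mul_L₁_apply]
  simp only [alphaFlow₁, minusPart_fst_left]
  split_ifs
  · rfl
  · rw [diagCoeff_zero, smul_zero]

theorem addFlow₁_snd (m : ℕ) (k i j : ℤ) : (addFlow₁ S m (m + k)).2 i j = -(m.factorial •
    Ser₂.diagCoeff m (-k - m - 1) fun a b => (alphaFlow₁ S a b).2 i j) := by
  rw [addFlow₁, Prod.snd_neg, Pi.neg_apply, Pi.neg_apply, minusPart_snd_left,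
    mpow_M₁_mul_L₁_apply]
  simp only [alphaFlow₁, minusPart_snd_left]
  split_ifs
  · rw [diagCoeff_neg, smul_neg]
    rfl
  · rw [diagCoeff_zero, smul_zero]

theorem addFlow₂_fst (m : ℕ) (k i j : ℤ) : (addFlow₂ S m (m + k)).1 i j = -(m.factorial •
    Ser₂.diagCoeff m (-k - m - 1) fun a b => (alphaFlow₂ S a b).1 i j) := by
  rw [addFlow₂, Prod.fst_neg, Pi.neg_apply, Pi.neg_apply, minusPart_fst_right,
    mpow_M₂_mul_L₂_apply]
  simp only [alphaFlow₂, minusPart_fst_right]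
  split_ifs
  · rw [diagCoeff_neg, smul_neg]
    rfl
  · rw [diagCoeff_zero, smul_zero]

theorem addFlow₂_snd (m : ℕ) (k i j : ℤ) : (addFlow₂ S m (m + k)).2 i j = -(m.factorial •
    Ser₂.diagCoeff m (-k - m - 1) fun a b => (alphaFlow₂ S a b).2 i j) := by
  rw [addFlow₂, Prod.snd_neg, Pi.neg_apply, Pi.neg_apply, minusPart_snd_right,
    mpow_M₂_mul_L₂_apply]
  simp only [alphaFlow₂, minusPart_snd_right]
  split_ifs
  · rfl
  · rw [diagCoeff_zero, smul_zero]

theorem lf_alphaFlow₁ (n i j : ℤ) : LF (fun b => (alphaFlow₁ S (n - b) b).1 i j) ∧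
    LF fun b => (alphaFlow₁ S (n - b) b).2 i j := by
  simp only [alphaFlow₁, minusPart_fst_left, minusPart_snd_left]
  constructor <;> split_ifs
  · exact lf_kernel₁ S n i j
  · exact LF.zero
  · exact (lf_kernel₁ S n i j).neg
  · exact LF.zero

theorem lf_alphaFlow₂ (n i j : ℤ) : LF (fun b => (alphaFlow₂ S (n - b) b).1 i j) ∧
    LF fun b => (alphaFlow₂ S (n - b) b).2 i j := by
  simp only [alphaFlow₂, minusPart_fst_right, minusPart_snd_right]
  constructor <;> split_ifs
  · exact (lf_kernel₂ S n i j).neg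
  · exact LF.zero
  · exact lf_kernel₂ S n i j
  · exact LF.zero

end

section



/-! ### The Adler–Shiota–van Moerbeke formula -/

theorem WtGE.mono {m n : ℤ} {f : Fn K} (hf : WtGE n f) (h : m ≤ n) : WtGE m f :=
  fun d hd => hf d (by omega)

theorem WtGE.zero (n : ℤ) : WtGE n (0 : Fn K) := fun _ _ => map_zero _

/-- Multiplication by `λ - μ` shifts the expansion at `μ = λ`. -/
theorem diagCoeff_diff_mul {F : Ser₂ K} (hF : ∀ n, LF fun b => F (n - b) b) (m : ℕ) (c : ℤ) :
    Ser₂.diagCoeff (m + 1) c (Ser₂.diff_mul F) = -Ser₂.diagCoeff m c F := by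
  have h1 : LF fun b : ℤ => ((Ring.choose b (m + 1) : ℤ) : Fn K) * F (c + m - b) b :=
    (hF (c + m)).mul_left _
  have h2 : LF fun b : ℤ => ((Ring.choose (b + 1) (m + 1) : ℤ) : Fn K) * F (c + m - b) b :=
    (hF (c + m)).mul_left _
  have h3 : LF fun b : ℤ => ((Ring.choose b (m + 1) : ℤ) : Fn K) *
      F (c + m - (b - 1)) (b - 1) := by
    have := h2.comp (Equiv.subRight (1 : ℤ)).injective
    simpa only [Equiv.subRight_apply, sub_add_cancel] using this
  have h4 : (lsum fun b : ℤ => ((Ring.choose b (m + 1) : ℤ) : Fn K) *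
      F (c + m - (b - 1)) (b - 1)) =
      lsum fun b : ℤ => ((Ring.choose (b + 1) (m + 1) : ℤ) : Fn K) * F (c + m - b) b := by
    rw [← lsum_equiv (Equiv.addRight (1 : ℤ))]
    simp only [Equiv.coe_addRight, add_sub_cancel_right]
  have h5 : Ser₂.diagCoeff (m + 1) c (Ser₂.diff_mul F) = lsum fun b : ℤ =>
      ((Ring.choose b (m + 1) : ℤ) : Fn K) * F (c + m - b) b -
      ((Ring.choose b (m + 1) : ℤ) : Fn K) * F (c + m - (b - 1)) (b - 1) := by
    rw [Ser₂.diagCoeff]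
    congr 1
    funext b
    simp only [Ser₂.diff_mul, Ser₂.mon_mul, sub_zero, zsmul_eq_mul]
    rw [show c + (m + 1 : ℕ) - b - 1 = c + m - b by push_cast; ring,
      show c + (m + 1 : ℕ) - b = c + m - (b - 1) by push_cast; ring, mul_sub]
  rw [h5, lsum_sub h1 h3, h4, ← lsum_sub h1 h2, Ser₂.diagCoeff, ← lsum_neg]
  congr 1
  funext b
  -- Pascal's rule is the coefficient form of `λ - μ = -t`.
  rw [Ring.choose_succ_succ, zsmul_eq_mul]
  push_cast
  ring

variable [CharZero K] {S : Dressing K} {τ : ℤ → Fn K} {v : Bool}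

/-- The difference multiplies by `1 - μ/λ` and so cancels the denominator in `e^{ξ(x+[λ⁻¹],μ)} =
e^{ξ(x,μ)}/(1 - μ/λ)`. -/
theorem shift_wave (f : Fn K) (b q : ℤ) :
    shift v 1 (wave v f b) q - shift v 1 (wave v f (b - 1)) (q - 1) =
      lsum fun j => expXi v 1 j * shift v 1 (shift v (-1) f (j - b)) q := by
  have h : wave v f (b - 1) = lsum fun j => expXi v 1 (j - 1) * shift v (-1) f (j - b) := by
    rw [wave, ← lsum_equiv (Equiv.subRight (1 : ℤ))]
    simp only [Equiv.subRight_apply, sub_sub_sub_cancel_right]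
  have hl : LF fun j => expXi v 1 (j - 1) * shift v (-1) f (j - b) := by
    have := (lf_expXi v 1 fun j => shift v (-1) f (j - (b - 1))).comp
      (Equiv.subRight (1 : ℤ)).injective
    simpa only [Equiv.subRight_apply, sub_sub_sub_cancel_right] using this
  have hl' := lf_expXi v 1 fun j => shift v (-1) f (j - b)
  rw [h, wave, shift_lsum hl', shift_lsum hl, ← lsum_sub (hl'.shift _ _ _) (hl.shift _ _ _)]
  simp only [shift_expXi_mul (show (1 : K) * 1 = 1 by ring)]

/-- The normally ordered form: `(λ-μ)X f = e^{ξ(x,μ)-ξ(x,λ)} f(x+[λ⁻¹]-[μ⁻¹])`, with no pole at `μ =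
λ`. -/
theorem diff_mul_vertexOp (f : Fn K) (a b : ℤ) : Ser₂.diff_mul (vertexOp v f) a b =
    expSum v fun p => lsum fun j =>
      expXi v 1 j * shift v 1 (shift v (-1) f (j - b)) (p - a) := by
  simp only [Ser₂.diff_mul, Ser₂.mon_mul, sub_zero, vertexOp_eq, ← shift_wave]
  rw [expSum_sub, vsum, vsum, sub_add_cancel]
  simp only [sub_sub]

/-- In the pole-free form the coefficient of `λ^a μ^b` has weight at least `max(a, b)`, since the
two exponentials must supply powers at least `a` and `b`. For fixed `a + b` only finitely many `b`
meet a given weight. -/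
theorem lf_diff_mul_vertexOp (f : Fn K) (n : ℤ) :
    LF fun b => Ser₂.diff_mul (vertexOp v f) (n - b) b := by
  refine LF.of_wtGE (fun b => max (n - b) b) (fun b => ?_) fun N => ?_
  · rw [diff_mul_vertexOp]
    rcases max_choice (n - b) b with h | h <;> rw [h]
    · refine WtGE.lsum fun p => ?_
      by_cases hp : p < n - b
      · simp only [shift_of_neg v (1 : K) _ (show p - (n - b) < 0 by omega), mul_zero]
        rw [lsum_zero, mul_zero]
        exact WtGE.zero _
      · exact ((wtGE_expXi v _ p).mul_right _).mono (by omega)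
    · refine WtGE.lsum fun p => WtGE.mul_left (WtGE.lsum fun j => ?_) _
      by_cases hj : j < b
      · rw [shift_of_neg v (-1) _ (show j - b < 0 by omega), shift_zero, mul_zero]
        exact WtGE.zero _
      · exact ((wtGE_expXi v _ j).mul_right _).mono (by omega)
  · refine (Set.finite_Icc (n - N) N).subset fun b hb => ?_
    have := max_le_iff.1 hb.1
    rw [Set.mem_Icc]
    omega

theorem lf_diff_mul_mon_mul (p q n : ℤ) (f : Fn K) :
    LF fun b => Ser₂.diff_mul (Ser₂.mon_mul p q (vertexOp v f)) (n - b) b := by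
  have h := (lf_diff_mul_vertexOp (v := v) f (n - p - q)).comp (Equiv.subRight q).injective
  convert h using 2 with b
  simp only [Ser₂.diff_mul, Ser₂.mon_mul, Equiv.subRight_apply]
  congr 2 <;> ring

/-- Only the flow has a convergent expansion on its own; for the tau side this is assumed after
multiplication by `λ - μ`. So the relations are multiplied first, then summed along the antidiagonal
with binomial weights, and on the flow side the factor is removed again by `diagCoeff_diff_mul`. -/
theorem isDressingDeriv_diagCoeff {A : ℤ → ℤ → MatPair K} {F : ℤ → Ser₂ K}
    (hA : ∀ a b, IsMinus (A a b)) (h1 : ∀ n i j, LF fun b => (A (n - b) b).1 i j)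
    (h2 : ∀ n i j, LF fun b => (A (n - b) b).2 i j)
    (hF : ∀ s n, LF fun b => Ser₂.diff_mul (F s) (n - b) b)
    (h : ∀ a b, IsDressingDeriv S τ (A a b) fun s => F s a b) (m : ℕ) (c : ℤ) {B : MatPair K}
    (hB1 : ∀ i j, B.1 i j = -(m.factorial • Ser₂.diagCoeff m c fun a b => (A a b).1 i j))
    (hB2 : ∀ i j, B.2 i j = -(m.factorial • Ser₂.diagCoeff m c fun a b => (A a b).2 i j)) :
    IsDressingDeriv S τ B fun s =>
      m.factorial • Ser₂.diagCoeff (m + 1) c (Ser₂.diff_mul (F s)) := by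
  -- The combination is the coefficient of `λ^a μ^b` in `(λ - μ)A`.
  have hD : ∀ a b, IsMinus (A (a - 1) b + -A a (b - 1)) := fun a b =>
    ⟨fun i j hij => by simp [(hA _ _).fst i j hij], fun i j hij => by simp [(hA _ _).snd i j hij]⟩
  have e : ∀ a b, IsDressingDeriv S τ (A (a - 1) b + -A a (b - 1))
      fun s => Ser₂.diff_mul (F s) a b := fun a b => by
    have h3 := (h (a - 1) b).add (hA _ _) ?_ ((h a (b - 1)).smul (-1) (hA _ _))
    · rw [neg_one_smul, neg_one_smul] at h3
      convert h3 using 1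
      funext s
      simp [Ser₂.diff_mul, Ser₂.mon_mul, sub_eq_add_neg]
    · rw [neg_one_smul]
      exact (hA _ _).neg
  have hs : ∀ (k : K) {P : MatPair K}, IsMinus P → IsMinus (k • P) := fun k P hP =>
    ⟨fun i j hij => by simp [hP.fst i j hij], fun i j hij => by simp [hP.snd i j hij]⟩
  have hl : ∀ (k : ℤ → K) {f : ℤ → Fn K}, LF f → LF fun b => k b • f b := fun k f hf => by
    simp only [smul_eq_C_mul]
    exact hf.mul_left _
  have hd : ∀ {f : Ser₂ K}, (∀ n, LF fun b => f (n - b) b) → ∀ n,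
      LF fun b => Ser₂.diff_mul f (n - b) b := fun {f} hf n => by
    have h3 := (hf (n - 1)).comp (Equiv.subRight (1 : ℤ)).injective
    have h4 : LF fun b => f (n - b) (b - 1) := by
      simpa only [Equiv.subRight_apply, sub_sub_sub_cancel_right] using h3
    have h5 := (hf (n - 1)).sub h4
    convert h5 using 2 with b
    simp only [Ser₂.diff_mul, Ser₂.mon_mul, sub_zero]
    rw [sub_right_comm]
  have h3 := IsDressingDeriv.infSum
    (A := fun b : ℤ => ((Ring.choose b (m + 1) : ℤ) : K) •
      (A (c + (m + 1 : ℕ) - b - 1) b + -A (c + (m + 1 : ℕ) - b) (b - 1)))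
    (σ := fun b s => ((Ring.choose b (m + 1) : ℤ) : K) •
      Ser₂.diff_mul (F s) (c + (m + 1 : ℕ) - b) b)
    (fun b => hs _ (hD _ _)) (fun i j => hl _ ?_) (fun i j => hl _ ?_)
    (fun s => hl _ (hF s (c + (m + 1 : ℕ)))) fun b => (e _ b).smul _ (hD _ _)
  · have h4 := h3.smul (m.factorial : K) ?_
    · have e1 : ∀ f : Ser₂ K, (lsum fun b : ℤ => ((Ring.choose b (m + 1) : ℤ) : K) •
          Ser₂.diff_mul f (c + (m + 1 : ℕ) - b) b) =
          Ser₂.diagCoeff (m + 1) c (Ser₂.diff_mul f) := fun f => by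
        simp only [Int.cast_smul_eq_zsmul]
        rfl
      convert h4 using 1
      · refine Prod.ext (funext fun i => funext fun j => ?_) (funext fun i => funext fun j => ?_)
        · rw [hB1, ← smul_neg, ← diagCoeff_diff_mul (fun n => h1 n i j), ← e1,
            ← Nat.cast_smul_eq_nsmul K]
          simp [Ser₂.diff_mul, Ser₂.mon_mul, sub_eq_add_neg]
        · rw [hB2, ← smul_neg, ← diagCoeff_diff_mul (fun n => h2 n i j), ← e1,
            ← Nat.cast_smul_eq_nsmul K]
          simp [Ser₂.diff_mul, Ser₂.mon_mul, sub_eq_add_neg]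
      · funext s
        rw [Pi.smul_apply, e1, Nat.cast_smul_eq_nsmul]
    · refine ⟨fun i j hij => ?_, fun i j hij => ?_⟩
      · refine Eq.trans (congrArg lsum (funext fun b => ?_)) lsum_zero
        exact (hs _ (hD _ _)).fst i j hij
      · refine Eq.trans (congrArg lsum (funext fun b => ?_)) lsum_zero
        exact (hs _ (hD _ _)).snd i j hij
  · have h4 := hd (f := fun a b => (A a b).1 i j) (fun n => h1 n i j) (c + (m + 1 : ℕ))
    convert h4 using 2 with b
    simp [Ser₂.diff_mul, Ser₂.mon_mul, sub_eq_add_neg]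
  · have h4 := hd (f := fun a b => (A a b).2 i j) (fun n => h2 n i j) (c + (m + 1 : ℕ))
    convert h4 using 2 with b
    simp [Ser₂.diff_mul, Ser₂.mon_mul, sub_eq_add_neg]

theorem isDressingDeriv_addFlow₁ (hS : S.IsTodaSolution) (hτ : IsTau S τ) (m : ℕ) (k : ℤ) :
    IsDressingDeriv S τ (addFlow₁ S m (m + k)) fun n => m.factorial •
      Ser₂.diagCoeff (m + 1) (-k - m - 1) (Ser₂.diff_mul (vertexX τ n)) := by
  refine isDressingDeriv_diagCoeff (A := alphaFlow₁ S) (F := vertexX τ)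
    (fun _ _ => isMinus_minusPart _) (fun n i j => (lf_alphaFlow₁ S n i j).1)
    (fun n i j => (lf_alphaFlow₁ S n i j).2) (fun s n => ?_)
    (isDressingDeriv_alphaFlow₁ hS hτ) m _ (addFlow₁_fst S m k) (addFlow₁_snd S m k)
  exact lf_diff_mul_mon_mul (-s) s n (τ s)

theorem isDressingDeriv_addFlow₂ (hS : S.IsTodaSolution) (hτ : IsTau S τ) (m : ℕ) (k : ℤ) :
    IsDressingDeriv S τ (addFlow₂ S m (m + k)) fun n => m.factorial •
      Ser₂.diagCoeff (m + 1) (-k - m - 1) (Ser₂.diff_mul (vertexY τ n)) := by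
  refine isDressingDeriv_diagCoeff (A := alphaFlow₂ S) (F := vertexY τ)
    (fun _ _ => isMinus_minusPart _) (fun n i j => (lf_alphaFlow₂ S n i j).1)
    (fun n i j => (lf_alphaFlow₂ S n i j).2) (fun s n => ?_)
    (isDressingDeriv_alphaFlow₂ hS hτ) m _ (addFlow₂_fst S m k) (addFlow₂_snd S m k)
  have e : vertexY τ s = Ser₂.mon_mul (s - 1) (1 - s) (vertexOp true (τ s)) := by
    funext a b
    simp only [vertexY, vertexXtilde, Ser₂.mon_mul]
    congr 1 <;> ring
  rw [e]
  exact lf_diff_mul_mon_mul _ _ n _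

end

end

end Toda

theorem mainTheorem4 {K : Type*} [Field K] [CharZero K]
    (S : Toda.Dressing K) (hS : S.IsTodaSolution)
    (τ : ℤ → Toda.Fn K) (hτ : Toda.IsTau S τ) :
    -- `∂_{α₁} τ = 𝕏(x, λ, μ) τ`, where `∂_{α₁} τ` is defined up to a constant multiple of `τ`
    (∀ σ : ℤ → Toda.Ser₂ K,
      (∀ a b : ℤ, Toda.IsTauDeriv S τ (Toda.alphaFlow₁ S a b) (fun n => σ n a b)) ↔
      ∃ c : ℤ → ℤ → K, ∀ n a b, σ n a b = Toda.vertexX τ n a b + c a b • τ n) ∧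
    -- `∂_{α₂} τ = (μ/λ) 𝕏̃(y, λ, μ) τ`
    (∀ σ : ℤ → Toda.Ser₂ K,
      (∀ a b : ℤ, Toda.IsTauDeriv S τ (Toda.alphaFlow₂ S a b) (fun n => σ n a b)) ↔
      ∃ c : ℤ → ℤ → K, ∀ n a b, σ n a b = Toda.vertexY τ n a b + c a b • τ n) ∧
    -- `∂_{α₁}` and `∂_{α₂}` generate the additional symmetries:
    -- `-∂_{αᵢ} = ∑_m (μ - λ)^m / m! ∑_k λ^{-k-m-1} ∂_{m,m+k}`
    (∀ (m : ℕ) (k i j : ℤ),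
      (Toda.addFlow₁ S m (m + k)).1 i j = -(m.factorial •
        Toda.Ser₂.diagCoeff m (-k - m - 1) fun a b => (Toda.alphaFlow₁ S a b).1 i j) ∧
      (Toda.addFlow₁ S m (m + k)).2 i j = -(m.factorial •
        Toda.Ser₂.diagCoeff m (-k - m - 1) fun a b => (Toda.alphaFlow₁ S a b).2 i j) ∧
      (Toda.addFlow₂ S m (m + k)).1 i j = -(m.factorial •
        Toda.Ser₂.diagCoeff m (-k - m - 1) fun a b => (Toda.alphaFlow₂ S a b).1 i j) ∧
      (Toda.addFlow₂ S m (m + k)).2 i j = -(m.factorial •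
        Toda.Ser₂.diagCoeff m (-k - m - 1) fun a b => (Toda.alphaFlow₂ S a b).2 i j)) ∧
    -- the Adler-Shiota-van Moerbeke formula, for the `x`-type and `y`-type additional symmetries
    (∀ (m : ℕ) (k : ℤ) (σ : ℤ → Toda.Fn K),
      Toda.IsTauDeriv S τ (Toda.addFlow₁ S m (m + k)) σ ↔
      ∃ c : K, ∀ n, σ n = m.factorial •
        Toda.Ser₂.diagCoeff (m + 1) (-k - m - 1) (Toda.Ser₂.diff_mul (Toda.vertexX τ n))
          + c • τ n) ∧
    (∀ (m : ℕ) (k : ℤ) (σ : ℤ → Toda.Fn K),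
      Toda.IsTauDeriv S τ (Toda.addFlow₂ S m (m + k)) σ ↔
      ∃ c : K, ∀ n, σ n = m.factorial •
        Toda.Ser₂.diagCoeff (m + 1) (-k - m - 1) (Toda.Ser₂.diff_mul (Toda.vertexY τ n))
          + c • τ n) := by
  refine ⟨fun σ => ?_, fun σ => ?_, fun m k i j => ⟨Toda.addFlow₁_fst S m k i j,
    Toda.addFlow₁_snd S m k i j, Toda.addFlow₂_fst S m k i j, Toda.addFlow₂_snd S m k i j⟩,
    fun m k σ => ?_, fun m k σ => ?_⟩
  · have h1 := fun a b => Toda.isTauDeriv_iff_of_isDressingDeriv hτ (A := Toda.alphaFlow₁ S a b)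
      (Toda.isMinus_minusPart _) (Toda.isDressingDeriv_alphaFlow₁ hS hτ a b) fun n => σ n a b
    refine ⟨fun h => ?_, fun ⟨c, hc⟩ a b => (h1 a b).2 ⟨c a b, fun s => hc s a b⟩⟩
    choose c hc using fun a b => (h1 a b).1 (h a b)
    exact ⟨c, fun n a b => hc a b n⟩
  · have h1 := fun a b => Toda.isTauDeriv_iff_of_isDressingDeriv hτ (A := Toda.alphaFlow₂ S a b)
      (Toda.isMinus_minusPart _) (Toda.isDressingDeriv_alphaFlow₂ hS hτ a b) fun n => σ n a b
    refine ⟨fun h => ?_, fun ⟨c, hc⟩ a b => (h1 a b).2 ⟨c a b, fun s => hc s a b⟩⟩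
    choose c hc using fun a b => (h1 a b).1 (h a b)
    exact ⟨c, fun n a b => hc a b n⟩
  · exact Toda.isTauDeriv_iff_of_isDressingDeriv hτ (Toda.isMinus_minusPart _).neg
      (Toda.isDressingDeriv_addFlow₁ hS hτ m k) σ
  · exact Toda.isTauDeriv_iff_of_isDressingDeriv hτ (Toda.isMinus_minusPart _).neg
      (Toda.isDressingDeriv_addFlow₂ hS hτ m k) σ
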